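/- **Theorem 5.1.** Let $\Gamma=\mathrm{SL}_2(\mathbb Z)$, let $\mathfrak H^{\pm}$ be the upper and lower half-planes, let $r>0$, and let $v:\Gamma\to\mathbb C^*$ be a multiplier system for the weight $r$; that is, there is a nonzero holomorphic $f:\mathfrak H^+\to\mathbb C$ with $$f(\gamma z)=v(\gamma)(cz+d)^r f(z)\qquad(\gamma=\begin{pmatrix}a&b\\c&d\end{pmatrix}\in\Gamma,\ \arg(cz+d)\in(-\pi,\pi]).\tag{1}$$ Let $S_r(\Gamma,v)$ be the space of cusp forms: the holomorphic solutions $f$ of (1) with $f(z)=O((\operatorname{Im}z)^{-a})$ as $\operatorname{Im}z\to\infty$, for every $a>0$. *Cocycles.* For $f\in S_r(\Gamma,v)$ and $z_1,z_2\in\mathfrak H^+\cup\{\infty\}$ put $$c_f(z_1,z_2;t)=\int_{z_1}^{z_2}f(z)(z-t)^{r-2}\,dz\quad(t\in\mathfrak H^-,\ \arg(z-t)\in(0,\pi)),\qquad c^K_f(z_1,z_2;z)=\overline{c_f(z_1,z_2;\bar z)}\quad(z\in\mathfrak H^+),$$ where a path to $\infty$ is a vertical half-line. *Duality.* Let $s\in\mathbb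 R$. For $h$ on $\mathfrak H^+$ and $f$ on $\mathfrak H^-$ put $h^+(z)=(-i-z)^s h(z)$ and $f^-(t)=(i-t)^s f(t)$, with $\arg(-i-z)\in(-\pi,0)$ and $\arg(i-t)\in(0,\pi)$. Suppose that $h$ is holomorphic on $\mathfrak H^+$. If $s\notin\mathbb Z_{\le0}$, suppose that $f^-$ extends holomorphically to a neighbourhood of $\mathfrak H^-\cup\mathbb P^1(\mathbb R)$ in $\mathbb P^1(\mathbb C)$; if $s\in\mathbb Z_{\le 0}$, suppose that $f^-$ is a polynomial in $\frac{t+i}{t-i}$ of degree at most $|s|$. Define $$[h,f]_s=\frac1\pi\int_{C}h^+(z)\,\sigma_sf^-(z)\,\frac{dz}{(z+i)^2}.$$ Here, for $s\notin\mathbb Z_{\le0}$, $$\sigma_sf^-(z)=\frac1\pi\,\frac{z+i}{z-i}\int_{C'}f^-(\tau)\;{}_2F_1\Bigl(1,1;s;\frac{(\tau-i)(z+i)}{(\tau+i)(z-i)}\Bigr)\frac{d\tau}{\tau^2+1},$$ and for $s\in\mathbb Z_{\le0}$, $\sigma_s$ is the linear map determined by $$\sigma_s\Bigl(\frac{z-i}{z+i}\Bigr)^{-k}=\frac{k!}{(s)_k}\Bigl(\frac{z-i}{z+i}\Bigr)^{-k-1}\qquad(0\le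 k\le|s|),$$ with $(s)_k$ the Pochhammer symbol. The contours $C$ and $C'$ are positively oriented circles $\bigl|\frac{z-i}{z+i}\bigr|=c_2$ and $\bigl|\frac{\tau-i}{\tau+i}\bigr|=c_1$ with $0<c_1<c_2<1$, where $c_1$ is so close to $1$ that $f^-$ is holomorphic on $\bigl|\frac{\tau-i}{\tau+i}\bigr|\ge c_1$. (In the case $s\in\mathbb Z_{\le0}$ only $C$ occurs, with any $0<c_2<1$.) *Statement.* Let $\rho=e^{\pi i/3}$. For all $f_1,f_2\in S_r(\Gamma,v)$ the integral defining $c^K_{f_2}(i,\infty)$ converges absolutely, the pair $\bigl(c^K_{f_2}(i,\infty),c_{f_1}(\rho-1,\rho)\bigr)$ satisfies the above conditions for $s=2-r$ (in addition $c_{f_1}(\rho-1,\rho)^-$ extends holomorphically to a neighbourhood of $\mathfrak H^-\cup\mathbb P^1(\mathbb R)$ for every $r>0$), the Petersson integral converges absolutely, and $$\bigl[c^K_{f_2}(i,\infty),\,c_{f_1}(\rho-1,\rho)\bigr]_{2-r}=-2i\,(f_1,f_2)_r:=-2i\int_{\Gamma\backslash\mathfrak H^+}f_1(\tau)\,\overline{f_2(\tau)}\,y^r\,\frac{dx\,dy}{y^2}\qquad(\tau=x+iy).$$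 -/

import Mathlib

open scoped MatrixGroups ComplexConjugate Modular
open MeasureTheory

noncomputable section

namespace Haberland

/-! ### Modular forms of real weight on `SL(2, ℤ)` -/

/-- `f` is a holomorphic modular form of real weight `r` with multiplier `v`, without any growth
condition at the cusp: `f (γ z) = v γ (c z + d) ^ r f z`. The power is the principal one, with
`arg (c z + d) ∈ (-π, π]`. -/
structure IsModularForm (r : ℝ) (v : SL(2, ℤ) → ℂˣ) (f : UpperHalfPlane → ℂ) : Prop where
  holo : DifferentiableOn ℂ (fun z : ℂ => f (UpperHalfPlane.ofComplex z)) {z : ℂ | 0 < z.im}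
  transf : ∀ (γ : SL(2, ℤ)) (z : UpperHalfPlane),
    f (γ • z) = (v γ : ℂ) * (((γ 1 0 : ℤ) : ℂ) * (z : ℂ) + ((γ 1 1 : ℤ) : ℂ)) ^ (r : ℂ) * f z

/-- `v` is a multiplier system for the weight `r`: the transformation law has a nonzero holomorphic
solution. -/
def IsMultiplierSystem (r : ℝ) (v : SL(2, ℤ) → ℂˣ) : Prop :=
  ∃ f : UpperHalfPlane → ℂ, f ≠ 0 ∧ IsModularForm r v f

/-- Cusp forms: modular forms with quick decay, `f z = O ((im z) ^ (-a))` as `im z → ∞`,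
for every `a`. -/
structure IsCuspForm (r : ℝ) (v : SL(2, ℤ) → ℂˣ) (f : UpperHalfPlane → ℂ) : Prop
    extends IsModularForm r v f where
  decay : ∀ a : ℝ, f =O[UpperHalfPlane.atImInfty] fun z : UpperHalfPlane => z.im ^ (-a)

/-- The Petersson scalar product: `∫ f₁ (conj f₂) y ^ r dx dy / y ^ 2` over the standard fundamental
domain. Mathlib's volume on the upper half-plane is `dx dy / y ^ 2`. -/
def peterssonProduct (r : ℝ) (f₁ f₂ : UpperHalfPlane → ℂ) : ℂ :=
  ∫ τ in 𝒟, f₁ τ * conj (f₂ τ) * ((τ.im ^ r : ℝ) : ℂ)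

/-! ### Eichler and Knopp cocycles

Functions on the lower or upper half-plane are functions `ℂ → ℂ`, of which only the values on that
half-plane are used. -/

/-- The integrand `f z (z - t) ^ (r - 2)`. For `z` in the upper and `t` in the lower half-plane
the principal power has `arg (z - t) ∈ (0, π)`. -/
def eichlerIntegrand (r : ℝ) (f : UpperHalfPlane → ℂ) (t z : ℂ) : ℂ :=
  f (UpperHalfPlane.ofComplex z) * (z - t) ^ ((r : ℂ) - 2)

/-- `c_f (z₁, z₂; t) = ∫ f z (z - t) ^ (r - 2) dz` for `z₁, z₂` in the upper half-plane. The integrand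
is holomorphic there, and the path is taken to be the straight segment. -/
def eichler (r : ℝ) (f : UpperHalfPlane → ℂ) (z₁ z₂ : ℂ) (t : ℂ) : ℂ :=
  ∫ u in (0 : ℝ)..1, eichlerIntegrand r f t (z₁ + (u : ℂ) * (z₂ - z₁)) * (z₂ - z₁)

/-- `c_f (z₁, ∞; t)`, along the vertical half-line from `z₁` to the cusp `∞`. -/
def eichlerInfty (r : ℝ) (f : UpperHalfPlane → ℂ) (z₁ : ℂ) (t : ℂ) : ℂ :=
  ∫ y in Set.Ioi z₁.im, eichlerIntegrand r f t ((z₁.re : ℂ) + (y : ℂ) * Complex.I) * Complex.I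

/-- `(ι f) z = conj (f (conj z))`, interchanging functions on the two half-planes. -/
def iota (f : ℂ → ℂ) (z : ℂ) : ℂ := conj (f (conj z))

/-- The value `c^K_f (z₁, ∞)` of the Knopp cocycle, a function on the upper half-plane. -/
def knoppInfty (r : ℝ) (f : UpperHalfPlane → ℂ) (z₁ : ℂ) : ℂ → ℂ :=
  iota (eichlerInfty r f z₁)

/-! ### The duality -/

/-- `h⁺ z = (-i - z) ^ s h z`, for `h` on the upper half-plane. -/
def plusPart (s : ℝ) (h : ℂ → ℂ) (z : ℂ) : ℂ := (-Complex.I - z) ^ (s : ℂ) * h z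

/-- `f⁻ t = (i - t) ^ s f t`, for `f` on the lower half-plane. -/
def minusPart (s : ℝ) (f : ℂ → ℂ) (t : ℂ) : ℂ := (Complex.I - t) ^ (s : ℂ) * f t

/-- The disk coordinate `w = (z - i) / (z + i)`. -/
def diskCoord (z : ℂ) : ℂ := (z - Complex.I) / (z + Complex.I)

/-- The integral over the positively oriented circle `|(z - i) / (z + i)| = c` in the upper
half-plane, `0 < c < 1`, which has Euclidean centre `i (1 + c²) / (1 - c²)` and radius
`2 c / (1 - c²)`, and encircles `i`. -/
def diskContour (c : ℝ) (F : ℂ → ℂ) : ℂ :=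
  ∮ z in C((((1 + c ^ 2) / (1 - c ^ 2) : ℝ) : ℂ) * Complex.I, 2 * c / (1 - c ^ 2)), F z

/-- `s ∈ {0, -1, -2, …}`. -/
def IsNonposInt (s : ℝ) : Prop := ∃ n : ℕ, s = -(n : ℝ)

/-- `g` is a holomorphic extension of `f⁻` from the lower half-plane to the region
`|(z - i) / (z + i)| > c` of the Riemann sphere (including the point `∞`), with `0 < c < 1`. -/
structure IsExtension (s : ℝ) (f : ℂ → ℂ) (c : ℝ) (g : ℂ → ℂ) : Prop where
  pos : 0 < c
  lt_one : c < 1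
  holo : DifferentiableOn ℂ g {t : ℂ | c * ‖t + Complex.I‖ < ‖t - Complex.I‖}
  holo_infty : ∃ G : ℂ → ℂ, AnalyticAt ℂ G 0 ∧ ∀ᶠ t in Filter.cocompact ℂ, g t = G (-1 / t)
  eq_minusPart : ∀ t : ℂ, t.im < 0 → g t = minusPart s f t

/-- Analytic vectors `D^ω`: functions `f` on the lower half-plane for which `f⁻` extends
holomorphically to a neighbourhood of the closure of the lower half-plane in the Riemann sphere.
By compactness such a neighbourhood contains a region as in `IsExtension`. -/
def IsAnalyticVector (s : ℝ) (f : ℂ → ℂ) : Prop := ∃ p : ℝ × (ℂ → ℂ), IsExtension s f p.1 p.2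

/-- `d` is the sequence of coefficients of `f⁻` as a polynomial in `(t + i) / (t - i)` of degree at
most `|s|`, for `s ∈ {0, -1, -2, …}`. -/
def IsPolExpansion (s : ℝ) (f : ℂ → ℂ) (d : ℕ → ℂ) : Prop :=
  ∀ t : ℂ, t.im < 0 → minusPart s f t =
    ∑ k ∈ Finset.range (⌊-s⌋₊ + 1), d k * ((t + Complex.I) / (t - Complex.I)) ^ k

/-- The module `D^pol`, for `s ∈ {0, -1, -2, …}`. -/
def IsPolVector (s : ℝ) (f : ℂ → ℂ) : Prop := ∃ d : ℕ → ℂ, IsPolExpansion s f d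

open Classical in
/-- A radius `c` and a holomorphic extension of `f⁻` to `|(z - i) / (z + i)| > c`. -/
def extension (s : ℝ) (f : ℂ → ℂ) : ℝ × (ℂ → ℂ) :=
  if hf : IsAnalyticVector s f then hf.choose else 0

open Classical in
/-- The coefficients of `f⁻` for `f` in `D^pol`. -/
def polCoeff (s : ℝ) (f : ℂ → ℂ) : ℕ → ℂ :=
  if hf : IsPolVector s f then hf.choose else 0

open Classical in
/-- `sigmaOp s f` is defined on the part of the disk outside this radius (in the disk coordinate). -/
def innerRadius (s : ℝ) (f : ℂ → ℂ) : ℝ :=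
  if IsNonposInt s then 0 else (extension s f).1

open Classical in
/-- The function `σ_s f⁻` on `innerRadius s f < |(z - i) / (z + i)| < 1`.
If `s ∉ {0, -1, -2, …}` it is
`(1 / π) (z + i) / (z - i) ∫_C f⁻(τ) ₂F₁(1, 1; s; (τ - i)(z + i) / ((τ + i)(z - i))) dτ / (τ² + 1)`
where `C` lies in the region where the extension of `f⁻` is holomorphic and `z` is outside `C`.
If `s ∈ {0, -1, -2, …}` it is determined by
`((z - i) / (z + i)) ^ (-k) ↦ (k! / (s)_k) ((z - i) / (z + i)) ^ (-k - 1)` for `0 ≤ k ≤ |s|`. -/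
def sigmaOp (s : ℝ) (f : ℂ → ℂ) (z : ℂ) : ℂ :=
  if IsNonposInt s then
    ∑ k ∈ Finset.range (⌊-s⌋₊ + 1),
      polCoeff s f k * ((k.factorial : ℂ) / (ascPochhammer ℂ k).eval (s : ℂ)) *
        ((z + Complex.I) / (z - Complex.I)) ^ (k + 1)
  else
    (1 / (Real.pi : ℂ)) * ((z + Complex.I) / (z - Complex.I)) *
      diskContour ((innerRadius s f + ‖diskCoord z‖) / 2) (fun τ : ℂ =>
        (extension s f).2 τ *
          ordinaryHypergeometric (1 : ℂ) 1 (s : ℂ)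
            (((τ - Complex.I) * (z + Complex.I)) / ((τ + Complex.I) * (z - Complex.I))) /
          (τ ^ 2 + 1))

/-- The bilinear form `[h, f]_s = (1 / π) ∫_C h⁺(z) σ_s f⁻(z) dz / (z + i)²`, where `C` is a positively
oriented circle in the upper half-plane around `i`, in the domain of `σ_s f⁻`. -/
def duality (s : ℝ) (h f : ℂ → ℂ) : ℂ :=
  (1 / (Real.pi : ℂ)) * diskContour ((1 + innerRadius s f) / 2) (fun z : ℂ =>
    plusPart s h z * sigmaOp s f z / (z + Complex.I) ^ 2)

/-- The pairs `(h, f)` on which `[h, f]_s` is defined: `h` is holomorphic on the upper half-plane, and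
`f` is in `D^ω`, respectively in `D^pol` if `s ∈ {0, -1, -2, …}`. -/
structure InDualityDomain (s : ℝ) (h f : ℂ → ℂ) : Prop where
  holo : DifferentiableOn ℂ h {z : ℂ | 0 < z.im}
  analytic : IsAnalyticVector s f
  pol : IsNonposInt s → IsPolVector s f

/-- `ρ = e^{π i / 3}`. -/
def rho : ℂ := Complex.exp ((Real.pi : ℂ) * Complex.I / 3)

end Haberland

end

noncomputable section

namespace Haberland

open Set Filter Topology Complex

/-! ### Analysis on the upper half-plane -/

/-! Write p = r - 2 and s = -p. Both sides are reduced to the integral of f₁ times the Knopp value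
c^K(i, ∞) over the segment from ρ - 1 to ρ.

Petersson side (`petersson_eq_integral_segment`). Let G(z) be the conjugate of the integral of
f₂(τ)(τ - conj z)^p dτ from z to ∞. Only its antiholomorphic derivative -(-2i)^p y^p conj f₂(z)
matters in d(f₁ G dz) (`RapidDecay.hasFDerivAt_conjEichler`). Apply Stokes on the fundamental domain
(`integral_domainMap`). The vertical sides cancel because the multiplier of T has modulus 1, and the
cusp contributes nothing by rapid decay. So -2i(-2i)^p (f₁, f₂) is the integral of f₁ G dz over the
unit arc from ρ - 1 to ρ. Split the path of G at i. The part from z to i has weight -p under S,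
since S fixes i (`RapidDecay.conjEichlerBased_neg_inv`). Multiplied by f₁ dz it is S-invariant,
while S reverses the arc, so it integrates to 0 (`integral_arc_eq_zero`). The part from i to ∞ is
the holomorphic Knopp value, and for it the arc may be straightened.

Duality side (`duality_eq_integral`). In the disk coordinate, with ζ on the image of the segment and
q = (t + i)/(t - i), the function f⁻ is the integral of m(1 - ζq)^(-s), where m = f₁(1 - ζ)^s
(`minusPart_eichler`). Its coefficients are (s)_k/k! times the moments M_k = ∫ m ζ^k. The operator
σ_s removes the factor (s)_k/k! and leaves Σ M_k w^(-k-1) (`hasSum_sigmaOp`). Pairing with h⁺ = Σ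
b_k w^k gives Σ M_k b_k = ∫ m h⁺(ζ). Since (1 - ζ)^s(-i - z)^s = (-2i)^s, this is (-2i)^s times the
segment integral, and (-2i)^s(-2i)^p = 1.

If s = -n, then σ_s keeps only M_0, ..., M_n. Nothing is lost, because h⁺ is then a polynomial of
degree at most n in w (`RapidDecay.exists_hasSum_plusPart_knoppAtI`). -/

lemma rpow_le_of_mem_Icc {X y M : ℝ} (p : ℝ) (hy : 0 < y) (h₁ : y ≤ X) (h₂ : X ≤ M * y)
    (hM : 1 ≤ M) : X ^ p ≤ M ^ |p| * y ^ p := by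
  rcases le_total 0 p with hp | hp
  · rw [abs_of_nonneg hp, ← Real.mul_rpow (by linarith) hy.le]
    exact Real.rpow_le_rpow (by linarith) h₂ hp
  · calc X ^ p ≤ y ^ p := Real.rpow_le_rpow_of_nonpos hy h₁ hp
      _ ≤ M ^ |p| * y ^ p :=
        le_mul_of_one_le_left (Real.rpow_nonneg hy.le _) (Real.one_le_rpow hM (abs_nonneg _))

lemma isOpen_im_pos : IsOpen {z : ℂ | 0 < z.im} := isOpen_lt continuous_const continuous_im

/-- A holomorphic function on the upper half-plane has a primitive. -/
lemma exists_primitive {F : ℂ → ℂ} (hF : DifferentiableOn ℂ F {z : ℂ | 0 < z.im}) :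
    ∃ P : ℂ → ℂ, ∀ z : ℂ, 0 < z.im → HasDerivAt P (F z) z := by
  -- The half-plane is transported to the unit disk by z = i(1 + w)/(1 - w), because a holomorphic
  -- function on a ball is exact; the factor 2i/(1 - w)² below is dz/dw.
  have him : ∀ w ∈ Metric.ball (0 : ℂ) 1, 0 < (I * (1 + w) / (1 - w)).im ∧ 1 - w ≠ 0 := by
    intro w hw
    have hw' : ‖w‖ < 1 := by simpa using hw
    have h1 : 1 - w ≠ 0 := by
      intro h
      rw [← sub_eq_zero.mp h] at hw'
      simp at hw'
    refine ⟨?_, h1⟩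
    have h2 : 0 < normSq (1 - w) := normSq_pos.mpr h1
    have h3 : w.re * w.re + w.im * w.im < 1 := by
      rw [← normSq_apply, normSq_eq_norm_sq]; nlinarith [norm_nonneg w]
    rw [div_im]
    simp only [mul_re, mul_im, I_re, I_im, add_re, add_im, one_re, one_im, sub_re, sub_im]
    rw [← sub_div]
    apply div_pos _ h2
    nlinarith
  have hd : DifferentiableOn ℂ (fun w : ℂ => F (I * (1 + w) / (1 - w)) * (2 * I / (1 - w) ^ 2))
      (Metric.ball 0 1) := by
    refine DifferentiableOn.mul ?_ ?_
    · refine hF.comp (t := {z : ℂ | 0 < z.im}) ?_ fun w hw => (him w hw).1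
      exact DifferentiableOn.div (by fun_prop) (by fun_prop) fun w hw => (him w hw).2
    · exact DifferentiableOn.div (by fun_prop) (by fun_prop)
        fun w hw => pow_ne_zero 2 (him w hw).2
  obtain ⟨Q, hQ⟩ := hd.isExactOn_ball
  refine ⟨fun z => Q ((z - I) / (z + I)), fun z hz => ?_⟩
  have hz1 : z + I ≠ 0 := by
    intro h
    have := congrArg im h
    simp at this; linarith
  have hmem : (z - I) / (z + I) ∈ Metric.ball (0 : ℂ) 1 := by
    rw [mem_ball_zero_iff, norm_div, div_lt_one (norm_pos_iff.mpr hz1)]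
    apply lt_of_pow_lt_pow_left₀ 2 (norm_nonneg _)
    rw [← normSq_eq_norm_sq, ← normSq_eq_norm_sq, normSq_apply, normSq_apply]
    simp only [sub_re, sub_im, add_re, add_im, I_re, I_im]
    nlinarith
  have h1 : 1 - (z - I) / (z + I) = 2 * I / (z + I) := by field_simp; ring
  have h2 : I * (1 + (z - I) / (z + I)) / (1 - (z - I) / (z + I)) = z := by
    rw [h1]; field_simp; ring
  have hder : HasDerivAt (fun z : ℂ => (z - I) / (z + I)) (2 * I / (z + I) ^ 2) z := by
    refine (((hasDerivAt_id z).sub_const I).fun_div ((hasDerivAt_id z).add_const I)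
      hz1).congr_deriv ?_
    simp only [id]; ring
  refine ((hQ _ hmem).comp z hder).congr_deriv ?_
  beta_reduce
  rw [h2, h1]
  field_simp

/-- Holomorphic functions on the upper half-plane that decay faster than any power at the cusp,
uniformly in the strip `|re z| ≤ 1`. -/
structure RapidDecay (F : ℂ → ℂ) : Prop where
  holo : DifferentiableOn ℂ F {z : ℂ | 0 < z.im}
  decay : ∀ y₀ : ℝ, 0 < y₀ → ∀ a : ℝ, ∃ C : ℝ, 0 ≤ C ∧
    ∀ z : ℂ, |z.re| ≤ 1 → y₀ ≤ z.im → ‖F z‖ ≤ C * z.im ^ (-a)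

/-- The growth condition controls f above some height A, uniformly in the real part. Between y₀ and
A the strip is a compact rectangle, on which f·y^a is bounded by continuity. -/
lemma IsCuspForm.rapidDecay {r : ℝ} {v : SL(2, ℤ) → ℂˣ} {f : UpperHalfPlane → ℂ}
    (hf : IsCuspForm r v f) : RapidDecay (fun z => f (UpperHalfPlane.ofComplex z)) := by
  refine ⟨hf.holo, fun y₀ hy₀ a => ?_⟩
  obtain ⟨c, hc⟩ := (hf.decay a).bound
  obtain ⟨A, hA⟩ := (UpperHalfPlane.atImInfty_mem _).mp hc
  have hcomp : IsCompact (Icc (-1 : ℝ) 1 ×ℂ Icc y₀ (max A y₀)) :=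
    isCompact_Icc.reProdIm isCompact_Icc
  have hcont : ContinuousOn (fun z => f (UpperHalfPlane.ofComplex z) * ((z.im ^ a : ℝ) : ℂ))
      (Icc (-1 : ℝ) 1 ×ℂ Icc y₀ (max A y₀)) := by
    refine ContinuousOn.mul (hf.holo.continuousOn.mono fun z hz => ?_) ?_
    · exact hy₀.trans_le hz.2.1
    · refine continuous_ofReal.comp_continuousOn ?_
      refine ContinuousOn.rpow_const continuous_im.continuousOn fun z hz => ?_
      exact Or.inl (hy₀.trans_le hz.2.1).ne'
  obtain ⟨B, hB⟩ := hcomp.exists_bound_of_continuousOn hcont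
  refine ⟨max 0 (max c B), le_max_left _ _, fun z hx hy => ?_⟩
  have hz : 0 < z.im := hy₀.trans_le hy
  have hpos : 0 < z.im ^ (-a) := Real.rpow_pos_of_pos hz _
  by_cases h : A ≤ z.im
  · have := hA (UpperHalfPlane.ofComplex z) (by
      rw [UpperHalfPlane.ofComplex_apply_of_im_pos hz]; exact h)
    simp only [mem_ofPred_eq] at this
    rw [UpperHalfPlane.ofComplex_apply_of_im_pos hz] at this ⊢
    refine this.trans ?_
    have him : UpperHalfPlane.im ⟨z, hz⟩ = z.im := rfl
    rw [him, Real.norm_of_nonneg hpos.le]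
    exact mul_le_mul_of_nonneg_right ((le_max_left _ _).trans (le_max_right _ _)) hpos.le
  · have := hB z ⟨abs_le.mp hx, hy, le_max_of_le_left (le_of_not_ge h)⟩
    rw [norm_mul, norm_real, Real.norm_of_nonneg (Real.rpow_nonneg hz.le _)] at this
    rw [Real.rpow_neg hz.le, ← div_eq_mul_inv, le_div_iff₀ (Real.rpow_pos_of_pos hz _)]
    exact this.trans ((le_max_right _ _).trans (le_max_right _ _))

/-! ### Vertical Eichler integrals -/

lemma sub_mem_slitPlane {z t : ℂ} (hz : 0 < z.im) (ht : t.im ≤ 0) : z - t ∈ slitPlane := by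
  right
  rw [sub_im]; linarith

/-- When |z - t| is comparable with y = im z, the power costs only a factor y^p, which decay of
order b + p absorbs. It serves both for bounded t and for t = conj z. -/
lemma RapidDecay.exists_norm_mul_cpow_le {F : ℂ → ℂ} (hF : RapidDecay F) (p b : ℝ) {y₀ M : ℝ}
    (hy₀ : 0 < y₀) (hM : 1 ≤ M) : ∃ C : ℝ, 0 ≤ C ∧ ∀ t z : ℂ, |z.re| ≤ 1 → y₀ ≤ z.im →
      z.im ≤ ‖z - t‖ → ‖z - t‖ ≤ M * z.im → ‖F z * (z - t) ^ (p : ℂ)‖ ≤ C * z.im ^ (-b) := by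
  obtain ⟨C, hC, h⟩ := hF.decay y₀ hy₀ (b + p)
  refine ⟨C * M ^ |p|, by positivity, fun t z hx hy h₁ h₂ => ?_⟩
  have hz : 0 < z.im := hy₀.trans_le hy
  rw [norm_mul, norm_cpow_real]
  calc ‖F z‖ * ‖z - t‖ ^ p ≤ (C * z.im ^ (-(b + p))) * (M ^ |p| * z.im ^ p) :=
        mul_le_mul (h z hx hy) (rpow_le_of_mem_Icc p hz h₁ h₂ hM) (by positivity) (by positivity)
    _ = C * M ^ |p| * (z.im ^ (-(b + p)) * z.im ^ p) := by ring
    _ = _ := by rw [← Real.rpow_add hz]; ring_nf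

lemma im_le_norm_sub {z t : ℂ} (ht : t.im ≤ 0) : z.im ≤ ‖z - t‖ := by
  have := (le_abs_self _).trans (abs_im_le_norm (z - t))
  rw [sub_im] at this; linarith

lemma RapidDecay.exists_norm_mul_cpow_le_of_norm_le {F : ℂ → ℂ} (hF : RapidDecay F) (p b : ℝ)
    {y₀ T : ℝ} (hy₀ : 0 < y₀) (hT : 0 ≤ T) : ∃ C : ℝ, 0 ≤ C ∧ ∀ t z : ℂ, t.im ≤ 0 → ‖t‖ ≤ T →
      |z.re| ≤ 1 → y₀ ≤ z.im → ‖F z * (z - t) ^ (p : ℂ)‖ ≤ C * z.im ^ (-b) := by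
  -- The value of M comes from |z - t| ≤ 1 + y + T and 1 + T ≤ ((1 + T)/y₀)·y.
  obtain ⟨C, hC, h⟩ := hF.exists_norm_mul_cpow_le p b (M := 1 + (1 + T) / y₀) hy₀
    (by have : 0 ≤ (1 + T) / y₀ := by positivity
        linarith)
  refine ⟨C, hC, fun t z ht htT hx hy => h t z hx hy (im_le_norm_sub ht) ?_⟩
  have h1 : ‖z - t‖ ≤ (|z.re| + |z.im|) + T :=
    (norm_sub_le _ _).trans (add_le_add (norm_le_abs_re_add_abs_im z) htT)
  rw [abs_of_pos (hy₀.trans_le hy)] at h1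
  have h2 : 1 + T ≤ (1 + T) / y₀ * z.im := by
    rw [div_mul_eq_mul_div, le_div_iff₀ hy₀]
    exact mul_le_mul_of_nonneg_left hy (by positivity)
  linarith

/-- The integral of `F τ (τ - t) ^ p dτ` along the vertical half-line from `z` to the cusp. -/
def verticalIntegral (F : ℂ → ℂ) (p : ℝ) (t z : ℂ) : ℂ :=
  ∫ y in Ioi z.im, F ((z.re : ℂ) + (y : ℂ) * I) * ((z.re : ℂ) + (y : ℂ) * I - t) ^ (p : ℂ) * I

lemma differentiableOn_mul_cpow {F : ℂ → ℂ} (hF : DifferentiableOn ℂ F {z : ℂ | 0 < z.im}) (p : ℂ)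
    {t : ℂ} (ht : t.im ≤ 0) :
    DifferentiableOn ℂ (fun z => F z * (z - t) ^ p) {z : ℂ | 0 < z.im} :=
  hF.mul (DifferentiableOn.cpow_const (by fun_prop) fun _ hz => sub_mem_slitPlane hz ht)

lemma continuousOn_vertical {g : ℂ → ℂ} (hg : ContinuousOn g {z : ℂ | 0 < z.im}) (x : ℝ) {y₀ : ℝ}
    (hy₀ : 0 ≤ y₀) : ContinuousOn (fun y : ℝ => g ((x : ℂ) + (y : ℂ) * I)) (Ioi y₀) :=
  hg.comp (by fun_prop) fun y hy => by simpa using hy₀.trans_lt hy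

lemma RapidDecay.integrableOn_vertical {F : ℂ → ℂ} (hF : RapidDecay F) (p : ℝ) {t : ℂ}
    (ht : t.im ≤ 0) {x y₀ : ℝ} (hx : |x| ≤ 1) (hy₀ : 0 < y₀) :
    IntegrableOn (fun y : ℝ => F ((x : ℂ) + (y : ℂ) * I) * ((x : ℂ) + (y : ℂ) * I - t) ^ (p : ℂ))
      (Ioi y₀) := by
  obtain ⟨C, hC, h⟩ := hF.exists_norm_mul_cpow_le_of_norm_le p 2 hy₀ (norm_nonneg t)
  refine Integrable.mono' ((integrableOn_Ioi_rpow_of_lt (a := -2) (by norm_num) hy₀).const_mul C)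
    ?_ ?_
  · exact (continuousOn_vertical (differentiableOn_mul_cpow hF.holo p ht).continuousOn x
      hy₀.le).aestronglyMeasurable measurableSet_Ioi
  · refine (ae_restrict_iff' measurableSet_Ioi).mpr (Eventually.of_forall fun y hy => ?_)
    have := h t ((x : ℂ) + (y : ℂ) * I) ht le_rfl (by simpa using hx) (by simpa using le_of_lt hy)
    simpa using this

lemma hasDerivAt_vertical {P : ℂ → ℂ} {P' : ℂ} {x y : ℝ}
    (h : HasDerivAt P P' ((x : ℂ) + (y : ℂ) * I)) :
    HasDerivAt (fun y : ℝ => P ((x : ℂ) + (y : ℂ) * I)) (P' * I) y := by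
  have h1 : HasDerivAt (fun y : ℝ => (x : ℂ) + (y : ℂ) * I) I y := by
    simpa using ((hasDerivAt_id y).ofReal_comp.mul_const I).const_add (x : ℂ)
  exact h.comp y h1

/-- In the strip `|re z| ≤ 1` the vertical integral differs by the sign and a constant from a
primitive. -/
lemma RapidDecay.exists_verticalIntegral_eq {F : ℂ → ℂ} (hF : RapidDecay F) (p : ℝ) {t : ℂ}
    (ht : t.im ≤ 0) {P : ℂ → ℂ}
    (hP : ∀ z : ℂ, 0 < z.im → HasDerivAt P (F z * (z - t) ^ (p : ℂ)) z) :
    ∃ L : ℂ, ∀ z : ℂ, |z.re| ≤ 1 → 0 < z.im → verticalIntegral F p t z = L - P z := by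
  have hint : ∀ x : ℝ, |x| ≤ 1 → ∃ L, Tendsto (fun y : ℝ => P ((x : ℂ) + (y : ℂ) * I)) atTop (𝓝 L)
      ∧ ∀ y₀ : ℝ, 0 < y₀ → ∫ y in Ioi y₀, F ((x : ℂ) + (y : ℂ) * I) *
        ((x : ℂ) + (y : ℂ) * I - t) ^ (p : ℂ) * I = L - P ((x : ℂ) + (y₀ : ℂ) * I) := by
    intro x hx
    have hder : ∀ y : ℝ, 0 < y → HasDerivAt (fun y : ℝ => P ((x : ℂ) + (y : ℂ) * I))
        (F ((x : ℂ) + (y : ℂ) * I) * ((x : ℂ) + (y : ℂ) * I - t) ^ (p : ℂ) * I) y :=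
      fun y hy => hasDerivAt_vertical (hP _ (by simpa using hy))
    have hL := tendsto_limUnder_of_hasDerivAt_of_integrableOn_Ioi (a := 1)
      (fun y hy => hder y (one_pos.trans hy))
      ((hF.integrableOn_vertical p ht hx one_pos).mul_const I)
    refine ⟨_, hL, fun y₀ hy₀ => ?_⟩
    exact integral_Ioi_of_hasDerivAt_of_tendsto' (fun y hy => hder y (hy₀.trans_le hy))
      ((hF.integrableOn_vertical p ht hx hy₀).mul_const I) hL
  obtain ⟨L, hL, -⟩ := hint 0 (by simp)
  refine ⟨L, fun z hx hz => ?_⟩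
  obtain ⟨L', hL', h'⟩ := hint z.re hx
  -- The limits along two verticals agree: at height y they are joined by a horizontal segment of
  -- length at most 1, on which the derivative of P is O(1/y).
  have heq : L' = L := by
    obtain ⟨C, hC, h⟩ := hF.exists_norm_mul_cpow_le_of_norm_le p 1 one_pos (norm_nonneg t)
    have hlim : Tendsto (fun y : ℝ => P ((z.re : ℂ) + (y : ℂ) * I) - P (((0 : ℝ) : ℂ) + (y : ℂ) * I))
        atTop (𝓝 0) := by
      refine squeeze_zero_norm' (a := fun y => C * y ^ (-1 : ℝ)) ?_ ?_
      · filter_upwards [eventually_ge_atTop 1] with y hy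
        have hconv : Convex ℝ (Icc (-1 : ℝ) 1 ×ℂ {y}) :=
          ((convex_Icc (-1 : ℝ) 1).linear_preimage reLm).inter
            ((convex_singleton y).linear_preimage imLm)
        have := hconv.norm_image_sub_le_of_norm_hasDerivWithin_le (𝕜 := ℂ) (f := P)
          (f' := fun z => F z * (z - t) ^ (p : ℂ)) (C := C * y ^ (-1 : ℝ))
          (x := ((0 : ℝ) : ℂ) + (y : ℂ) * I) (y := (z.re : ℂ) + (y : ℂ) * I) ?_ ?_ ?_ ?_
        · refine this.trans ?_
          refine mul_le_of_le_one_right (by positivity) ?_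
          have e : (z.re : ℂ) + (y : ℂ) * I - (((0 : ℝ) : ℂ) + (y : ℂ) * I) = (z.re : ℂ) := by
            push_cast; ring
          rw [e, norm_real]; exact hx
        · rintro w ⟨-, hw⟩
          have hw : w.im = y := hw
          exact (hP w (by rw [hw]; linarith)).hasDerivWithinAt
        · rintro w ⟨hw1, hw⟩
          have hw : w.im = y := hw
          rw [← hw]
          exact h t w ht le_rfl (abs_le.mpr hw1) (by rw [hw]; linarith)
        · exact ⟨by simp, by simp⟩
        · exact ⟨by simpa using abs_le.mp hx, by simp⟩
      · simpa using (tendsto_rpow_neg_atTop (y := 1) one_pos).const_mul C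
    have := tendsto_nhds_unique hlim (hL'.sub (by simpa using hL))
    exact (sub_eq_zero.mp this.symm)
  rw [verticalIntegral, h' _ hz, heq, re_add_im]

lemma RapidDecay.hasDerivAt_verticalIntegral {F : ℂ → ℂ} (hF : RapidDecay F) (p : ℝ) {t z : ℂ}
    (ht : t.im ≤ 0) (hx : |z.re| < 1) (hz : 0 < z.im) :
    HasDerivAt (verticalIntegral F p t) (-(F z * (z - t) ^ (p : ℂ))) z := by
  obtain ⟨P, hP⟩ := exists_primitive (differentiableOn_mul_cpow hF.holo p ht)
  obtain ⟨L, hL⟩ := hF.exists_verticalIntegral_eq p ht hP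
  have h1 := (hP z hz).const_sub L
  refine h1.congr_of_eventuallyEq ?_
  filter_upwards [isOpen_im_pos.mem_nhds hz,
    (isOpen_lt (continuous_abs.comp continuous_re) continuous_const).mem_nhds hx] with w hw1 hw2
  exact hL w (le_of_lt hw2) hw1

/-- Differentiation under the integral: for t in a bounded neighbourhood inside the lower
half-plane, the derivative has exponent p - 1 and is dominated by a multiple of y^(-2). -/
lemma RapidDecay.differentiableAt_verticalIntegral {F : ℂ → ℂ} (hF : RapidDecay F) (p : ℝ)
    {t z : ℂ} (ht : t.im < 0) (hx : |z.re| ≤ 1) (hz : 0 < z.im) :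
    DifferentiableAt ℂ (fun t => verticalIntegral F p t z) t := by
  have hs : {t' : ℂ | t'.im < 0} ∩ Metric.ball 0 (‖t‖ + 1) ∈ 𝓝 t :=
    ((isOpen_lt continuous_im continuous_const).inter Metric.isOpen_ball).mem_nhds
      ⟨ht, by simp⟩
  obtain ⟨C, hC, h⟩ := hF.exists_norm_mul_cpow_le_of_norm_le (p - 1) 2 hz
    (by positivity : 0 ≤ ‖t‖ + 1)
  have key := hasDerivAt_integral_of_dominated_loc_of_deriv_le (μ := volume.restrict (Ioi z.im))
    (F := fun t (y : ℝ) => F ((z.re : ℂ) + (y : ℂ) * I) *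
      ((z.re : ℂ) + (y : ℂ) * I - t) ^ (p : ℂ) * I)
    (F' := fun t (y : ℝ) => F ((z.re : ℂ) + (y : ℂ) * I) *
      (-(p : ℂ) * ((z.re : ℂ) + (y : ℂ) * I - t) ^ ((p - 1 : ℝ) : ℂ)) * I)
    (bound := fun y => |p| * (C * y ^ (-2 : ℝ))) hs ?_ ?_ ?_ ?_ ?_ ?_
  · exact key.2.differentiableAt
  · filter_upwards [hs] with t' ht'
    exact ((hF.integrableOn_vertical p ht'.1.le hx hz).mul_const I).aestronglyMeasurable
  · exact (hF.integrableOn_vertical p ht.le hx hz).mul_const I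
  · have := ((hF.integrableOn_vertical (p - 1) ht.le hx hz).mul_const
      (-(p : ℂ) * I)).aestronglyMeasurable
    refine this.congr (Eventually.of_forall fun y => ?_)
    beta_reduce; ring
  · refine (ae_restrict_iff' measurableSet_Ioi).mpr (Eventually.of_forall fun y hy t' ht' => ?_)
    have := h t' ((z.re : ℂ) + (y : ℂ) * I) ht'.1.le (le_of_lt (by simpa using ht'.2))
      (by simpa using hx) (by simpa using le_of_lt hy)
    have e : F ((z.re : ℂ) + (y : ℂ) * I) *
      (-(p : ℂ) * ((z.re : ℂ) + (y : ℂ) * I - t') ^ ((p - 1 : ℝ) : ℂ)) * I = (-(p : ℂ) * I) *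
        (F ((z.re : ℂ) + (y : ℂ) * I) *
          ((z.re : ℂ) + (y : ℂ) * I - t') ^ ((p - 1 : ℝ) : ℂ)) := by ring
    rw [e, norm_mul]
    refine mul_le_mul ?_ (by simpa using this) (norm_nonneg _) (abs_nonneg _)
    simp
  · exact ((integrableOn_Ioi_rpow_of_lt (a := -2) (by norm_num) hz).const_mul C).const_mul _
  · refine (ae_restrict_iff' measurableSet_Ioi).mpr (Eventually.of_forall fun y hy t' ht' => ?_)
    have h1 : HasDerivAt (fun t'' : ℂ => (z.re : ℂ) + (y : ℂ) * I - t'') (-1) t' := by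
      simpa using (hasDerivAt_id t').const_sub ((z.re : ℂ) + (y : ℂ) * I)
    have h2 := h1.cpow_const (c := (p : ℂ)) (sub_mem_slitPlane (by simpa using hz.trans hy) ht'.1.le)
    refine ((h2.const_mul _).mul_const I).congr_deriv ?_
    push_cast; ring

/-- The non-holomorphic Eichler integral. -/
def conjEichler (F : ℂ → ℂ) (p : ℝ) (z : ℂ) : ℂ := conj (verticalIntegral F p (conj z) z)

/-- The variable enters as the endpoint z and, through conj z, as the parameter. The outer
conjugation makes the endpoint part antiholomorphic, with the explicit coefficient, and the
parameter part holomorphic. The value of a is irrelevant because dz ∧ dz = 0. -/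
lemma RapidDecay.hasFDerivAt_conjEichler {F : ℂ → ℂ} (hF : RapidDecay F) (p : ℝ) {z : ℂ}
    (hx : |z.re| < 1) (hz : 0 < z.im) : ∃ a : ℂ, HasFDerivAt (𝕜 := ℝ) (conjEichler F p)
      (a • (1 : ℂ →L[ℝ] ℂ) + (-conj (F z * (z - conj z) ^ (p : ℂ))) • (conjCLE : ℂ →L[ℝ] ℂ)) z := by
  have hconj : (conj z).im < 0 := by simpa using hz
  obtain ⟨a, ha⟩ : ∃ a, HasDerivAt (fun t => verticalIntegral F p t z) a (conj z) :=
    ⟨_, (hF.differentiableAt_verticalIntegral p hconj hx.le hz).hasDerivAt⟩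
  refine ⟨conj a, ?_⟩
  -- The endpoint moves while the parameter is conj w rather than conj z, so the derivative at conj
  -- z alone is not enough. Joint continuity of the integrand and the mean value inequality on a
  -- ball give the required uniformity.
  have h1 : (fun w => verticalIntegral F p (conj w) w - verticalIntegral F p (conj w) z -
      (ContinuousLinearMap.toSpanSingleton ℂ (-(F z * (z - conj z) ^ (p : ℂ)))) (w - z))
        =o[𝓝 z] fun w => w - z := by
    have hc : ContinuousAt (fun q : ℂ × ℂ => F q.2 * (q.2 - conj q.1) ^ (p : ℂ)) (z, z) := by
      refine ContinuousAt.mul ?_ ?_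
      · exact ContinuousAt.comp (f := fun q : ℂ × ℂ => q.2) (x := (z, z))
          (hF.holo.continuousOn.continuousAt (isOpen_im_pos.mem_nhds hz)) continuousAt_snd
      · refine ContinuousAt.cpow (by fun_prop) continuousAt_const ?_
        exact sub_mem_slitPlane hz hconj.le
    have hS : {q : ℂ × ℂ | 0 < q.1.im ∧ |q.2.re| < 1 ∧ 0 < q.2.im} ∈ 𝓝 (z, z) := by
      refine IsOpen.mem_nhds ?_ ⟨hz, hx, hz⟩
      have h1 : IsOpen {q : ℂ × ℂ | 0 < q.1.im} := isOpen_lt (by fun_prop) (by fun_prop)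
      have h2 : IsOpen {q : ℂ × ℂ | |q.2.re| < 1} := isOpen_lt (by fun_prop) (by fun_prop)
      have h3 : IsOpen {q : ℂ × ℂ | 0 < q.2.im} := isOpen_lt (by fun_prop) (by fun_prop)
      exact h1.inter (h2.inter h3)
    rw [Asymptotics.isLittleO_iff]
    intro ε hε
    obtain ⟨δ, hδ, hball⟩ := Metric.mem_nhds_iff.mp
      (inter_mem hS (hc (Metric.ball_mem_nhds _ hε)))
    filter_upwards [Metric.ball_mem_nhds z hδ] with w hw
    have hmem : ∀ x ∈ Metric.ball z δ, (w, x) ∈ Metric.ball (z, z) δ := by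
      intro x hx
      rw [← ball_prod_same]
      exact ⟨hw, hx⟩
    have := (convex_ball z δ).norm_image_sub_le_of_norm_hasDerivWithin_le (𝕜 := ℂ)
      (f := fun x => verticalIntegral F p (conj w) x + (F z * (z - conj z) ^ (p : ℂ)) * x)
      (f' := fun x => -(F x * (x - conj w) ^ (p : ℂ)) + (F z * (z - conj z) ^ (p : ℂ)) * 1)
      (C := ε) (x := z) (y := w) ?_ ?_ (Metric.mem_ball_self hδ) hw
    · refine (le_of_eq (congrArg norm ?_)).trans this
      rw [ContinuousLinearMap.toSpanSingleton_apply, smul_eq_mul]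
      ring
    · intro x hx
      have hq := (hball (hmem x hx)).1
      exact ((hF.hasDerivAt_verticalIntegral p (by simpa using hq.1.le) hq.2.1 hq.2.2).add
        ((hasDerivAt_id x).const_mul _)).hasDerivWithinAt
    · intro x hx
      have hq := (hball (hmem x hx)).2
      rw [mem_preimage, Metric.mem_ball, dist_comm, dist_eq_norm] at hq
      refine le_of_eq_of_le ?_ hq.le
      congr 1; ring
  have h2 : HasFDerivAt (𝕜 := ℝ) (fun w => verticalIntegral F p (conj w) z)
      (((ContinuousLinearMap.toSpanSingleton ℂ a).restrictScalars ℝ).comp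
          (conjCLE : ℂ →L[ℝ] ℂ)) z := by
    have := ha.hasFDerivAt.restrictScalars ℝ
    exact HasFDerivAt.comp z this (conjCLE : ℂ →L[ℝ] ℂ).hasFDerivAt
  have h3 : HasFDerivAt (𝕜 := ℝ) (fun w => verticalIntegral F p (conj w) w -
      verticalIntegral F p (conj w) z) ((ContinuousLinearMap.toSpanSingleton ℂ
        (-(F z * (z - conj z) ^ (p : ℂ)))).restrictScalars ℝ) z := by
    rw [hasFDerivAt_iff_isLittleO]
    simpa using h1
  have h4 := (conjCLE : ℂ →L[ℝ] ℂ).hasFDerivAt.comp z (h3.add h2)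
  refine (h4.congr_fderiv ?_).congr_of_eventuallyEq (Eventually.of_forall fun w => ?_)
  · ext x; simp; ring
  · simp [conjEichler]

/-! ### Powers -/

lemma cpow_eq_exp_mul_of_exp_eq {x L : ℂ} (a : ℂ) (h : exp L = x) (h₁ : -Real.pi < L.im)
    (h₂ : L.im ≤ Real.pi) : x ^ a = exp (L * a) := by
  rw [cpow_def_of_ne_zero (h ▸ exp_ne_zero L), ← h, log_exp h₁ h₂]

lemma cpow_eq_exp_log_mul {x : ℂ} (a : ℂ) (h : x ≠ 0) : x ^ a = exp (log x * a) :=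
  cpow_def_of_ne_zero h a

lemma ne_zero_of_im_pos {z : ℂ} (h : 0 < z.im) : z ≠ 0 := by
  rintro rfl; simp at h

lemma ne_zero_of_im_neg {z : ℂ} (h : z.im < 0) : z ≠ 0 := by
  rintro rfl; simp at h

lemma arg_pos_of_im_pos {z : ℂ} (h : 0 < z.im) : 0 < arg z :=
  lt_of_le_of_ne (arg_nonneg_iff.mpr h.le) fun h' => by
    have := (arg_eq_zero_iff.mp h'.symm).2
    linarith

lemma arg_lt_pi_of_im_pos {z : ℂ} (h : 0 < z.im) : arg z < Real.pi :=
  lt_of_le_of_ne (arg_le_pi z) fun h' => by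
    have := (arg_eq_pi_iff.mp h').2
    linarith

lemma neg_inv_im_pos {z : ℂ} (h : 0 < z.im) : 0 < (-z⁻¹).im := by
  rw [neg_im, inv_im]
  have : 0 < normSq z := normSq_pos.mpr (ne_zero_of_im_pos h)
  rw [neg_div, neg_neg]; positivity

/-- The combination arg(τ - t) - arg τ - arg t lies in (-π, 2π). The quotient equals -1/τ + 1/t,
which is in the upper half-plane, so the sine of this angle is positive and the angle is in (0, π).
The principal branches therefore multiply without a correction. -/
lemma cpow_sub_div_mul {τ t : ℂ} (a : ℂ) (hτ : 0 < τ.im) (ht : t.im < 0) :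
    ((τ - t) / (τ * t)) ^ a = (τ - t) ^ a * τ ^ (-a) * t ^ (-a) := by
  have h0 : τ - t ≠ 0 := ne_zero_of_im_pos (by rw [sub_im]; linarith)
  have h1 := ne_zero_of_im_pos hτ
  have h2 := ne_zero_of_im_neg ht
  set L := log (τ - t) - log τ - log t with hL
  have hexp : exp L = (τ - t) / (τ * t) := by
    rw [hL, exp_sub, exp_sub, exp_log h0, exp_log h1, exp_log h2]
    field_simp
  have him : L.im = arg (τ - t) - arg τ - arg t := by simp [hL, log_im]
  have hpos : 0 < Real.sin L.im := by
    have e1 : 0 < ((τ - t) / (τ * t)).im := by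
      have e2 : (τ - t) / (τ * t) = -τ⁻¹ + t⁻¹ := by field_simp; ring
      have e3 := neg_inv_im_pos hτ
      have e4 : 0 < (t⁻¹).im := by
        rw [inv_im]
        exact div_pos (by linarith) (normSq_pos.mpr h2)
      rw [e2, add_im]; linarith
    rw [← hexp, exp_im] at e1
    exact (mul_pos_iff_of_pos_left (Real.exp_pos _)).mp e1
  have b1 := arg_pos_of_im_pos (z := τ - t) (by rw [sub_im]; linarith)
  have b2 := arg_lt_pi_of_im_pos (z := τ - t) (by rw [sub_im]; linarith)
  have b3 := arg_pos_of_im_pos hτ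
  have b4 := arg_lt_pi_of_im_pos hτ
  have b5 := arg_neg_iff.mpr ht
  have b6 := neg_pi_lt_arg t
  have c1 : -Real.pi < L.im := by rw [him]; linarith
  have c2 : L.im ≤ Real.pi := by
    by_contra! hc
    have : Real.sin (L.im - Real.pi) ≥ 0 :=
      Real.sin_nonneg_of_nonneg_of_le_pi (by linarith) (by rw [him]; linarith)
    rw [Real.sin_sub_pi] at this
    linarith
  rw [cpow_eq_exp_mul_of_exp_eq a hexp c1 c2, cpow_eq_exp_log_mul a h0, cpow_eq_exp_log_mul _ h1,
    cpow_eq_exp_log_mul _ h2, ← exp_add, ← exp_add, hL]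
  ring_nf

/-! ### The action of the generators -/

lemma IsModularForm.apply_neg_inv {r : ℝ} {v : SL(2, ℤ) → ℂˣ} {f : UpperHalfPlane → ℂ}
    (hf : IsModularForm r v f) {z : ℂ} (hz : 0 < z.im) :
    f (UpperHalfPlane.ofComplex (-z⁻¹)) =
      (v ModularGroup.S : ℂ) * z ^ (r : ℂ) * f (UpperHalfPlane.ofComplex z) := by
  have h := hf.transf ModularGroup.S (UpperHalfPlane.ofComplex z)
  rw [UpperHalfPlane.ofComplex_apply_of_im_pos hz] at h ⊢
  rw [UpperHalfPlane.ofComplex_apply_of_im_pos (neg_inv_im_pos hz)]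
  rw [UpperHalfPlane.modular_S_smul] at h
  have e : (⟨-z⁻¹, neg_inv_im_pos hz⟩ : UpperHalfPlane) = UpperHalfPlane.mk
      (-((⟨z, hz⟩ : UpperHalfPlane) : ℂ))⁻¹ (UpperHalfPlane.im_inv_neg_coe_pos ⟨z, hz⟩) := by
    ext1
    simp [inv_neg]
  rw [e, h]
  simp [ModularGroup.S]

lemma IsModularForm.apply_add_one {r : ℝ} {v : SL(2, ℤ) → ℂˣ} {f : UpperHalfPlane → ℂ}
    (hf : IsModularForm r v f) {z : ℂ} (hz : 0 < z.im) :
    f (UpperHalfPlane.ofComplex (z + 1)) =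
      (v ModularGroup.T : ℂ) * f (UpperHalfPlane.ofComplex z) := by
  have h := hf.transf ModularGroup.T (UpperHalfPlane.ofComplex z)
  rw [UpperHalfPlane.modular_T_smul] at h
  have hz' : 0 < (z + 1).im := by simpa using hz
  have e : UpperHalfPlane.ofComplex (z + 1) = (1 : ℝ) +ᵥ UpperHalfPlane.ofComplex z := by
    rw [UpperHalfPlane.ofComplex_apply_of_im_pos hz, UpperHalfPlane.ofComplex_apply_of_im_pos hz']
    ext1
    simp [UpperHalfPlane.coe_vadd, add_comm]
  rw [e, h]
  simp [ModularGroup.T]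

/-- Follow a nonzero value of |f| around the relations of the modular group. Applying z ↦ -1/z twice
gives |v(S)|² = 1. Applying z ↦ -1/(z + 1) three times gives |v(T)|³ = 1, since the automorphy
factors have product of modulus 1. -/
lemma IsMultiplierSystem.norm_S_and_norm_T {r : ℝ} {v : SL(2, ℤ) → ℂˣ}
    (hv : IsMultiplierSystem r v) :
    ‖(v ModularGroup.S : ℂ)‖ = 1 ∧ ‖(v ModularGroup.T : ℂ)‖ = 1 := by
  obtain ⟨f, hf0, hf⟩ := hv
  obtain ⟨τ, hτ⟩ := Function.ne_iff.mp hf0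
  set F : ℂ → ℂ := fun z => f (UpperHalfPlane.ofComplex z) with hF
  set z : ℂ := (τ : ℂ)
  have hz : 0 < z.im := τ.im_pos
  have hFz : 0 < ‖F z‖ := by
    rw [norm_pos_iff, hF]
    simpa [z] using hτ
  set α := ‖(v ModularGroup.S : ℂ)‖ with hα
  set β := ‖(v ModularGroup.T : ℂ)‖ with hβ
  have hα0 : 0 < α := norm_pos_iff.mpr (Units.ne_zero _)
  have hβ0 : 0 < β := norm_pos_iff.mpr (Units.ne_zero _)
  have hS : ∀ w : ℂ, 0 < w.im → ‖F (-w⁻¹)‖ = α * ‖w‖ ^ r * ‖F w‖ := fun w hw => by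
    rw [hF]; simp only [hf.apply_neg_inv hw, norm_mul, norm_cpow_real, hα]
  have hT : ∀ w : ℂ, 0 < w.im → ‖F (w + 1)‖ = β * ‖F w‖ := fun w hw => by
    rw [hF]; simp only [hf.apply_add_one hw, norm_mul, hβ]
  have hz0 := ne_zero_of_im_pos hz
  have hαone : α = 1 := by
    have h1 := hS _ (neg_inv_im_pos hz)
    rw [hS z hz, inv_neg, inv_inv, neg_neg, norm_neg, norm_inv,
      Real.inv_rpow (norm_nonneg _)] at h1
    have h2 : 0 < ‖z‖ ^ r := Real.rpow_pos_of_pos (norm_pos_iff.mpr hz0) _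
    have h3 : α * α = 1 := by
      field_simp at h1
      nlinarith
    nlinarith
  refine ⟨hαone, ?_⟩
  have hST : ∀ w : ℂ, 0 < w.im → ‖F (-(w + 1)⁻¹)‖ = ‖w + 1‖ ^ r * β * ‖F w‖ := fun w hw => by
    rw [hS (w + 1) (by simpa using hw), hT w hw, hαone]; ring
  have hz1 : z + 1 ≠ 0 := ne_zero_of_im_pos (by simpa using hz)
  have i2 : 0 < (-(z + 1)⁻¹).im := neg_inv_im_pos (by simpa using hz)
  have e2 : -(z + 1)⁻¹ + 1 = z / (z + 1) := by field_simp; ring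
  have i3 : 0 < (-(-(z + 1)⁻¹ + 1)⁻¹).im := neg_inv_im_pos (by simpa using i2)
  have e3 : -(-(z + 1)⁻¹ + 1)⁻¹ + 1 = -z⁻¹ := by rw [e2, inv_div]; field_simp; ring
  have h1 := hST _ i3
  rw [hST _ i2, hST _ hz, e3, e2] at h1
  have e4 : -(-z⁻¹)⁻¹ = z := by simp
  rw [e4, norm_neg, norm_inv, norm_div, Real.inv_rpow (norm_nonneg _),
    Real.div_rpow (norm_nonneg _) (norm_nonneg _)] at h1
  have p1 : 0 < ‖z‖ ^ r := Real.rpow_pos_of_pos (norm_pos_iff.mpr hz0) _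
  have p2 : 0 < ‖z + 1‖ ^ r := Real.rpow_pos_of_pos (norm_pos_iff.mpr hz1) _
  have h3 : β ^ 3 = 1 := by
    field_simp at h1
    linarith
  exact (pow_eq_one_iff_of_nonneg hβ0.le (by norm_num)).mp h3

/-! ### Transformation of the non-holomorphic Eichler integral -/

lemma conjEichler_add_one {F : ℂ → ℂ} {p : ℝ} {μ : ℂ}
    (hT : ∀ z : ℂ, 0 < z.im → F (z + 1) = μ * F z) {z : ℂ} (hz : 0 < z.im) :
    conjEichler F p (z + 1) = conj μ * conjEichler F p z := by
  rw [conjEichler, conjEichler, ← map_mul]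
  congr 1
  rw [verticalIntegral, verticalIntegral, ← integral_const_mul]
  simp only [add_im, one_im, add_zero]
  refine setIntegral_congr_fun measurableSet_Ioi fun y hy => ?_
  have hy : 0 < y := hz.trans hy
  have e : ((z + 1).re : ℂ) + (y : ℂ) * I = ((z.re : ℂ) + (y : ℂ) * I) + 1 := by
    simp; ring
  rw [e, hT _ (by simpa using hy)]
  simp only [map_add, map_one, add_sub_add_right_eq_sub]
  ring

lemma RapidDecay.exists_norm_conjEichler_le {F : ℂ → ℂ} (hF : RapidDecay F) (p : ℝ) {y₀ : ℝ}
    (hy₀ : 0 < y₀) : ∃ C : ℝ, 0 ≤ C ∧ ∀ z : ℂ, |z.re| ≤ 1 → y₀ ≤ z.im →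
      ‖conjEichler F p z‖ ≤ C := by
  -- M = 2 because on the ray τ - conj z = i(y + im z) with y ≥ im z.
  obtain ⟨C, hC, h⟩ := hF.exists_norm_mul_cpow_le p 2 (M := 2) hy₀ (by norm_num)
  refine ⟨C * y₀⁻¹, by positivity, fun z hx hy => ?_⟩
  have hz : 0 < z.im := hy₀.trans_le hy
  rw [conjEichler, norm_conj, verticalIntegral]
  have hint := (integrableOn_Ioi_rpow_of_lt (a := -2) (by norm_num) hz).const_mul C
  refine (norm_integral_le_of_norm_le hint ?_).trans ?_
  · refine (ae_restrict_iff' measurableSet_Ioi).mpr (Eventually.of_forall fun y hy' => ?_)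
    have hy' : z.im < y := hy'
    have e : (z.re : ℂ) + (y : ℂ) * I - conj z = ((y + z.im : ℝ) : ℂ) * I := by
      apply Complex.ext <;> simp
    have en : ‖(z.re : ℂ) + (y : ℂ) * I - conj z‖ = y + z.im := by
      rw [e, norm_mul, norm_I, mul_one, norm_real, Real.norm_of_nonneg (by linarith)]
    rw [norm_mul, norm_I, mul_one]
    have := h (conj z) ((z.re : ℂ) + (y : ℂ) * I) (by simpa using hx)
      (by simpa using hy.trans hy'.le) (by rw [en]; simpa using hz.le)
      (by rw [en]; simp; linarith)
    simpa using this
  · rw [integral_const_mul, integral_Ioi_rpow_of_lt (by norm_num) hz]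
    refine mul_le_mul_of_nonneg_left ?_ hC
    have : (-2 : ℝ) + 1 = -1 := by norm_num
    rw [this, Real.rpow_neg_one, neg_div_neg_eq, div_one]
    exact inv_anti₀ hy₀ hy

/-- The Eichler integral based at `i`. -/
def conjEichlerBased (F : ℂ → ℂ) (p : ℝ) (z : ℂ) : ℂ :=
  conjEichler F p z - conj (verticalIntegral F p (conj z) I)

/-- Substitute τ ↦ -1/τ in the integral from z to i; the endpoint i is fixed. In terms of
primitives, Q(-1/τ) minus a multiple of P(τ) has derivative 0 on the half-plane. The bounds on the
real parts keep z and -1/z in the strip where vertical integrals are expressed by primitives. -/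
lemma RapidDecay.conjEichlerBased_neg_inv {F : ℂ → ℂ} (hF : RapidDecay F) {p : ℝ} {μ : ℂ}
    (hS : ∀ z : ℂ, 0 < z.im → F (-z⁻¹) = μ * z ^ ((p + 2 : ℝ) : ℂ) * F z) {z : ℂ} (hz : 0 < z.im)
    (hx : |z.re| ≤ 1) (hx' : |(-z⁻¹).re| ≤ 1) :
    conjEichlerBased F p (-z⁻¹) = conj μ * z ^ (-(p : ℂ)) * conjEichlerBased F p z := by
  have hbased : ∀ w : ℂ, 0 < w.im → |w.re| ≤ 1 → ∀ P : ℂ → ℂ,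
      (∀ τ : ℂ, 0 < τ.im → HasDerivAt P (F τ * (τ - conj w) ^ (p : ℂ)) τ) →
      conjEichlerBased F p w = conj (P I - P w) := by
    intro w hw hwx P hP
    obtain ⟨L, hL⟩ := hF.exists_verticalIntegral_eq p (t := conj w) (by simpa using hw.le) hP
    rw [conjEichlerBased, conjEichler, hL w hwx hw, hL I (by simp) (by simp), ← map_sub]
    congr 1; ring
  set t := conj z with htdef
  have ht : t.im < 0 := by simpa [t] using hz
  have ht0 := ne_zero_of_im_neg ht
  have hz0 := ne_zero_of_im_pos hz
  have ht' : conj (-z⁻¹) = -t⁻¹ := by simp [t]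
  obtain ⟨P, hP⟩ := exists_primitive (differentiableOn_mul_cpow hF.holo p ht.le)
  obtain ⟨Q, hQ⟩ := exists_primitive (differentiableOn_mul_cpow hF.holo p (t := -t⁻¹) (by
    rw [← ht', conj_im]; linarith [neg_inv_im_pos hz]))
  rw [hbased z hz hx P hP, hbased _ (neg_inv_im_pos hz) hx' Q (by rw [ht']; exact hQ)]
  have hder : ∀ τ : ℂ, 0 < τ.im →
      HasDerivAt (fun τ => Q (-τ⁻¹) - μ * t ^ (-(p : ℂ)) * P τ) 0 τ := by
    intro τ hτ
    have hτ0 := ne_zero_of_im_pos hτ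
    have h1 := (hQ _ (neg_inv_im_pos hτ)).comp τ ((hasDerivAt_inv hτ0).fun_neg)
    refine (h1.sub ((hP τ hτ).const_mul (μ * t ^ (-(p : ℂ))))).congr_deriv ?_
    have e1 : -τ⁻¹ - -t⁻¹ = (τ - t) / (τ * t) := by field_simp; ring
    have e2 : τ ^ ((p + 2 : ℝ) : ℂ) * τ ^ (-(p : ℂ)) = τ ^ 2 := by
      rw [← cpow_add _ _ hτ0]
      push_cast
      rw [show (p : ℂ) + 2 + -p = ((2 : ℕ) : ℂ) by push_cast; ring, cpow_natCast]
    rw [hS τ hτ, e1, cpow_sub_div_mul _ hτ ht]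
    have : μ * τ ^ ((p + 2 : ℝ) : ℂ) * F τ * ((τ - t) ^ (p : ℂ) * τ ^ (-(p : ℂ)) * t ^ (-(p : ℂ))) *
        - -(τ ^ 2)⁻¹ = (τ ^ ((p + 2 : ℝ) : ℂ) * τ ^ (-(p : ℂ))) * (τ ^ 2)⁻¹ *
          (μ * F τ * (τ - t) ^ (p : ℂ) * t ^ (-(p : ℂ))) := by ring
    rw [this, e2, mul_inv_cancel₀ (pow_ne_zero 2 hτ0)]
    ring
  have hconst := (convex_halfSpace_im_gt 0).norm_image_sub_le_of_norm_hasDerivWithin_le (𝕜 := ℂ)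
    (f := fun τ => Q (-τ⁻¹) - μ * t ^ (-(p : ℂ)) * P τ) (f' := fun _ => 0) (C := 0) (x := z)
    (y := I) (fun w hw => (hder w hw).hasDerivWithinAt) (fun w _ => by simp) hz
    (show (0 : ℝ) < I.im by simp)
  rw [zero_mul, norm_le_zero_iff] at hconst
  have eI : -I⁻¹ = I := by simp
  rw [eI] at hconst
  have harg : t.arg ≠ Real.pi := by
    have := arg_neg_iff.mpr ht
    linarith [Real.pi_pos]
  have ez : z ^ (-(p : ℂ)) = conj (t ^ (-(p : ℂ))) := by
    have := conj_cpow t (-(p : ℂ)) harg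
    rw [htdef, conj_conj] at this
    simpa [t] using this
  rw [ez, ← map_mul, ← map_mul]
  congr 1
  linear_combination hconst

/-! ### The fundamental domain -/

/-- The height of the unit circle above `x`. -/
def arcHeight (x : ℝ) : ℝ := √(1 - x ^ 2)

/-- The arc of the unit circle, parametrized by the real part. -/
def arc (x : ℝ) : ℂ := (x : ℂ) + (arcHeight x : ℂ) * I

/-- The derivative of `arc`. -/
def arcDeriv (x : ℝ) : ℂ := 1 + ((-(x / arcHeight x) : ℝ) : ℂ) * I

@[simp] lemma arc_re (x : ℝ) : (arc x).re = x := by simp [arc]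

@[simp] lemma arc_im (x : ℝ) : (arc x).im = arcHeight x := by simp [arc]

lemma arcHeight_pos {x : ℝ} (hx : |x| < 1) : 0 < arcHeight x := by
  rw [arcHeight, Real.sqrt_pos]
  have := (sq_lt_one_iff_abs_lt_one x).mpr hx
  linarith

lemma arcHeight_sq {x : ℝ} (hx : |x| < 1) : arcHeight x ^ 2 = 1 - x ^ 2 := by
  rw [arcHeight, Real.sq_sqrt]
  have := (sq_lt_one_iff_abs_lt_one x).mpr hx
  linarith

lemma half_le_arcHeight {x : ℝ} (hx : |x| ≤ 1 / 2) : 1 / 2 ≤ arcHeight x := by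
  rw [arcHeight]
  apply Real.le_sqrt_of_sq_le
  have := sq_le_sq' (abs_le.mp hx).1 (abs_le.mp hx).2
  linarith

lemma continuous_arcHeight : Continuous arcHeight := by unfold arcHeight; fun_prop

lemma hasDerivAt_arcHeight {x : ℝ} (hx : |x| < 1) :
    HasDerivAt arcHeight (-(x / arcHeight x)) x := by
  have h1 : HasDerivAt (fun x : ℝ => 1 - x ^ 2) (-(2 * x)) x := by
    simpa using (hasDerivAt_pow 2 x).const_sub 1
  have h2 := h1.sqrt (Real.sqrt_ne_zero'.mp (arcHeight_pos hx).ne' |>.ne')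
  refine h2.congr_deriv ?_
  rw [arcHeight]; field_simp

lemma hasDerivAt_arc {x : ℝ} (hx : |x| < 1) : HasDerivAt arc (arcDeriv x) x :=
  ((hasDerivAt_id x).ofReal_comp).add (((hasDerivAt_arcHeight hx).ofReal_comp).mul_const I)

lemma continuousOn_arcDeriv : ContinuousOn arcDeriv {x : ℝ | |x| < 1} := by
  unfold arcDeriv
  refine continuousOn_const.add (ContinuousOn.mul ?_ continuousOn_const)
  refine continuous_ofReal.comp_continuousOn (ContinuousOn.neg ?_)
  exact continuousOn_id.div continuous_arcHeight.continuousOn fun x hx => (arcHeight_pos hx).ne'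

lemma differentiableAt_arcDeriv {x : ℝ} (hx : |x| < 1) : DifferentiableAt ℝ arcDeriv x := by
  have h1 : DifferentiableAt ℝ (fun x : ℝ => -(x / arcHeight x)) x :=
    (differentiableAt_id.fun_div (hasDerivAt_arcHeight hx).differentiableAt
      (arcHeight_pos hx).ne').fun_neg
  unfold arcDeriv
  exact (h1.hasDerivAt.ofReal_comp.differentiableAt.mul_const I).const_add 1

/-- Coordinates `(x, u)` for which the fundamental domain is `|x| ≤ 1 / 2`, `0 ≤ u`. -/
def domainMap (q : ℝ × ℝ) : ℂ := arc q.1 + (q.2 : ℂ) * I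

@[simp] lemma domainMap_re (q : ℝ × ℝ) : (domainMap q).re = q.1 := by simp [domainMap]

@[simp] lemma domainMap_im (q : ℝ × ℝ) : (domainMap q).im = arcHeight q.1 + q.2 := by
  simp [domainMap]

lemma continuous_domainMap : Continuous domainMap := by
  unfold domainMap arc
  have := continuous_arcHeight
  fun_prop

lemma hasFDerivAt_domainMap {q : ℝ × ℝ} (hx : |q.1| < 1) : HasFDerivAt domainMap
    ((ContinuousLinearMap.fst ℝ ℝ ℝ).smulRight (arcDeriv q.1) +
      (ContinuousLinearMap.snd ℝ ℝ ℝ).smulRight I) q := by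
  have h1 : HasFDerivAt (fun q : ℝ × ℝ => arc q.1)
      ((ContinuousLinearMap.fst ℝ ℝ ℝ).smulRight (arcDeriv q.1)) q := by
    refine ((hasDerivAt_arc hx).hasFDerivAt.comp q hasFDerivAt_fst).congr_fderiv ?_
    ext <;> simp
  have h2 : HasFDerivAt (fun q : ℝ × ℝ => (q.2 : ℂ) * I)
      ((ContinuousLinearMap.snd ℝ ℝ ℝ).smulRight I) q := by
    have h3 : HasDerivAt (fun u : ℝ => (u : ℂ) * I) I q.2 := by
      simpa using (hasDerivAt_id q.2).ofReal_comp.mul_const I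
    refine (h3.hasFDerivAt.comp q hasFDerivAt_snd).congr_fderiv ?_
    ext <;> simp
  exact h1.add h2

/-- Stokes' theorem for `F dz` on a truncated fundamental domain, where `F` has period `1` and
`B` is the antiholomorphic derivative of `F`. -/
lemma integral_domainMap_truncated {F B : ℂ → ℂ}
    (hF : ∀ z : ℂ, |z.re| < 1 → 0 < z.im → ∃ a : ℂ, HasFDerivAt (𝕜 := ℝ) F
      (a • (1 : ℂ →L[ℝ] ℂ) + B z • (conjCLE : ℂ →L[ℝ] ℂ)) z)
    (hB : ContinuousOn B {z : ℂ | 0 < z.im}) (hper : ∀ z : ℂ, 0 < z.im → F (z + 1) = F z)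
    {U : ℝ} (hU : 0 ≤ U) :
    ∫ q in Icc ((-(1 / 2), 0) : ℝ × ℝ) (1 / 2, U), 2 * I * B (domainMap q) =
      (∫ x in (-(1 / 2) : ℝ)..(1 / 2), F (arc x) * arcDeriv x) -
        ∫ x in (-(1 / 2) : ℝ)..(1 / 2), F (domainMap (x, U)) * arcDeriv x := by
  have hmem : ∀ q ∈ Icc ((-(1 / 2), 0) : ℝ × ℝ) (1 / 2, U),
      |q.1| < 1 ∧ 0 < (domainMap q).im := by
    rintro q ⟨⟨h1, h2⟩, h3, h4⟩
    simp only at h1 h2 h3 h4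
    have hq : |q.1| < 1 := abs_lt.mpr ⟨by linarith, by linarith⟩
    refine ⟨hq, ?_⟩
    rw [domainMap_im]
    linarith [arcHeight_pos hq]
  -- With dF = a dz + B d(conj z), the a-terms of the divergence cancel, and the rest is iB(γ' +
  -- conj γ') = 2iB, because γ' = `arcDeriv` has real part 1.
  have hder : ∀ q ∈ Icc ((-(1 / 2), 0) : ℝ × ℝ) (1 / 2, U),
      DifferentiableAt ℝ (fun q => F (domainMap q) * I) q ∧
      DifferentiableAt ℝ (fun q => -(F (domainMap q) * arcDeriv q.1)) q ∧
      fderiv ℝ (fun q => F (domainMap q) * I) q (1, 0) +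
        fderiv ℝ (fun q => -(F (domainMap q) * arcDeriv q.1)) q (0, 1) =
          2 * I * B (domainMap q) := by
    intro q hq
    obtain ⟨h1, h2⟩ := hmem q hq
    obtain ⟨a, ha⟩ := hF (domainMap q) (by simpa using h1) h2
    have hc := ha.comp q (hasFDerivAt_domainMap h1)
    have hd : HasFDerivAt (fun q : ℝ × ℝ => arcDeriv q.1) _ q :=
      (differentiableAt_arcDeriv h1).hasDerivAt.hasFDerivAt.comp q hasFDerivAt_fst
    have hf := hc.mul_const I
    have hg := (hc.mul hd).fun_neg
    refine ⟨hf.differentiableAt, hg.differentiableAt, ?_⟩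
    have e1 : fderiv ℝ (fun q => F (domainMap q) * I) q = _ := hf.fderiv
    have e2 : fderiv ℝ (fun q => -(F (domainMap q) * arcDeriv q.1)) q = _ := hg.fderiv
    rw [e1, e2]
    have e3 : conj (arcDeriv q.1) = 2 - arcDeriv q.1 := by
      simp [arcDeriv]; ring
    simp [e3]
    ring
  have h := integral_divergence_prod_Icc_of_hasFDerivAt_of_le
    (fun q => F (domainMap q) * I) (fun q => -(F (domainMap q) * arcDeriv q.1))
    (fderiv ℝ (fun q => F (domainMap q) * I))
    (fderiv ℝ (fun q => -(F (domainMap q) * arcDeriv q.1))) (-(1 / 2), 0) (1 / 2, U)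
    ⟨by norm_num, hU⟩ (fun q hq => (hder q hq).1.continuousAt.continuousWithinAt)
    (fun q hq => (hder q hq).2.1.continuousAt.continuousWithinAt)
    (fun q hq => (hder q ⟨⟨hq.1.1.le, hq.2.1.le⟩, hq.1.2.le, hq.2.2.le⟩).1.hasFDerivAt)
    (fun q hq => (hder q ⟨⟨hq.1.1.le, hq.2.1.le⟩, hq.1.2.le, hq.2.2.le⟩).2.1.hasFDerivAt) ?_
  · rw [setIntegral_congr_fun measurableSet_Icc fun q hq => (hder q hq).2.2] at h
    rw [h]
    -- The two vertical sides differ by the translation by 1, as `arcHeight` is even; periodicity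
    -- makes their contributions cancel.
    have e : ∀ y ∈ uIcc 0 U, F (domainMap (1 / 2, y)) * I = F (domainMap (-(1 / 2), y)) * I := by
      intro y hy
      rw [uIcc_of_le hU] at hy
      rw [← hper (domainMap (-(1 / 2), y))
        (hmem (-(1 / 2), y) ⟨⟨le_rfl, hy.1⟩, ⟨by norm_num, hy.2⟩⟩).2]
      congr 2
      simp [domainMap, arc, arcHeight]
      ring
    simp only [intervalIntegral.integral_congr e, intervalIntegral.integral_neg]
    have e0 : ∀ x : ℝ, domainMap (x, 0) = arc x := fun x => by simp [domainMap]
    simp only [e0]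
    ring
  · refine ContinuousOn.integrableOn_compact isCompact_Icc ?_
    refine ContinuousOn.congr ?_ fun q hq => (hder q hq).2.2
    exact continuousOn_const.mul (hB.comp continuous_domainMap.continuousOn
      fun q hq => (hmem q hq).2)

/-- The arc has height at least 1/2 over |x| ≤ 1/2, so the integrand is dominated by C(1/2 + u)^(-2)
on a strip of finite width. -/
lemma integrableOn_domainMap {B : ℂ → ℂ} (hB : ContinuousOn B {z : ℂ | 0 < z.im}) {C : ℝ}
    (hC : ∀ z : ℂ, |z.re| ≤ 1 → 1 / 2 ≤ z.im → ‖B z‖ ≤ C * z.im ^ (-2 : ℝ)) :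
    IntegrableOn (fun q => B (domainMap q)) (Icc (-(1 / 2)) (1 / 2) ×ˢ Ici 0) := by
  have hmem : ∀ q ∈ Icc (-(1 / 2) : ℝ) (1 / 2) ×ˢ Ici (0 : ℝ),
      |q.1| ≤ 1 ∧ 1 / 2 + q.2 ≤ (domainMap q).im := by
    rintro q ⟨⟨h1, h2⟩, h3⟩
    have hq : |q.1| ≤ 1 / 2 := abs_le.mpr ⟨h1, h2⟩
    refine ⟨by linarith, ?_⟩
    rw [domainMap_im]
    linarith [half_le_arcHeight hq]
  have hC0 : 0 ≤ C := by
    have := (norm_nonneg _).trans (hC I (by simp) (by norm_num))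
    simpa using this
  have hbound : IntegrableOn (fun q : ℝ × ℝ => C * (1 / 2 + q.2) ^ (-2 : ℝ))
      (Icc (-(1 / 2)) (1 / 2) ×ˢ Ici 0) := by
    have h1 : IntegrableOn (fun _ : ℝ => C) (Icc (-(1 / 2)) (1 / 2)) := by simp
    have h2 : IntegrableOn (fun u : ℝ => (1 / 2 + u) ^ (-2 : ℝ)) (Ici 0) := by
      rw [integrableOn_Ici_iff_integrableOn_Ioi]
      have := integrableOn_Ioi_rpow_of_lt (a := -2) (c := 1 / 2) (by norm_num) (by norm_num)
      have h := ((measurePreserving_add_left volume (1 / 2 : ℝ)).integrableOn_comp_preimage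
        (measurableEmbedding_addLeft _)).mpr this
      have e : (fun u : ℝ => 1 / 2 + u) ⁻¹' Ioi (1 / 2) = Ioi 0 := by ext u; simp
      rwa [e] at h
    have := Integrable.mul_prod h1 h2
    rwa [Measure.prod_restrict] at this
  refine Integrable.mono' hbound ?_ ?_
  · refine ContinuousOn.aestronglyMeasurable (hB.comp continuous_domainMap.continuousOn
      fun q hq => ?_) (measurableSet_Icc.prod measurableSet_Ici)
    have h3 : (0 : ℝ) ≤ q.2 := hq.2
    have := (hmem q hq).2
    change 0 < (domainMap q).im
    linarith
  · refine (ae_restrict_iff' (measurableSet_Icc.prod measurableSet_Ici)).mpr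
      (Eventually.of_forall fun q hq => ?_)
    have h3 : (0 : ℝ) ≤ q.2 := hq.2
    obtain ⟨h1, h2⟩ := hmem q hq
    refine (hC _ (by simpa using h1) (by linarith)).trans (mul_le_mul_of_nonneg_left ?_ hC0)
    exact Real.rpow_le_rpow_of_nonpos (by linarith) h2 (by norm_num)

/-- Stokes' theorem for `F dz` on the fundamental domain. -/
lemma integral_domainMap {F B : ℂ → ℂ}
    (hF : ∀ z : ℂ, |z.re| < 1 → 0 < z.im → ∃ a : ℂ, HasFDerivAt (𝕜 := ℝ) F
      (a • (1 : ℂ →L[ℝ] ℂ) + B z • (conjCLE : ℂ →L[ℝ] ℂ)) z)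
    (hB : ContinuousOn B {z : ℂ | 0 < z.im}) (hper : ∀ z : ℂ, 0 < z.im → F (z + 1) = F z)
    {C C' : ℝ} (hC : ∀ z : ℂ, |z.re| ≤ 1 → 1 / 2 ≤ z.im → ‖B z‖ ≤ C * z.im ^ (-2 : ℝ))
    (hC' : ∀ z : ℂ, |z.re| ≤ 1 → 1 / 2 ≤ z.im → ‖F z‖ ≤ C' * z.im ^ (-1 : ℝ)) :
    ∫ q in Icc (-(1 / 2) : ℝ) (1 / 2) ×ˢ Ici (0 : ℝ), 2 * I * B (domainMap q) =
      ∫ x in (-(1 / 2) : ℝ)..(1 / 2), F (arc x) * arcDeriv x := by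
  have hunion : ⋃ n : ℕ, Icc ((-(1 / 2), 0) : ℝ × ℝ) (1 / 2, (n : ℝ)) =
      Icc (-(1 / 2) : ℝ) (1 / 2) ×ˢ Ici (0 : ℝ) := by
    ext q
    simp only [mem_iUnion, ← Icc_prod_Icc, mem_prod, mem_Icc, mem_Ici]
    constructor
    · rintro ⟨n, h1, h2⟩
      exact ⟨h1, h2.1⟩
    · rintro ⟨h1, h2⟩
      obtain ⟨n, hn⟩ := exists_nat_ge q.2
      exact ⟨n, h1, h2, hn⟩
  have hlim : Tendsto (fun n : ℕ => ∫ q in Icc ((-(1 / 2), 0) : ℝ × ℝ) (1 / 2, (n : ℝ)),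
      2 * I * B (domainMap q)) atTop
      (𝓝 (∫ q in Icc (-(1 / 2) : ℝ) (1 / 2) ×ˢ Ici (0 : ℝ), 2 * I * B (domainMap q))) := by
    have := tendsto_setIntegral_of_monotone (μ := volume)
      (f := fun q : ℝ × ℝ => 2 * I * B (domainMap q))
      (s := fun n : ℕ => Icc ((-(1 / 2), 0) : ℝ × ℝ) (1 / 2, (n : ℝ)))
      (fun n => measurableSet_Icc) (fun m n hmn => Icc_subset_Icc le_rfl
        ⟨le_rfl, by simpa using hmn⟩)
      (by rw [hunion]; exact (integrableOn_domainMap hB hC).const_mul _)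
    rwa [hunion] at this
  refine tendsto_nhds_unique hlim ?_
  have hC'0 : 0 ≤ C' := by
    have := (norm_nonneg _).trans (hC' I (by simp) (by norm_num))
    simpa using this
  obtain ⟨D, hD⟩ := (isCompact_Icc (a := (-(1 / 2) : ℝ)) (b := 1 / 2)).exists_bound_of_continuousOn
    (continuousOn_arcDeriv.mono fun x hx => by
      change |x| < 1
      exact abs_lt.mpr ⟨by linarith [hx.1], by linarith [hx.2]⟩)
  have hD0 : 0 ≤ D := (norm_nonneg _).trans (hD 0 ⟨by norm_num, by norm_num⟩)
  have hzero : Tendsto (fun n : ℕ => ∫ x in (-(1 / 2) : ℝ)..(1 / 2),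
      F (domainMap (x, (n : ℝ))) * arcDeriv x) atTop (𝓝 0) := by
    refine squeeze_zero_norm' (a := fun n : ℕ => C' * D * (n : ℝ) ^ (-1 : ℝ)) ?_ ?_
    · filter_upwards [eventually_ge_atTop 1] with n hn
      have hn' : (1 : ℝ) ≤ n := by exact_mod_cast hn
      have := intervalIntegral.norm_integral_le_of_norm_le_const
        (a := (-(1 / 2) : ℝ)) (b := 1 / 2) (C := C' * D * (n : ℝ) ^ (-1 : ℝ))
        (f := fun x => F (domainMap (x, (n : ℝ))) * arcDeriv x) ?_
      · refine this.trans (le_of_eq ?_)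
        norm_num
      · intro x hx
        rw [uIoc_of_le (by norm_num)] at hx
        have hx1 : |x| ≤ 1 / 2 := abs_le.mpr ⟨hx.1.le, hx.2⟩
        have hh := half_le_arcHeight hx1
        have h1 := hC' (domainMap (x, (n : ℝ))) (by simp; linarith) (by simp; linarith)
        have h2 : (domainMap (x, (n : ℝ))).im ^ (-1 : ℝ) ≤ (n : ℝ) ^ (-1 : ℝ) :=
          Real.rpow_le_rpow_of_nonpos (by linarith) (by simp; linarith) (by norm_num)
        rw [norm_mul]
        calc _ ≤ (C' * (n : ℝ) ^ (-1 : ℝ)) * D :=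
              mul_le_mul (h1.trans (mul_le_mul_of_nonneg_left h2 hC'0)) (hD x ⟨hx.1.le, hx.2⟩)
                (norm_nonneg _) (by positivity)
          _ = _ := by ring
    · have := ((tendsto_rpow_neg_atTop (y := 1) one_pos).comp
        (tendsto_natCast_atTop_atTop (R := ℝ))).const_mul (C' * D)
      simpa using this
  have hfin := (tendsto_const_nhds (x := ∫ x in (-(1 / 2) : ℝ)..(1 / 2),
    F (arc x) * arcDeriv x)).sub hzero
  rw [sub_zero] at hfin
  refine hfin.congr fun n => ?_
  rw [integral_domainMap_truncated hF hB hper n.cast_nonneg]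

/-! ### Integration over the fundamental domain -/

/-- The map is a shear: for fixed x it is a vertical translation by `arcHeight x`. -/
lemma measurePreserving_domainMap : MeasurePreserving domainMap := by
  have h1 : MeasurePreserving (fun q : ℝ × ℝ => (q.1, arcHeight q.1 + q.2)) := by
    refine (MeasurePreserving.id volume).skew_product (g := fun x u => arcHeight x + u) ?_
      (Eventually.of_forall fun x => ?_)
    · exact ((continuous_arcHeight.comp continuous_fst).add continuous_snd).measurable
    · exact map_add_left_eq_self volume (arcHeight x)
  have h2 := (Complex.volume_preserving_equiv_real_prod.symm _).comp h1
  have e : domainMap = Complex.measurableEquivRealProd.symm ∘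
      fun q : ℝ × ℝ => (q.1, arcHeight q.1 + q.2) := by
    ext q
    simp only [domainMap, arc, Function.comp, Complex.measurableEquivRealProd_symm_apply]
    apply Complex.ext <;> simp
  rw [e]
  exact h2

lemma measurableEmbedding_domainMap : MeasurableEmbedding domainMap := by
  refine MeasurableEmbedding.of_measurable_inverse (g := fun z => (z.re, z.im - arcHeight z.re))
    continuous_domainMap.measurable ?_ ?_ ?_
  · have : range domainMap = univ := by
      refine eq_univ_of_forall fun z => ⟨(z.re, z.im - arcHeight z.re), ?_⟩
      apply Complex.ext <;> simp
    rw [this]; exact MeasurableSet.univ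
  · have := continuous_arcHeight
    exact Continuous.measurable (by fun_prop)
  · intro q
    simp

lemma domainMap_preimage : domainMap ⁻¹' {z : ℂ | (1 ≤ normSq z ∧ |z.re| ≤ 1 / 2) ∧ 0 < z.im} =
    Icc (-(1 / 2)) (1 / 2) ×ˢ Ici 0 := by
  ext q
  simp only [mem_preimage, mem_ofPred_eq, mem_prod, mem_Icc, mem_Ici, domainMap_re, domainMap_im,
    ← abs_le, normSq_apply]
  constructor
  · rintro ⟨⟨h1, h2⟩, h3⟩
    refine ⟨h2, ?_⟩
    have h4 := arcHeight_sq (x := q.1) (by linarith)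
    have h5 := arcHeight_pos (x := q.1) (by linarith)
    by_contra! h
    nlinarith
  · rintro ⟨h1, h2⟩
    have h4 := arcHeight_sq (x := q.1) (by linarith)
    have h5 := arcHeight_pos (x := q.1) (by linarith)
    exact ⟨⟨by nlinarith, h1⟩, by linarith⟩

lemma measurableSet_domain :
    MeasurableSet {z : ℂ | (1 ≤ normSq z ∧ |z.re| ≤ 1 / 2) ∧ 0 < z.im} := by
  have h1 : MeasurableSet {z : ℂ | 1 ≤ normSq z} :=
    (isClosed_le continuous_const continuous_normSq).measurableSet
  have h2 : MeasurableSet {z : ℂ | |z.re| ≤ 1 / 2} :=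
    (isClosed_le (continuous_abs.comp continuous_re) continuous_const).measurableSet
  exact (h1.inter h2).inter isOpen_im_pos.measurableSet

lemma coe_preimage_domain : 𝒟 = UpperHalfPlane.coe ⁻¹'
    {z : ℂ | (1 ≤ normSq z ∧ |z.re| ≤ 1 / 2) ∧ 0 < z.im} := by
  ext τ
  simp only [mem_preimage, mem_ofPred_eq, ModularGroup.fd]
  exact ⟨fun h => ⟨h, τ.im_pos⟩, fun h => h.1⟩

lemma measurePreserving_coe : MeasurePreserving UpperHalfPlane.coe
    ((volume : Measure ℂ).comap UpperHalfPlane.coe)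
      ((volume : Measure ℂ).restrict (Set.range UpperHalfPlane.coe)) :=
  ⟨UpperHalfPlane.measurable_coe, by rw [UpperHalfPlane.measurableEmbedding_coe.map_comap]⟩

lemma measurable_density : Measurable fun z : UpperHalfPlane =>
    ((1 / NNReal.mk z.im z.im_pos.le : NNReal) ^ 2) := by
  have : Measurable fun z : UpperHalfPlane => NNReal.mk z.im z.im_pos.le :=
    (UpperHalfPlane.continuous_im.subtype_mk _).measurable
  exact (measurable_const.div this).pow_const 2

lemma restrict_range_restrict_domain :
    ((volume : Measure ℂ).restrict (Set.range UpperHalfPlane.coe)).restrict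
      {z : ℂ | (1 ≤ normSq z ∧ |z.re| ≤ 1 / 2) ∧ 0 < z.im} =
    (volume : Measure ℂ).restrict {z : ℂ | (1 ≤ normSq z ∧ |z.re| ≤ 1 / 2) ∧ 0 < z.im} := by
  rw [Measure.restrict_restrict measurableSet_domain, inter_eq_left.mpr]
  intro z hz
  exact ⟨⟨z, hz.2⟩, rfl⟩

lemma density_smul (Φ : ℂ → ℂ) (τ : UpperHalfPlane) :
    ((1 / NNReal.mk τ.im τ.im_pos.le : NNReal) ^ 2) • Φ τ =
      (fun z : ℂ => (((z.im)⁻¹ ^ 2 : ℝ) : ℂ) * Φ z) τ := by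
  rw [NNReal.smul_def, real_smul]
  simp

lemma integrableOn_fd_iff (Φ : ℂ → ℂ) :
    IntegrableOn (fun τ : UpperHalfPlane => Φ τ) 𝒟 ↔
      IntegrableOn (fun q => (((domainMap q).im⁻¹ ^ 2 : ℝ) : ℂ) * Φ (domainMap q))
        (Icc (-(1 / 2)) (1 / 2) ×ˢ Ici 0) := by
  rw [IntegrableOn, UpperHalfPlane.volume_def, restrict_withDensity',
    integrable_withDensity_iff_integrable_smul measurable_density]
  simp only [density_smul]
  rw [← IntegrableOn, coe_preimage_domain]
  have := measurePreserving_coe.integrableOn_comp_preimage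
    (s := {z : ℂ | (1 ≤ normSq z ∧ |z.re| ≤ 1 / 2) ∧ 0 < z.im})
    (f := fun z : ℂ => (((z.im)⁻¹ ^ 2 : ℝ) : ℂ) * Φ z) UpperHalfPlane.measurableEmbedding_coe
  refine this.trans ?_
  rw [IntegrableOn, restrict_range_restrict_domain, ← domainMap_preimage]
  exact (measurePreserving_domainMap.integrableOn_comp_preimage
    measurableEmbedding_domainMap).symm

lemma integral_fd (Φ : ℂ → ℂ) :
    ∫ τ in 𝒟, Φ (τ : UpperHalfPlane) = ∫ q in Icc (-(1 / 2) : ℝ) (1 / 2) ×ˢ Ici (0 : ℝ),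
      (((domainMap q).im⁻¹ ^ 2 : ℝ) : ℂ) * Φ (domainMap q) := by
  rw [UpperHalfPlane.volume_def, restrict_withDensity',
    integral_withDensity_eq_integral_smul measurable_density]
  simp only [density_smul]
  rw [coe_preimage_domain]
  have := measurePreserving_coe.setIntegral_preimage_emb UpperHalfPlane.measurableEmbedding_coe
    (fun z : ℂ => (((z.im)⁻¹ ^ 2 : ℝ) : ℂ) * Φ z)
    {z : ℂ | (1 ≤ normSq z ∧ |z.re| ≤ 1 / 2) ∧ 0 < z.im}
  refine this.trans ?_
  rw [restrict_range_restrict_domain, ← domainMap_preimage]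
  exact (measurePreserving_domainMap.setIntegral_preimage_emb
    measurableEmbedding_domainMap (fun z : ℂ => (((z.im)⁻¹ ^ 2 : ℝ) : ℂ) * Φ z) _).symm

/-! ### The Petersson product as a contour integral -/

lemma arc_mem {x : ℝ} (hx : x ∈ uIcc (-(1 / 2) : ℝ) (1 / 2)) : |x| ≤ 1 / 2 ∧ |x| < 1 ∧
    0 < (arc x).im ∧ |(arc x).re| < 1 := by
  rw [uIcc_of_le (by norm_num)] at hx
  have h : |x| ≤ 1 / 2 := abs_le.mpr hx
  have h1 : |x| < 1 := by linarith
  exact ⟨h, h1, by rw [arc_im]; exact arcHeight_pos h1, by rw [arc_re]; exact h1⟩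

/-- On the unit circle -1/z = -conj z, so S acts on the arc by x ↦ -x. -/
lemma arc_mul_conj {x : ℝ} (hx : |x| < 1) : arc x * arc (-x) = -1 := by
  have h : arcHeight (-x) = arcHeight x := by simp [arcHeight]
  have h2 := arcHeight_sq hx
  apply Complex.ext
  · simp only [mul_re, arc_re, arc_im, h, neg_re, one_re]; linarith
  · simp only [mul_im, arc_re, arc_im, h, neg_im, one_im]; ring

/-- This is the derivative of arc(-x) = -1/arc(x). -/
lemma arcDeriv_neg {x : ℝ} (hx : |x| < 1) : arc x ^ 2 * arcDeriv (-x) = -arcDeriv x := by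
  have h : arcHeight (-x) = arcHeight x := by simp [arcHeight]
  have h2 := arcHeight_sq hx
  have h3 := (arcHeight_pos hx).ne'
  apply Complex.ext
  · simp only [pow_two, mul_re, mul_im, arc_re, arc_im, arcDeriv, h, neg_re, add_re, one_re,
      ofReal_re, I_re, ofReal_im, I_im, add_im, one_im]
    field_simp
    linear_combination (-arcHeight x) * h2
  · simp only [pow_two, mul_re, mul_im, arc_re, arc_im, arcDeriv, h, neg_im, add_re, one_re,
      ofReal_re, I_re, ofReal_im, I_im, add_im, one_im]
    field_simp
    ring_nf
    linear_combination x * h2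

/-- The hypothesis says that J dz is invariant under S, and S maps the arc to itself with reversed
orientation, so the integral equals its negative. -/
lemma integral_arc_eq_zero {J : ℂ → ℂ}
    (hJ : ∀ z : ℂ, 0 < z.im → |z.re| ≤ 1 → |(-z⁻¹).re| ≤ 1 → J (-z⁻¹) = z ^ 2 * J z) :
    ∫ x in (-(1 / 2) : ℝ)..(1 / 2), J (arc x) * arcDeriv x = 0 := by
  have h1 := intervalIntegral.integral_comp_neg (a := (-(1 / 2) : ℝ)) (b := 1 / 2)
    (fun x => J (arc x) * arcDeriv x)
  rw [neg_neg] at h1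
  have h2 : ∀ x ∈ uIcc (-(1 / 2) : ℝ) (1 / 2),
      J (arc (-x)) * arcDeriv (-x) = -(J (arc x) * arcDeriv x) := by
    intro x hx
    obtain ⟨-, h1, h2, h3⟩ := arc_mem hx
    have e : -(arc x)⁻¹ = arc (-x) := by
      have := arc_mul_conj h1
      have h0 := ne_zero_of_im_pos h2
      field_simp
      linear_combination -this
    have := hJ (arc x) h2 h3.le (by rw [e, arc_re, abs_neg]; exact h1.le)
    rw [e] at this
    rw [this]
    linear_combination J (arc x) * arcDeriv_neg h1
  rw [intervalIntegral.integral_congr h2, intervalIntegral.integral_neg] at h1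
  linear_combination (-(1 / 2) : ℂ) * h1

lemma continuousOn_arcDeriv_uIcc : ContinuousOn arcDeriv (uIcc (-(1 / 2) : ℝ) (1 / 2)) :=
  continuousOn_arcDeriv.mono fun _ hx => (arc_mem hx).2.1

lemma continuous_arc : Continuous arc := by
  unfold arc
  have := continuous_arcHeight
  fun_prop

lemma rho_eq_arc : rho = arc (1 / 2) := by
  have h1 : arcHeight (1 / 2) = √3 / 2 := by
    rw [arcHeight, show (1 : ℝ) - (1 / 2) ^ 2 = 3 / 2 ^ 2 by norm_num,
      Real.sqrt_div (by norm_num), Real.sqrt_sq (by norm_num)]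
  have h2 : (Real.pi : ℂ) * I / 3 = ((Real.pi / 3 : ℝ) : ℂ) * I := by push_cast; ring
  rw [rho, h2, exp_mul_I, ← ofReal_cos, ← ofReal_sin, Real.cos_pi_div_three,
    Real.sin_pi_div_three, arc, h1]

lemma rho_sub_one_eq_arc : rho - 1 = arc (-(1 / 2)) := by
  rw [rho_eq_arc]
  simp [arc, arcHeight]; ring

/-- For a holomorphic integrand the arc from `ρ - 1` to `ρ` can be replaced by the segment. -/
lemma integral_arc_eq_segment {J : ℂ → ℂ} (hJ : DifferentiableOn ℂ J {z : ℂ | 0 < z.im}) :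
    ∫ x in (-(1 / 2) : ℝ)..(1 / 2), J (arc x) * arcDeriv x =
      ∫ u in (0 : ℝ)..1, J (rho - 1 + (u : ℂ) * (rho - (rho - 1))) * (rho - (rho - 1)) := by
  obtain ⟨P, hP⟩ := exists_primitive hJ
  have him : 0 < rho.im := by
    rw [rho_eq_arc, arc_im]
    exact arcHeight_pos (by norm_num [abs_of_pos])
  have hseg : ∀ u : ℝ, 0 < (rho - 1 + (u : ℂ) * (rho - (rho - 1))).im := fun u => by
    simpa using him
  rw [intervalIntegral.integral_eq_sub_of_hasDerivAt (f := fun x => P (arc x)),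
    intervalIntegral.integral_eq_sub_of_hasDerivAt
      (f := fun u : ℝ => P (rho - 1 + (u : ℂ) * (rho - (rho - 1))))]
  · rw [← rho_eq_arc, ← rho_sub_one_eq_arc]
    simp
  · intro u _
    have h1 : HasDerivAt (fun u : ℝ => rho - 1 + (u : ℂ) * (rho - (rho - 1)))
        (rho - (rho - 1)) u := by
      simpa using ((hasDerivAt_id u).ofReal_comp.mul_const (rho - (rho - 1))).const_add (rho - 1)
    exact (hP _ (hseg u)).comp u h1
  · refine ContinuousOn.intervalIntegrable (ContinuousOn.mul ?_ continuousOn_const)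
    exact hJ.continuousOn.comp (by fun_prop) fun u _ => hseg u
  · intro x hx
    obtain ⟨-, h1, h2, -⟩ := arc_mem hx
    exact (hP _ h2).comp x (hasDerivAt_arc h1)
  · exact ContinuousOn.intervalIntegrable ((hJ.continuousOn.comp continuous_arc.continuousOn
      fun x hx => (arc_mem hx).2.2.1).mul continuousOn_arcDeriv_uIcc)

/-- The Knopp cocycle value `c^K (i, ∞)`. -/
def knoppAtI (F : ℂ → ℂ) (p : ℝ) (z : ℂ) : ℂ := conj (verticalIntegral F p (conj z) I)

lemma RapidDecay.differentiableOn_knoppAtI {F : ℂ → ℂ} (hF : RapidDecay F) (p : ℝ) :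
    DifferentiableOn ℂ (knoppAtI F p) {z : ℂ | 0 < z.im} := by
  intro z hz
  have hz : 0 < z.im := hz
  have := (hF.differentiableAt_verticalIntegral p (t := conj z) (z := I) (by simpa using hz)
    (by simp) (by simp)).conj_conj
  rw [conj_conj] at this
  exact this.differentiableWithinAt

/-- Conjugation commutes with the principal power off the negative axis, and conj(z - conj z) =
y·(-2i) with y > 0, so the positive factor splits off. -/
lemma conj_sub_conj_cpow {z : ℂ} (hz : 0 < z.im) (p : ℝ) :
    conj ((z - conj z) ^ (p : ℂ)) = (-2 * I) ^ (p : ℂ) * ((z.im ^ p : ℝ) : ℂ) := by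
  have e : z - conj z = ((2 * z.im : ℝ) : ℂ) * I := by
    apply Complex.ext <;> simp; ring
  have him : 0 < (z - conj z).im := by rw [e]; simpa using hz
  have h1 := conj_cpow (z - conj z) (p : ℂ) (arg_lt_pi_of_im_pos him).ne
  rw [conj_ofReal] at h1
  have h2 : conj (z - conj z) = (z.im : ℂ) * (-2 * I) := by
    apply Complex.ext <;> simp
    ring
  have h3 : (-2 * I : ℂ) ≠ 0 := by simp
  have h4 : (z.im : ℂ) ≠ 0 := by exact_mod_cast hz.ne'
  rw [← h1, h2, cpow_def_of_ne_zero (mul_ne_zero h4 h3), log_ofReal_mul hz h3, add_mul, exp_add,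
    ofReal_cpow hz.le, cpow_def_of_ne_zero h4, cpow_def_of_ne_zero h3, ofReal_log hz.le, mul_comm]

variable {F₁ F₂ : ℂ → ℂ} {p : ℝ} {μ ν : ℂ}

lemma exists_norm_mul_conj_le (h₁ : RapidDecay F₁) (h₂ : RapidDecay F₂) (p : ℝ) :
    ∃ C : ℝ, ∀ z : ℂ, |z.re| ≤ 1 → 1 / 2 ≤ z.im →
      ‖F₁ z * conj (F₂ z) * ((z.im ^ p : ℝ) : ℂ)‖ ≤ C * z.im ^ (-2 : ℝ) := by
  obtain ⟨C, hC, h⟩ := h₁.decay (1 / 2) (by norm_num) 2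
  obtain ⟨D, hD, h'⟩ := h₂.decay (1 / 2) (by norm_num) p
  refine ⟨C * D, fun z hx hy => ?_⟩
  have hz : 0 < z.im := by linarith
  rw [norm_mul, norm_mul, norm_conj, norm_real, Real.norm_of_nonneg (Real.rpow_nonneg hz.le _)]
  calc _ ≤ (C * z.im ^ (-2 : ℝ)) * (D * z.im ^ (-p)) * z.im ^ p := by
        gcongr
        · exact h z hx hy
        · exact h' z hx hy
    _ = C * D * z.im ^ (-2 : ℝ) * (z.im ^ (-p) * z.im ^ p) := by ring
    _ = _ := by rw [← Real.rpow_add hz]; simp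

lemma continuousOn_mul_conj (h₁ : RapidDecay F₁) (h₂ : RapidDecay F₂) (p : ℝ) :
    ContinuousOn (fun z => F₁ z * conj (F₂ z) * ((z.im ^ p : ℝ) : ℂ)) {z : ℂ | 0 < z.im} := by
  refine (h₁.holo.continuousOn.mul (continuous_conj.comp_continuousOn h₂.holo.continuousOn)).mul
    (continuous_ofReal.comp_continuousOn ?_)
  exact continuous_im.continuousOn.rpow_const fun z hz => Or.inl (ne_of_gt hz)

lemma integrableOn_petersson (h₁ : RapidDecay F₁) (h₂ : RapidDecay F₂) (p : ℝ) :
    IntegrableOn (fun τ : UpperHalfPlane => F₁ τ * conj (F₂ τ) * ((τ.im ^ (p + 2) : ℝ) : ℂ)) 𝒟 := by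
  obtain ⟨C, hC⟩ := exists_norm_mul_conj_le h₁ h₂ p
  have := integrableOn_domainMap (continuousOn_mul_conj h₁ h₂ p) hC
  refine (integrableOn_fd_iff fun z => F₁ z * conj (F₂ z) * ((z.im ^ (p + 2) : ℝ) : ℂ)).mpr ?_
  refine this.congr_fun (fun q hq => ?_) (measurableSet_Icc.prod measurableSet_Ici)
  have hq' := hq
  rw [← domainMap_preimage] at hq'
  have him : 0 < (domainMap q).im := hq'.2
  beta_reduce
  rw [Real.rpow_add him, Real.rpow_two]
  have : ((domainMap q).im : ℂ) ≠ 0 := by exact_mod_cast him.ne'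
  push_cast
  field_simp

/-- The Petersson product as a contour integral over the segment from `ρ - 1` to `ρ`. -/
lemma petersson_eq_integral_segment (h₁ : RapidDecay F₁) (h₂ : RapidDecay F₂)
    (hμ : ‖μ‖ = 1) (hν : ‖ν‖ = 1)
    (hS₁ : ∀ z : ℂ, 0 < z.im → F₁ (-z⁻¹) = μ * z ^ ((p + 2 : ℝ) : ℂ) * F₁ z)
    (hS₂ : ∀ z : ℂ, 0 < z.im → F₂ (-z⁻¹) = μ * z ^ ((p + 2 : ℝ) : ℂ) * F₂ z)
    (hT₁ : ∀ z : ℂ, 0 < z.im → F₁ (z + 1) = ν * F₁ z)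
    (hT₂ : ∀ z : ℂ, 0 < z.im → F₂ (z + 1) = ν * F₂ z) :
    -2 * I * (-2 * I) ^ (p : ℂ) *
      ∫ τ in 𝒟, F₁ (τ : UpperHalfPlane) * conj (F₂ τ) * ((τ.im ^ (p + 2) : ℝ) : ℂ) =
    ∫ u in (0 : ℝ)..1, F₁ (rho - 1 + (u : ℂ) * (rho - (rho - 1))) *
      knoppAtI F₂ p (rho - 1 + (u : ℂ) * (rho - (rho - 1))) * (rho - (rho - 1)) := by
  have hμ' : μ * conj μ = 1 := by rw [mul_conj, normSq_eq_norm_sq, hμ]; simp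
  have hν' : ν * conj ν = 1 := by rw [mul_conj, normSq_eq_norm_sq, hν]; simp
  have hGcont : ContinuousOn (conjEichler F₂ p) {z : ℂ | |z.re| < 1 ∧ 0 < z.im} := fun z hz => by
    obtain ⟨a, ha⟩ := h₂.hasFDerivAt_conjEichler p hz.1 hz.2
    exact ha.continuousAt.continuousWithinAt
  -- Stokes
  set B : ℂ → ℂ := fun z => -(-2 * I) ^ (p : ℂ) *
    (F₁ z * conj (F₂ z) * ((z.im ^ p : ℝ) : ℂ)) with hBdef
  have hF : ∀ z : ℂ, |z.re| < 1 → 0 < z.im → ∃ a : ℂ, HasFDerivAt (𝕜 := ℝ)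
      (fun z => F₁ z * conjEichler F₂ p z)
      (a • (1 : ℂ →L[ℝ] ℂ) + B z • (conjCLE : ℂ →L[ℝ] ℂ)) z := by
    intro z hx hz
    obtain ⟨a, ha⟩ := h₂.hasFDerivAt_conjEichler p hx hz
    have hd := ((h₁.holo z hz).differentiableAt
      (isOpen_im_pos.mem_nhds hz)).hasDerivAt.hasFDerivAt.restrictScalars ℝ
    refine ⟨F₁ z * a + conjEichler F₂ p z * deriv F₁ z, (hd.mul ha).congr_fderiv ?_⟩
    ext w
    simp [hBdef, conj_sub_conj_cpow hz]
    ring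
  have hBcont : ContinuousOn B {z : ℂ | 0 < z.im} :=
    continuousOn_const.mul (continuousOn_mul_conj h₁ h₂ p)
  have hper : ∀ z : ℂ, 0 < z.im →
      F₁ (z + 1) * conjEichler F₂ p (z + 1) = F₁ z * conjEichler F₂ p z := by
    intro z hz
    rw [hT₁ z hz, conjEichler_add_one hT₂ hz]
    linear_combination F₁ z * conjEichler F₂ p z * hν'
  obtain ⟨C, hC⟩ := exists_norm_mul_conj_le h₁ h₂ p
  obtain ⟨D, hD, hD'⟩ := h₁.decay (1 / 2) (by norm_num) 1
  obtain ⟨E, hE, hE'⟩ := h₂.exists_norm_conjEichler_le p (y₀ := 1 / 2) (by norm_num)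
  have hstokes := integral_domainMap (F := fun z => F₁ z * conjEichler F₂ p z) hF hBcont hper
    (C := ‖(-2 * I) ^ (p : ℂ)‖ * C) (C' := D * E)
    (fun z hx hy => by
      rw [hBdef]; beta_reduce
      rw [norm_mul, norm_neg, mul_assoc _ C]
      exact mul_le_mul_of_nonneg_left (hC z hx hy)
        (norm_nonneg ((-2 * I : ℂ) ^ (p : ℂ))))
    (fun z hx hy => by
      rw [norm_mul]
      have h0 : (0 : ℝ) ≤ z.im ^ (-1 : ℝ) := Real.rpow_nonneg (by linarith) _
      calc _ ≤ D * z.im ^ (-1 : ℝ) * E :=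
            mul_le_mul (hD' z hx hy) (hE' z hx hy) (norm_nonneg _) (by positivity)
        _ = _ := by ring)
  have hpet := integral_fd fun z => F₁ z * conj (F₂ z) * ((z.im ^ (p + 2) : ℝ) : ℂ)
  have hcongr : ∀ q ∈ Icc (-(1 / 2) : ℝ) (1 / 2) ×ˢ Ici (0 : ℝ), 2 * I * B (domainMap q) =
      -2 * I * (-2 * I) ^ (p : ℂ) * ((((domainMap q).im⁻¹ ^ 2 : ℝ) : ℂ) *
        (F₁ (domainMap q) * conj (F₂ (domainMap q)) * (((domainMap q).im ^ (p + 2) : ℝ) : ℂ))) := by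
    intro q hq
    rw [← domainMap_preimage] at hq
    have him : 0 < (domainMap q).im := hq.2
    rw [hBdef]; beta_reduce
    rw [Real.rpow_add him, Real.rpow_two]
    have : ((domainMap q).im : ℂ) ≠ 0 := by exact_mod_cast him.ne'
    push_cast
    field_simp
  rw [setIntegral_congr_fun (measurableSet_Icc.prod measurableSet_Ici) hcongr,
    integral_const_mul, ← hpet] at hstokes
  refine hstokes.trans ?_
  rw [← integral_arc_eq_segment (J := fun z => F₁ z * knoppAtI F₂ p z)
    (h₁.holo.mul (h₂.differentiableOn_knoppAtI p))]
  -- the Eichler integral based at `i` does not contribute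
  have hzero := integral_arc_eq_zero (J := fun z => F₁ z * conjEichlerBased F₂ p z)
    (fun z hz hx hx' => by
      rw [hS₁ z hz, h₂.conjEichlerBased_neg_inv hS₂ hz hx hx']
      have hz0 := ne_zero_of_im_pos hz
      have e2 : z ^ ((p + 2 : ℝ) : ℂ) * z ^ (-(p : ℂ)) = z ^ 2 := by
        rw [← cpow_add _ _ hz0]
        push_cast
        rw [show (p : ℂ) + 2 + -p = ((2 : ℕ) : ℂ) by push_cast; ring, cpow_natCast]
      linear_combination F₁ z * conjEichlerBased F₂ p z * (μ * conj μ * e2 + z ^ 2 * hμ'))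
  -- The two arc integrands differ by F₁ times `conjEichlerBased`, whose integral has just been
  -- shown to vanish.
  rw [← sub_eq_zero, ← hzero, ← intervalIntegral.integral_sub]
  · refine intervalIntegral.integral_congr fun x _ => ?_
    simp only [conjEichlerBased, knoppAtI]
    ring
  · refine ContinuousOn.intervalIntegrable (ContinuousOn.mul (ContinuousOn.mul ?_ ?_)
      continuousOn_arcDeriv_uIcc)
    · exact h₁.holo.continuousOn.comp continuous_arc.continuousOn fun x hx => (arc_mem hx).2.2.1
    · exact hGcont.comp continuous_arc.continuousOn
        fun x hx => ⟨(arc_mem hx).2.2.2, (arc_mem hx).2.2.1⟩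
  · refine ContinuousOn.intervalIntegrable (ContinuousOn.mul ?_ continuousOn_arcDeriv_uIcc)
    exact (h₁.holo.mul (h₂.differentiableOn_knoppAtI p)).continuousOn.comp
      continuous_arc.continuousOn fun x hx => (arc_mem hx).2.2.1

/-! ### Circles in the disk coordinate -/

/-- A contour integral over a circle can be computed with any parametrization of winding number
`1`. -/
lemma circleIntegral_eq_of_param {γ γ' : ℝ → ℂ} {z₀ : ℂ} {R : ℝ} (hR : 0 < R)
    (hγ : ∀ θ, HasDerivAt γ (γ' θ) θ) (hγ' : Continuous γ') (hn : ∀ θ, ‖γ θ - z₀‖ = R)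
    (hw : ∫ θ in (0 : ℝ)..2 * Real.pi, γ' θ / (γ θ - z₀) = 2 * Real.pi * I) {F : ℂ → ℂ}
    (hF : ContinuousOn F (Metric.sphere z₀ R)) :
    (∮ z in C(z₀, R), F z) = ∫ θ in (0 : ℝ)..2 * Real.pi, γ' θ * F (γ θ) := by
  have hγc : Continuous γ := continuous_iff_continuousAt.mpr fun θ => (hγ θ).continuousAt
  have hne : ∀ θ, γ θ - z₀ ≠ 0 := fun θ => norm_pos_iff.mp (by rw [hn]; exact hR)
  have hlc : Continuous fun θ => γ' θ / (γ θ - z₀) :=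
    hγ'.div (hγc.sub continuous_const) hne
  -- L is a continuous logarithm of γ - z₀ up to its initial value. Constancy of |γ - z₀| makes L
  -- purely imaginary, so γ is the standard circle with angle φ₀ + im L.
  set L : ℝ → ℂ := fun θ => ∫ u in (0 : ℝ)..θ, γ' u / (γ u - z₀) with hL
  have hLd : ∀ θ, HasDerivAt L (γ' θ / (γ θ - z₀)) θ := fun θ =>
    intervalIntegral.integral_hasDerivAt_right (hlc.intervalIntegrable _ _)
      hlc.aestronglyMeasurable.stronglyMeasurableAtFilter hlc.continuousAt
  have hexp : ∀ θ, γ θ - z₀ = (γ 0 - z₀) * exp (L θ) := by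
    have hd : ∀ θ, HasDerivAt (fun θ => (γ θ - z₀) * exp (-L θ)) 0 θ := by
      intro θ
      refine (((hγ θ).sub_const z₀).mul ((hLd θ).fun_neg.cexp)).congr_deriv ?_
      have := hne θ
      field_simp; ring
    intro θ
    have := is_const_of_deriv_eq_zero (𝕜 := ℝ) (fun θ => (hd θ).differentiableAt)
      (fun θ => (hd θ).deriv) θ 0
    have h0 : L 0 = 0 := by simp [hL]
    simp only [h0, neg_zero, exp_zero, mul_one] at this
    rw [← this, mul_assoc, ← exp_add]; simp
  have hre : ∀ θ, (L θ).re = 0 := by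
    intro θ
    have h1 := hn θ
    rw [hexp θ, norm_mul, hn 0, norm_exp] at h1
    have h2 : Real.exp (L θ).re = 1 := by
      have := hR.ne'
      field_simp at h1
      exact h1
    exact Real.exp_eq_one_iff _ |>.mp h2
  set φ₀ := arg (γ 0 - z₀) with hφ₀
  have hcirc : ∀ θ, γ θ = circleMap z₀ R (φ₀ + (L θ).im) := by
    intro θ
    have h1 : L θ = ((L θ).im : ℂ) * I := by apply Complex.ext <;> simp [hre]
    have h2 : γ 0 - z₀ = (R : ℂ) * exp (φ₀ * I) := by
      rw [← hn 0]; exact (norm_mul_exp_arg_mul_I _).symm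
    rw [← sub_add_cancel (γ θ) z₀, hexp θ, h2, circleMap, add_comm, mul_assoc, ← exp_add]
    congr 3
    rw [ofReal_add, add_mul, ← h1]
  have hℓd : ∀ θ, HasDerivAt (fun θ => φ₀ + (L θ).im) (γ' θ / (γ θ - z₀)).im θ := fun θ => by
    have := (imCLM.hasFDerivAt.comp_hasDerivAt θ (hLd θ)).const_add φ₀
    simpa using this
  -- The winding hypothesis makes the angle increase by exactly 2π; periodicity then moves the
  -- starting angle from φ₀ to 0.
  have hL2 : (L (2 * Real.pi)).im = 2 * Real.pi := by
    have : L (2 * Real.pi) = ((2 * Real.pi : ℝ) : ℂ) * I := by rw [hL]; simp [hw]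
    rw [this]; simp
  have hcont : Continuous fun φ => deriv (circleMap z₀ R) φ • F (circleMap z₀ R φ) := by
    simp only [deriv_circleMap]
    exact ((continuous_circleMap _ _).mul continuous_const).smul
      (hF.comp_continuous (continuous_circleMap _ _) fun φ => circleMap_mem_sphere _ hR.le _)
  have hsub := intervalIntegral.integral_deriv_smul_comp (a := 0) (b := 2 * Real.pi)
    (f := fun θ => φ₀ + (L θ).im) (f' := fun θ => (γ' θ / (γ θ - z₀)).im)
    (g := fun φ => deriv (circleMap z₀ R) φ • F (circleMap z₀ R φ)) (fun θ _ => hℓd θ)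
    (continuous_im.comp hlc).continuousOn hcont
  have h0 : (L 0).im = 0 := by simp [hL]
  rw [h0, hL2, add_zero] at hsub
  have hper : Function.Periodic (fun φ => deriv (circleMap z₀ R) φ • F (circleMap z₀ R φ))
      (2 * Real.pi) := fun φ => by
    simp only [deriv_circleMap, periodic_circleMap _ _ φ]
  have h3 := hper.intervalIntegral_add_eq φ₀ 0
  rw [zero_add] at h3
  rw [circleIntegral, ← h3, ← hsub]
  refine intervalIntegral.integral_congr fun θ _ => ?_
  have hder : γ' θ = ((γ' θ / (γ θ - z₀)).im : ℂ) * deriv (circleMap z₀ R) (φ₀ + (L θ).im) := by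
    have h1 := ((differentiable_circleMap z₀ R) (φ₀ + (L θ).im)).hasDerivAt.scomp θ (hℓd θ)
    have h2 : (circleMap z₀ R) ∘ (fun θ => φ₀ + (L θ).im) = γ := funext fun θ => (hcirc θ).symm
    rw [h2] at h1
    exact ((hγ θ).unique h1).trans (real_smul ..)
  simp only [Function.comp, smul_eq_mul, real_smul]
  rw [← mul_assoc, ← hder, ← hcirc]

/-- The inverse of the disk coordinate. -/
def cayley (w : ℂ) : ℂ := I * (1 + w) / (1 - w)

lemma one_sub_ne_zero_of_norm_lt {w : ℂ} (hw : ‖w‖ < 1) : 1 - w ≠ 0 := by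
  intro h
  rw [← sub_eq_zero.mp h] at hw
  simp at hw

lemma hasDerivAt_cayley {w : ℂ} (hw : ‖w‖ < 1) :
    HasDerivAt cayley (2 * I / (1 - w) ^ 2) w := by
  have h := one_sub_ne_zero_of_norm_lt hw
  have h1 : HasDerivAt (fun w : ℂ => I * (1 + w)) I w := by
    simpa using ((hasDerivAt_id w).const_add 1).const_mul I
  have h2 : HasDerivAt (fun w : ℂ => 1 - w) (-1) w := by
    simpa using (hasDerivAt_id w).const_sub 1
  refine (h1.fun_div h2 h).congr_deriv ?_
  field_simp; ring

lemma add_I_ne_zero {z : ℂ} (hz : 0 < z.im) : z + I ≠ 0 :=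
  ne_zero_of_im_pos (by simp; linarith)

lemma cayley_diskCoord {z : ℂ} (hz : 0 < z.im) : cayley (diskCoord z) = z := by
  have h1 := add_I_ne_zero hz
  have h2 : 1 - (z - I) / (z + I) = 2 * I / (z + I) := by field_simp; ring
  rw [cayley, diskCoord, h2]
  field_simp; ring

lemma cayley_add_I {w : ℂ} (hw : ‖w‖ < 1) : cayley w + I = 2 * I / (1 - w) := by
  have h := one_sub_ne_zero_of_norm_lt hw
  rw [cayley]; field_simp; ring

lemma cayley_sub_I {w : ℂ} (hw : ‖w‖ < 1) : cayley w - I = 2 * I * w / (1 - w) := by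
  have h := one_sub_ne_zero_of_norm_lt hw
  rw [cayley]; field_simp; ring

lemma diskCoord_cayley {w : ℂ} (hw : ‖w‖ < 1) : diskCoord (cayley w) = w := by
  have h := one_sub_ne_zero_of_norm_lt hw
  rw [diskCoord, cayley_add_I hw, cayley_sub_I hw]
  field_simp

lemma cayley_im_pos {w : ℂ} (hw : ‖w‖ < 1) : 0 < (cayley w).im := by
  have h2 : 0 < normSq (1 - w) := normSq_pos.mpr (one_sub_ne_zero_of_norm_lt hw)
  have h3 : w.re * w.re + w.im * w.im < 1 := by
    rw [← normSq_apply, normSq_eq_norm_sq]; nlinarith [norm_nonneg w]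
  rw [cayley, div_im]
  simp only [mul_re, mul_im, I_re, I_im, add_re, add_im, one_re, one_im, sub_re, sub_im]
  rw [← sub_div]
  apply div_pos _ h2
  nlinarith

lemma norm_diskCoord_lt_one {z : ℂ} (hz : 0 < z.im) : ‖diskCoord z‖ < 1 := by
  rw [diskCoord, norm_div, div_lt_one (norm_pos_iff.mpr (add_I_ne_zero hz))]
  apply lt_of_pow_lt_pow_left₀ 2 (norm_nonneg _)
  rw [← normSq_eq_norm_sq, ← normSq_eq_norm_sq, normSq_apply, normSq_apply]
  simp only [sub_re, sub_im, add_re, add_im, I_re, I_im]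
  nlinarith

lemma differentiableOn_cayley : DifferentiableOn ℂ cayley (Metric.ball 0 1) := fun w hw =>
  (hasDerivAt_cayley (by simpa using hw)).differentiableAt.differentiableWithinAt

lemma differentiableOn_diskCoord : DifferentiableOn ℂ diskCoord {z : ℂ | 0 < z.im} :=
  DifferentiableOn.div (by fun_prop) (by fun_prop) fun _ hz => add_I_ne_zero hz

/-- Squaring turns the circle into (1 - c²)(|z|² + 1) = 2(1 + c²) im z, which forces im z > 0 and is
also the squared form of |z - i| = c|z + i|. -/
lemma mem_of_mem_sphere {c : ℝ} (hc : 0 < c) (hc1 : c < 1) {z : ℂ}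
    (hz : z ∈ Metric.sphere ((((1 + c ^ 2) / (1 - c ^ 2) : ℝ) : ℂ) * I) (2 * c / (1 - c ^ 2))) :
    0 < z.im ∧ ‖diskCoord z‖ = c := by
  have h1 : 0 < 1 - c ^ 2 := by nlinarith
  rw [mem_sphere_iff_norm] at hz
  have h2 := congrArg (· ^ 2) hz
  simp only [← normSq_eq_norm_sq] at h2
  rw [normSq_apply] at h2
  simp only [sub_re, sub_im, mul_re, mul_im, ofReal_re, ofReal_im, I_re, I_im, mul_zero, mul_one,
    sub_zero, add_zero] at h2
  have h3 : (1 - c ^ 2) * (z.re ^ 2 + z.im ^ 2 + 1) = 2 * (1 + c ^ 2) * z.im := by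
    field_simp at h2
    have h4 : (1 - c ^ 2) ^ 2 ≠ 0 := by positivity
    have : (1 - c ^ 2) * ((1 - c ^ 2) * (z.re ^ 2 + z.im ^ 2 + 1)) =
        (1 - c ^ 2) * (2 * (1 + c ^ 2) * z.im) := by linear_combination h2
    exact mul_left_cancel₀ h1.ne' this
  have him : 0 < z.im := by
    by_contra! h
    have : 0 < (1 - c ^ 2) * (z.re ^ 2 + z.im ^ 2 + 1) := by positivity
    nlinarith [sq_nonneg c]
  refine ⟨him, ?_⟩
  rw [diskCoord, norm_div, div_eq_iff (norm_ne_zero_iff.mpr (add_I_ne_zero him))]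
  refine (sq_eq_sq₀ (norm_nonneg _) (by positivity)).mp ?_
  rw [mul_pow, ← normSq_eq_norm_sq, ← normSq_eq_norm_sq, normSq_apply, normSq_apply]
  simp only [sub_re, sub_im, add_re, add_im, I_re, I_im]
  linear_combination h3

/-- The Cayley transform maps |w| = c onto the Euclidean circle, but with non-uniform speed, and the
centre is the image of c² rather than of 0. Hence the comparison through the winding number. -/
lemma diskContour_eq {c : ℝ} (hc : 0 < c) (hc1 : c < 1) {F : ℂ → ℂ}
    (hF : ContinuousOn F {z : ℂ | 0 < z.im ∧ ‖diskCoord z‖ = c}) :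
    diskContour c F = ∮ w in C(0, c), 2 * I / (1 - w) ^ 2 * F (cayley w) := by
  have h1 : 0 < 1 - c ^ 2 := by nlinarith
  have h1' : (1 - (c : ℂ) ^ 2) ≠ 0 := by exact_mod_cast h1.ne'
  have hlt : ∀ w ∈ Metric.sphere (0 : ℂ) c, ‖w‖ < 1 := fun w hw => by
    rw [mem_sphere_zero_iff_norm.mp hw]; exact hc1
  have hmem : ∀ θ, circleMap 0 c θ ∈ Metric.sphere (0 : ℂ) c := fun θ =>
    circleMap_mem_sphere _ hc.le _
  have hdiff : ∀ w ∈ Metric.sphere (0 : ℂ) c,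
      cayley w - (((1 + c ^ 2) / (1 - c ^ 2) : ℝ) : ℂ) * I =
        2 * I * (w - (c : ℂ) ^ 2) / ((1 - w) * (1 - (c : ℂ) ^ 2)) := by
    intro w hw
    have := one_sub_ne_zero_of_norm_lt (hlt w hw)
    rw [cayley]
    push_cast
    field_simp
    ring
  have hnorm : ∀ w ∈ Metric.sphere (0 : ℂ) c, ‖w - (c : ℂ) ^ 2‖ = c * ‖1 - w‖ := by
    intro w hw
    have h2 : (c : ℂ) ^ 2 = w * conj w := by
      rw [mul_conj, normSq_eq_norm_sq, mem_sphere_zero_iff_norm.mp hw]; push_cast; rfl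
    have h3 : w - w * conj w = w * conj (1 - w) := by simp; ring
    rw [h2, h3, norm_mul, norm_conj, mem_sphere_zero_iff_norm.mp hw]
  have hF' : ContinuousOn F
      (Metric.sphere ((((1 + c ^ 2) / (1 - c ^ 2) : ℝ) : ℂ) * I) (2 * c / (1 - c ^ 2))) :=
    hF.mono fun z hz => mem_of_mem_sphere hc hc1 hz
  rw [diskContour, circleIntegral_eq_of_param (γ := fun θ => cayley (circleMap 0 c θ))
    (γ' := fun θ => 2 * I / (1 - circleMap 0 c θ) ^ 2 * deriv (circleMap 0 c) θ)
    (by positivity) ?_ ?_ ?_ ?_ hF']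
  · rw [circleIntegral]
    refine intervalIntegral.integral_congr fun θ _ => ?_
    simp only [smul_eq_mul]; ring
  · intro θ
    exact (hasDerivAt_cayley (hlt _ (hmem θ))).comp θ
      ((differentiable_circleMap 0 c) θ).hasDerivAt
  · refine Continuous.mul (Continuous.div continuous_const (by
      have := continuous_circleMap 0 c
      fun_prop) fun θ => pow_ne_zero 2 (one_sub_ne_zero_of_norm_lt (hlt _ (hmem θ)))) ?_
    rw [show deriv (circleMap 0 c) = fun θ => circleMap 0 c θ * I from
      funext (deriv_circleMap 0 c)]
    exact (continuous_circleMap _ _).mul continuous_const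
  · intro θ
    have h4 : ‖1 - circleMap 0 c θ‖ ≠ 0 :=
      norm_ne_zero_iff.mpr (one_sub_ne_zero_of_norm_lt (hlt _ (hmem θ)))
    have h5 : ‖1 - (c : ℂ) ^ 2‖ = 1 - c ^ 2 := by
      rw [show 1 - (c : ℂ) ^ 2 = ((1 - c ^ 2 : ℝ) : ℂ) by push_cast; ring, norm_real,
        Real.norm_of_nonneg h1.le]
    rw [hdiff _ (hmem θ), norm_div, norm_mul, norm_mul, norm_mul, hnorm _ (hmem θ), norm_I, h5]
    have h6 : ‖(2 : ℂ)‖ = 2 := by simp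
    rw [h6]
    field_simp
  -- The logarithmic derivative of `cayley w` minus the centre is 1/(w - c²) + 1/(1 - w), and only
  -- the pole c² lies inside |w| = c.
  · have h6 : (∮ w in C(0, c), ((w - (c : ℂ) ^ 2)⁻¹ + (1 - w)⁻¹)) = 2 * Real.pi * I := by
      have hc2 : (c : ℂ) ^ 2 ∈ Metric.ball (0 : ℂ) c := by
        rw [mem_ball_zero_iff, norm_pow, norm_real, Real.norm_of_nonneg hc.le]; nlinarith
      have hd : DifferentiableOn ℂ (fun w : ℂ => (1 - w)⁻¹) (Metric.closedBall 0 c) := by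
        refine DifferentiableOn.inv (by fun_prop) fun w hw => ?_
        exact one_sub_ne_zero_of_norm_lt ((mem_closedBall_zero_iff.mp hw).trans_lt hc1)
      rw [circleIntegral.integral_add, circleIntegral.integral_sub_inv_of_mem_ball hc2,
        circleIntegral_eq_zero_of_differentiable_on_off_countable hc.le countable_empty
          hd.continuousOn, add_zero]
      · intro w hw
        exact (hd.mono Metric.ball_subset_closedBall).differentiableAt
          (Metric.isOpen_ball.mem_nhds hw.1)
      · refine ContinuousOn.circleIntegrable hc.le (ContinuousOn.inv₀ (by fun_prop) fun w hw h => ?_)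
        have := hnorm w hw
        rw [h, norm_zero] at this
        have := norm_pos_iff.mpr (one_sub_ne_zero_of_norm_lt (hlt w hw))
        nlinarith
      · exact (hd.continuousOn.mono Metric.sphere_subset_closedBall).circleIntegrable hc.le
    rw [← h6, circleIntegral]
    refine intervalIntegral.integral_congr fun θ _ => ?_
    have h2 := one_sub_ne_zero_of_norm_lt (hlt _ (hmem θ))
    have h3 : circleMap 0 c θ - (c : ℂ) ^ 2 ≠ 0 := fun h => by
      have := hnorm _ (hmem θ)
      rw [h, norm_zero] at this
      have := norm_pos_iff.mpr h2
      nlinarith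
    simp only [hdiff _ (hmem θ), smul_eq_mul]
    have hI := I_ne_zero
    field_simp
    ring

/-! ### Series on circles -/

/-- The coefficients `(s)_k / k!` of `(1 - x) ^ (-s)`. -/
def binomCoeff (s : ℂ) (k : ℕ) : ℂ := (ascPochhammer ℂ k).eval s / (k.factorial : ℂ)

lemma hasSum_one_sub_cpow_neg (s : ℂ) {x : ℂ} (hx : ‖x‖ < 1) :
    HasSum (fun k => binomCoeff s k * x ^ k) ((1 - x) ^ (-s)) := by
  have h := (one_div_one_sub_cpow_hasFPowerSeriesOnBall_zero s).hasSum (y := x) (by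
    rw [← ENNReal.ofReal_one, Metric.eball_ofReal]
    simpa using hx)
  rw [zero_add] at h
  rw [cpow_neg, ← one_div]
  refine h.congr_fun fun k => ?_
  rw [FormalMultilinearSeries.ofScalars_apply_eq, smul_eq_mul]
  congr 1
  rw [Ring.choose, show s + k - 1 - k + 1 = s by ring, binomCoeff, div_eq_iff (by
    exact_mod_cast k.factorial_ne_zero), ← Polynomial.ascPochhammer_smeval_eq_eval,
    ← Ring.factorial_nsmul_multichoose_eq_ascPochhammer, nsmul_eq_mul, mul_comm]

lemma summable_hypergeometric {s : ℂ} (hs : ∀ k : ℕ, (k : ℂ) ≠ -s) {x : ℝ} (hx : 0 ≤ x)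
    (hx1 : x < 1) : Summable fun k : ℕ => ‖(binomCoeff s k)⁻¹‖ * x ^ k := by
  have hrad : (ordinaryHypergeometricSeries ℂ (1 : ℂ) 1 s).radius = 1 := by
    refine ordinaryHypergeometricSeries_radius_eq_one ℂ _ _ _ fun k => ⟨?_, ?_, hs k⟩ <;>
    · intro h
      have := congrArg re h
      simp at this
      have h2 : (0 : ℝ) ≤ k := k.cast_nonneg
      linarith
  have := (ordinaryHypergeometricSeries ℂ (1 : ℂ) 1 s).summable_norm_apply (x := (x : ℂ)) (by
    rw [hrad, ← ENNReal.ofReal_one, Metric.eball_ofReal]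
    simpa [abs_of_nonneg hx] using hx1)
  refine this.congr fun k => ?_
  rw [ordinaryHypergeometricSeries_apply_eq, norm_smul, norm_pow, norm_real,
    Real.norm_of_nonneg hx]
  congr 2
  rw [ascPochhammer_eval_one, binomCoeff]
  have : (k.factorial : ℂ) ≠ 0 := by exact_mod_cast k.factorial_ne_zero
  field_simp

/-- Since (1)_k = k!, the coefficients are k!/(s)_k, the reciprocals of the binomial ones. This is
why the kernel of σ_s undoes the weights of a binomial series. -/
lemma hasSum_hypergeometric {s : ℂ} (hs : ∀ k : ℕ, (k : ℂ) ≠ -s) {x : ℂ} (hx : ‖x‖ < 1) :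
    HasSum (fun k : ℕ => (binomCoeff s k)⁻¹ * x ^ k) (ordinaryHypergeometric (1 : ℂ) 1 s x) := by
  have h1 : Summable fun k : ℕ => (binomCoeff s k)⁻¹ * x ^ k := by
    refine Summable.of_norm ?_
    simpa using summable_hypergeometric hs (norm_nonneg x) hx
  rw [ordinaryHypergeometric_eq_tsum]
  refine h1.hasSum_iff.mpr (tsum_congr fun k => ?_)
  rw [smul_eq_mul, ascPochhammer_eval_one, binomCoeff]
  have : (k.factorial : ℂ) ≠ 0 := by exact_mod_cast k.factorial_ne_zero
  field_simp

lemma hasSum_circleIntegral {c : ℝ} (hc : 0 ≤ c) {f : ℕ → ℂ → ℂ} {S : ℂ → ℂ} {u : ℕ → ℝ}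
    (hf : ∀ k, ContinuousOn (f k) (Metric.sphere 0 c)) (hu : Summable u)
    (hfu : ∀ k, ∀ w ∈ Metric.sphere (0 : ℂ) c, ‖f k w‖ ≤ u k)
    (hS : ∀ w ∈ Metric.sphere (0 : ℂ) c, HasSum (fun k => f k w) (S w)) :
    HasSum (fun k => ∮ w in C(0, c), f k w) (∮ w in C(0, c), S w) := by
  have hmem : ∀ θ, circleMap 0 c θ ∈ Metric.sphere (0 : ℂ) c := fun θ =>
    circleMap_mem_sphere _ hc θ
  have hnorm : ∀ θ, ‖deriv (circleMap 0 c) θ‖ = c := fun θ => by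
    rw [deriv_circleMap, norm_mul, norm_I, mul_one, norm_circleMap_zero, abs_of_nonneg hc]
  simp only [circleIntegral]
  refine intervalIntegral.hasSum_integral_of_dominated_convergence (fun k _ => c * u k) ?_ ?_ ?_ ?_
    ?_
  · intro k
    have hd : Continuous fun θ => deriv (circleMap 0 c) θ := by
      simp only [deriv_circleMap]
      exact (continuous_circleMap _ _).mul continuous_const
    exact (hd.smul ((hf k).comp_continuous (continuous_circleMap _ _) hmem)).aestronglyMeasurable
  · intro k
    refine Eventually.of_forall fun θ _ => ?_
    rw [norm_smul, hnorm]
    exact mul_le_mul_of_nonneg_left (hfu k _ (hmem θ)) hc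
  · exact Eventually.of_forall fun θ _ => hu.mul_left c
  · exact intervalIntegrable_const
  · exact Eventually.of_forall fun θ _ => (hS _ (hmem θ)).const_smul _

lemma circleIntegral_zpow {c : ℝ} (hc : 0 < c) (n : ℤ) :
    (∮ w in C(0, c), w ^ n) = if n = -1 then 2 * Real.pi * I else 0 := by
  split_ifs with h
  · have := circleIntegral.integral_sub_center_inv (0 : ℂ) hc.ne'
    rw [h]
    simpa using this
  · simpa using circleIntegral.integral_sub_zpow_of_ne h 0 0 c

/-- Extraction of a coefficient of a Laurent series whose exponents `e j` are distinct. -/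
lemma circleIntegral_laurent {c : ℝ} (hc : 0 < c) {a : ℕ → ℂ} {e : ℕ → ℤ} {S : ℂ → ℂ}
    (he : Function.Injective e) (ha : Summable fun j => ‖a j‖ * c ^ e j)
    (hS : ∀ w ∈ Metric.sphere (0 : ℂ) c, HasSum (fun j => a j * w ^ e j) (S w)) (k : ℕ) :
    (∮ w in C(0, c), S w * w ^ (-e k - 1)) = 2 * Real.pi * I * a k := by
  have hw0 : ∀ w ∈ Metric.sphere (0 : ℂ) c, w ≠ 0 := fun w hw =>
    norm_pos_iff.mp (by rw [mem_sphere_zero_iff_norm.mp hw]; exact hc)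
  have h := hasSum_circleIntegral hc.le (f := fun j w => a j * w ^ (e j - e k - 1))
    (S := fun w => S w * w ^ (-e k - 1)) (u := fun j => ‖a j‖ * c ^ e j * c ^ (-e k - 1)) ?_
    (ha.mul_right _) ?_ ?_
  · have h2 : ∀ j, (∮ w in C(0, c), a j * w ^ (e j - e k - 1)) =
        if j = k then 2 * Real.pi * I * a k else 0 := by
      intro j
      rw [circleIntegral.integral_const_mul, circleIntegral_zpow hc]
      by_cases hj : j = k
      · subst hj; simp; ring
      · have : e j ≠ e k := fun h => hj (he h)
        rw [if_neg (by omega), if_neg hj, mul_zero]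
    simp only [h2] at h
    exact h.unique (hasSum_ite_eq k _)
  · intro j
    exact continuousOn_const.mul (continuousOn_id.zpow₀ _ fun w hw => Or.inl (hw0 w hw))
  · intro j w hw
    rw [norm_mul, norm_zpow, mem_sphere_zero_iff_norm.mp hw, mul_assoc, ← zpow_add₀ hc.ne']
    refine le_of_eq ?_
    congr 2; ring
  · intro w hw
    have h1 := (hS w hw).mul_right (w ^ (-e k - 1))
    refine h1.congr_fun fun j => ?_
    rw [mul_assoc, ← zpow_add₀ (hw0 w hw)]
    congr 2; ring

lemma summable_norm_mul_pow_of_hasSum {b : ℕ → ℂ} {H : ℂ → ℂ}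
    (hb : ∀ w : ℂ, ‖w‖ < 1 → HasSum (fun k => b k * w ^ k) (H w)) {c : ℝ} (hc : 0 ≤ c)
    (hc1 : c < 1) : Summable fun k => ‖b k‖ * c ^ k := by
  have := (hb (c : ℂ) (by rw [norm_real, Real.norm_of_nonneg hc]; exact hc1)).summable.norm
  simpa [abs_of_nonneg hc] using this

lemma exists_hasSum_of_differentiableOn {H : ℂ → ℂ} (hH : DifferentiableOn ℂ H (Metric.ball 0 1)) :
    ∃ b : ℕ → ℂ, ∀ w : ℂ, ‖w‖ < 1 → HasSum (fun k => b k * w ^ k) (H w) := by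
  refine ⟨fun k => (k.factorial : ℂ)⁻¹ * iteratedDeriv k H 0, fun w hw => ?_⟩
  have := hasSum_taylorSeries_on_ball hH (z := w) (by simpa using hw)
  refine this.congr_fun fun k => ?_
  simp only [smul_eq_mul, sub_zero]
  ring

/-- The pairing of `Σ N_k w ^ (-k - 1)` with `Σ b_k w ^ k`. -/
lemma hasSum_circleIntegral_mul {N b : ℕ → ℂ} {H S : ℂ → ℂ} {c d D : ℝ} (hd : 0 ≤ d) (hdc : d < c)
    (hc1 : c < 1) (hN : ∀ k, ‖N k‖ ≤ D * d ^ k)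
    (hb : ∀ w : ℂ, ‖w‖ < 1 → HasSum (fun k => b k * w ^ k) (H w))
    (hS : ∀ w ∈ Metric.sphere (0 : ℂ) c, HasSum (fun k => N k * (w⁻¹) ^ (k + 1)) (S w)) :
    HasSum (fun k => N k * b k) ((2 * Real.pi * I)⁻¹ * ∮ w in C(0, c), H w * S w) := by
  have hc : 0 < c := hd.trans_lt hdc
  have hw0 : ∀ w ∈ Metric.sphere (0 : ℂ) c, w ≠ 0 := fun w hw =>
    norm_pos_iff.mp (by rw [mem_sphere_zero_iff_norm.mp hw]; exact hc)
  have hsum := summable_norm_mul_pow_of_hasSum hb hc.le hc1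
  have hHb : ∀ w ∈ Metric.sphere (0 : ℂ) c, ‖H w‖ ≤ ∑' k, ‖b k‖ * c ^ k := by
    intro w hw
    have hw' := mem_sphere_zero_iff_norm.mp hw
    rw [← (hb w (by rw [hw']; exact hc1)).tsum_eq]
    refine tsum_of_norm_bounded hsum.hasSum fun k => ?_
    rw [norm_mul, norm_pow, hw']
  have hHc : ContinuousOn H (Metric.sphere 0 c) := by
    have h1 : ContinuousOn (fun w => ∑' k, b k * w ^ k) (Metric.sphere 0 c) := by
      refine continuousOn_tsum (fun k => by fun_prop) hsum fun k w hw => ?_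
      rw [norm_mul, norm_pow, mem_sphere_zero_iff_norm.mp hw]
    refine h1.congr fun w hw => ?_
    exact (hb w (by rw [mem_sphere_zero_iff_norm.mp hw]; exact hc1)).tsum_eq.symm
  have h := hasSum_circleIntegral hc.le (f := fun k w => N k * (H w * (w⁻¹) ^ (k + 1)))
    (S := fun w => H w * S w)
    (u := fun k => (D * (∑' k, ‖b k‖ * c ^ k) * c⁻¹) * (d / c) ^ k) ?_ ?_ ?_ ?_
  · refine (h.mul_left (2 * Real.pi * I)⁻¹).congr_fun fun k => ?_
    rw [circleIntegral.integral_const_mul]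
    have h1 := circleIntegral_laurent hc (a := b) (e := fun k => (k : ℤ)) (S := H)
      Nat.cast_injective (by simpa using hsum) (fun w hw => by
        simpa using hb w (by rw [mem_sphere_zero_iff_norm.mp hw]; exact hc1)) k
    have h2 : ∀ w : ℂ, (w⁻¹) ^ (k + 1) = w ^ (-(k : ℤ) - 1) := fun w => by
      rw [show (-(k : ℤ) - 1) = -((k + 1 : ℕ) : ℤ) by push_cast; ring, zpow_neg, zpow_natCast,
        inv_pow]
    simp only [h2, h1]
    have : (2 * Real.pi * I : ℂ) ≠ 0 := two_pi_I_ne_zero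
    field_simp
  · intro k
    exact continuousOn_const.mul (hHc.mul ((continuousOn_id.inv₀ hw0).pow _))
  · refine (summable_geometric_of_lt_one (by positivity) ?_).mul_left _
    rwa [div_lt_one hc]
  · intro k w hw
    have hw' := mem_sphere_zero_iff_norm.mp hw
    have hT : 0 ≤ ∑' k, ‖b k‖ * c ^ k := (norm_nonneg _).trans (hHb w hw)
    rw [norm_mul, norm_mul, norm_pow, norm_inv, hw']
    calc ‖N k‖ * (‖H w‖ * c⁻¹ ^ (k + 1))
        ≤ (D * d ^ k) * ((∑' k, ‖b k‖ * c ^ k) * c⁻¹ ^ (k + 1)) := by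
          refine mul_le_mul (hN k) ?_ (by positivity) ((norm_nonneg _).trans (hN k))
          exact mul_le_mul_of_nonneg_right (hHb w hw) (by positivity)
      _ = _ := by rw [div_pow, pow_succ, inv_pow]; field_simp
  · intro w hw
    refine ((hS w hw).mul_left (H w)).congr_fun fun k => ?_
    ring

/-! ### Moments along a path -/

/-- The moments of the weight `m` along `ζ`. -/
def moment (m ζ : ℝ → ℂ) (k : ℕ) : ℂ := ∫ u in (0 : ℝ)..1, m u * ζ u ^ k

/-- The function `∫ m (1 - ζ q) ^ (-s)`. -/
def binomTransform (m ζ : ℝ → ℂ) (s : ℂ) (q : ℂ) : ℂ :=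
  ∫ u in (0 : ℝ)..1, m u * (1 - ζ u * q) ^ (-s)

lemma exists_norm_weight_le {m : ℝ → ℂ} (hm : ContinuousOn m (uIcc 0 1)) :
    ∃ D : ℝ, 0 ≤ D ∧ ∀ u ∈ uIcc (0 : ℝ) 1, ‖m u‖ ≤ D := by
  obtain ⟨D, hD⟩ := isCompact_uIcc.exists_bound_of_continuousOn hm
  exact ⟨D, (norm_nonneg _).trans (hD 0 left_mem_uIcc), hD⟩

lemma exists_norm_moment_le {m ζ : ℝ → ℂ} (hm : ContinuousOn m (uIcc 0 1))
    (hζ3 : ∀ u ∈ uIcc (0 : ℝ) 1, ‖ζ u‖ ≤ 1 / 3) :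
    ∃ D : ℝ, 0 ≤ D ∧ ∀ k, ‖moment m ζ k‖ ≤ D * (1 / 3) ^ k := by
  obtain ⟨D, hD0, hD⟩ := exists_norm_weight_le hm
  refine ⟨D, hD0, fun k => ?_⟩
  have := intervalIntegral.norm_integral_le_of_norm_le_const (a := 0) (b := 1)
    (C := D * (1 / 3) ^ k) (f := fun u => m u * ζ u ^ k) fun u hu => ?_
  · simpa [moment] using this
  · have hu := uIoc_subset_uIcc hu
    rw [norm_mul, norm_pow]
    exact mul_le_mul (hD u hu) (pow_le_pow_left₀ (norm_nonneg _) (hζ3 u hu) k) (by positivity) hD0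

/-- Termwise integration, dominated by the absolutely convergent series at the point 1/3. -/
lemma hasSum_mul_moment {m ζ : ℝ → ℂ} (hm : ContinuousOn m (uIcc 0 1))
    (hζ : ContinuousOn ζ (uIcc 0 1)) (hζ3 : ∀ u ∈ uIcc (0 : ℝ) 1, ‖ζ u‖ ≤ 1 / 3)
    {b : ℕ → ℂ} {H : ℂ → ℂ}
    (hb : ∀ x : ℂ, ‖x‖ ≤ 1 / 3 → HasSum (fun k => b k * x ^ k) (H x)) :
    HasSum (fun k => b k * moment m ζ k) (∫ u in (0 : ℝ)..1, m u * H (ζ u)) := by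
  obtain ⟨D, hD0, hD⟩ := exists_norm_weight_le hm
  have hsum : Summable fun k => D * (‖b k‖ * (1 / 3) ^ k) := by
    have := (hb (1 / 3) (by simp)).summable.norm
    simpa using this.mul_left D
  have h := intervalIntegral.hasSum_integral_of_dominated_convergence (μ := volume) (a := 0)
    (b := 1) (F := fun k u => m u * (b k * ζ u ^ k)) (f := fun u => m u * H (ζ u))
    (fun k _ => D * (‖b k‖ * (1 / 3) ^ k)) ?_ ?_ ?_ ?_ ?_
  · refine h.congr_fun fun k => ?_
    rw [moment, ← intervalIntegral.integral_const_mul]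
    refine intervalIntegral.integral_congr fun u _ => ?_
    ring
  · intro k
    refine ContinuousOn.aestronglyMeasurable ?_ measurableSet_uIoc
    exact (hm.mul (continuousOn_const.mul (hζ.pow k))).mono uIoc_subset_uIcc
  · intro k
    refine Eventually.of_forall fun u hu => ?_
    have hu := uIoc_subset_uIcc hu
    rw [norm_mul, norm_mul, norm_pow]
    refine mul_le_mul (hD u hu) ?_ (by positivity) hD0
    exact mul_le_mul_of_nonneg_left (pow_le_pow_left₀ (norm_nonneg _) (hζ3 u hu) k)
      (norm_nonneg _)
  · exact Eventually.of_forall fun u _ => hsum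
  · exact intervalIntegrable_const
  · exact Eventually.of_forall fun u hu =>
      (hb _ (hζ3 u (uIoc_subset_uIcc hu))).mul_left _

/-- For |ζ| ≤ 1/3 and |q| < 3 the binomial series in ζq converges; its powers of ζ integrate to
moments. -/
lemma hasSum_binomTransform {m ζ : ℝ → ℂ} (hm : ContinuousOn m (uIcc 0 1))
    (hζ : ContinuousOn ζ (uIcc 0 1)) (hζ3 : ∀ u ∈ uIcc (0 : ℝ) 1, ‖ζ u‖ ≤ 1 / 3) (s : ℂ) {q : ℂ}
    (hq : ‖q‖ < 3) :
    HasSum (fun k => binomCoeff s k * moment m ζ k * q ^ k) (binomTransform m ζ s q) := by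
  have := hasSum_mul_moment hm hζ hζ3 (b := fun k => binomCoeff s k * q ^ k)
    (H := fun x => (1 - x * q) ^ (-s)) fun x hx => ?_
  · refine this.congr_fun fun k => ?_
    ring
  · have := hasSum_one_sub_cpow_neg s (x := x * q) (by
      rw [norm_mul]
      nlinarith [norm_nonneg q, norm_nonneg x])
    refine this.congr_fun fun k => ?_
    rw [mul_pow]; ring

lemma differentiableOn_binomTransform {m ζ : ℝ → ℂ} (hm : ContinuousOn m (uIcc 0 1))
    (hζ : ContinuousOn ζ (uIcc 0 1)) (hζ3 : ∀ u ∈ uIcc (0 : ℝ) 1, ‖ζ u‖ ≤ 1 / 3) (s : ℂ) :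
    DifferentiableOn ℂ (binomTransform m ζ s) (Metric.ball 0 3) := by
  obtain ⟨D, hD0, hD⟩ := exists_norm_moment_le hm hζ3
  intro q hq
  obtain ⟨R, hqR, hR⟩ := exists_between (mem_ball_zero_iff.mp hq)
  have hR0 : 0 < R := (norm_nonneg q).trans_lt hqR
  have hsum := summable_norm_mul_pow_of_hasSum
    (fun w hw => hasSum_one_sub_cpow_neg s hw) (c := R / 3) (by positivity) (by linarith)
  have hd := differentiableOn_tsum_of_summable_norm
    (F := fun k q => binomCoeff s k * moment m ζ k * q ^ k) (U := Metric.ball 0 R)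
    (hsum.mul_left D) (fun k => by fun_prop) Metric.isOpen_ball fun k w hw => by
      have hw : ‖w‖ ≤ R := (mem_ball_zero_iff.mp hw).le
      rw [norm_mul, norm_mul, norm_pow]
      calc ‖binomCoeff s k‖ * ‖moment m ζ k‖ * ‖w‖ ^ k
          ≤ ‖binomCoeff s k‖ * (D * (1 / 3) ^ k) * R ^ k := by
            gcongr
            exact hD k
        _ = _ := by rw [div_pow, div_pow]; ring
  have hq' : Metric.ball (0 : ℂ) R ∈ 𝓝 q := Metric.isOpen_ball.mem_nhds (by simpa using hqR)
  refine ((hd.differentiableAt hq').congr_of_eventuallyEq ?_).differentiableWithinAt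
  filter_upwards [hq'] with w hw
  exact (hasSum_binomTransform hm hζ hζ3 s ((mem_ball_zero_iff.mp hw).trans hR)).tsum_eq.symm

/-! ### The segment from `ρ - 1` to `ρ` -/

/-- The segment from `ρ - 1` to `ρ`. -/
def seg (u : ℝ) : ℂ := rho - 1 + (u : ℂ) * (rho - (rho - 1))

lemma continuous_seg : Continuous seg := by unfold seg; fun_prop

lemma seg_re (u : ℝ) : (seg u).re = u - 1 / 2 := by
  simp [seg, rho_eq_arc]; ring

lemma seg_im (u : ℝ) : (seg u).im = √3 / 2 := by
  have h1 : arcHeight (1 / 2) = √3 / 2 := by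
    rw [arcHeight, show (1 : ℝ) - (1 / 2) ^ 2 = 3 / 2 ^ 2 by norm_num,
      Real.sqrt_div (by norm_num), Real.sqrt_sq (by norm_num)]
  simp [seg, rho_eq_arc]
  rw [← h1]; norm_num

lemma seg_im_pos (u : ℝ) : 0 < (seg u).im := by rw [seg_im]; positivity

/-- The largest modulus, 2 - √3, occurs at the ends of the segment; 1/3 is a convenient larger
bound, for which √3 ≥ 1.6 would be enough. -/
lemma norm_diskCoord_seg_le {u : ℝ} (hu : u ∈ uIcc (0 : ℝ) 1) : ‖diskCoord (seg u)‖ ≤ 1 / 3 := by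
  rw [uIcc_of_le zero_le_one] at hu
  have h3 : √3 ^ 2 = 3 := Real.sq_sqrt (by norm_num)
  have h4 : 1.7 ≤ √3 := Real.le_sqrt_of_sq_le (by norm_num)
  rw [diskCoord, norm_div, div_le_iff₀ (norm_pos_iff.mpr (add_I_ne_zero (seg_im_pos u)))]
  refine le_of_sq_le_sq ?_ (by positivity)
  rw [mul_pow, ← normSq_eq_norm_sq, ← normSq_eq_norm_sq, normSq_apply, normSq_apply]
  simp only [sub_re, sub_im, add_re, add_im, I_re, I_im, seg_re, seg_im]
  nlinarith [hu.1, hu.2]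

/-- The weight `F z (1 - ζ) ^ s` on the segment. -/
def segWeight (F : ℂ → ℂ) (s : ℂ) (u : ℝ) : ℂ := F (seg u) * (1 - diskCoord (seg u)) ^ s

lemma one_sub_mem_slitPlane {x : ℂ} (hx : ‖x‖ < 1) : 1 - x ∈ slitPlane := by
  left
  have := (abs_le.mp (abs_re_le_norm x)).2
  simp; linarith

lemma continuousOn_diskCoord_seg : ContinuousOn (fun u => diskCoord (seg u)) (uIcc 0 1) :=
  differentiableOn_diskCoord.continuousOn.comp continuous_seg.continuousOn fun u _ => seg_im_pos u

lemma continuousOn_segWeight {F : ℂ → ℂ} (hF : DifferentiableOn ℂ F {z : ℂ | 0 < z.im}) (s : ℂ) :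
    ContinuousOn (segWeight F s) (uIcc 0 1) := by
  refine (hF.continuousOn.comp continuous_seg.continuousOn fun u _ => seg_im_pos u).mul ?_
  refine (continuousOn_const.sub continuousOn_diskCoord_seg).cpow continuousOn_const fun u hu => ?_
  exact one_sub_mem_slitPlane (norm_diskCoord_lt_one (seg_im_pos u))

/-! ### Branches of powers in the disk coordinate -/

lemma abs_arg_lt_pi_div_two_of_norm_lt {x : ℂ} (hx : ‖x‖ < 1) :
    |arg (1 - x)| < Real.pi / 2 := by
  rw [abs_arg_lt_pi_div_two_iff]
  left
  have := (abs_le.mp (abs_re_le_norm x)).2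
  simp; linarith

lemma eq_of_exp_eq {L L' : ℂ} (h : exp L = exp L') (h₁ : -Real.pi < L.im) (h₂ : L.im < Real.pi)
    (h₁' : -Real.pi < L'.im) (h₂' : L'.im < Real.pi) : L = L' := by
  rw [← log_exp h₁ h₂.le, ← log_exp h₁' h₂'.le, h]

lemma norm_add_I_lt {t : ℂ} (ht : t.im < 0) : ‖t + I‖ < ‖t - I‖ := by
  apply lt_of_pow_lt_pow_left₀ 2 (norm_nonneg _)
  rw [← normSq_eq_norm_sq, ← normSq_eq_norm_sq, normSq_apply, normSq_apply]
  simp only [sub_re, sub_im, add_re, add_im, I_re, I_im]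
  nlinarith

lemma sub_I_ne_zero {t : ℂ} (ht : t.im < 0) : t - I ≠ 0 :=
  ne_zero_of_im_neg (by simp; linarith)

/-- With ζ = `diskCoord z` and q = (t + i)/(t - i), one has (i - t)/(z - t) = (1 - ζ)/(1 - ζq). On
the left both arguments are in (0, π), on the right both are in (-π/2, π/2). So both differences of
logarithms have imaginary part in (-π, π) and coincide. -/
lemma cpow_sub_mul_cpow_sub {z t : ℂ} (hz : 0 < z.im) (ht : t.im < 0) (s : ℂ) :
    (I - t) ^ s * (z - t) ^ (-s) =
      (1 - diskCoord z) ^ s * (1 - diskCoord z * ((t + I) / (t - I))) ^ (-s) := by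
  have ht' := sub_I_ne_zero ht
  have hz' := add_I_ne_zero hz
  have hq : ‖(t + I) / (t - I)‖ < 1 := by
    rw [norm_div, div_lt_one (norm_pos_iff.mpr ht')]
    exact norm_add_I_lt ht
  have hd := norm_diskCoord_lt_one hz
  have hdq : ‖diskCoord z * ((t + I) / (t - I))‖ < 1 := by
    rw [norm_mul]; nlinarith [norm_nonneg (diskCoord z), norm_nonneg ((t + I) / (t - I))]
  have i1 : 0 < (I - t).im := by simp; linarith
  have i2 : 0 < (z - t).im := by simp; linarith
  have n1 := ne_zero_of_im_pos i1
  have n2 := ne_zero_of_im_pos i2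
  have n3 := one_sub_ne_zero_of_norm_lt hd
  have n4 := one_sub_ne_zero_of_norm_lt hdq
  have a3 := abs_lt.mp (abs_arg_lt_pi_div_two_of_norm_lt hd)
  have a4 := abs_lt.mp (abs_arg_lt_pi_div_two_of_norm_lt hdq)
  have key : log (I - t) - log (z - t) =
      log (1 - diskCoord z) - log (1 - diskCoord z * ((t + I) / (t - I))) := by
    apply eq_of_exp_eq
    · rw [exp_sub, exp_sub, exp_log n1, exp_log n2, exp_log n3, exp_log n4,
        div_eq_div_iff n2 n4, diskCoord]
      field_simp
      ring
    all_goals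
      simp only [sub_im, log_im]
      linarith [arg_pos_of_im_pos i1, arg_pos_of_im_pos i2, arg_lt_pi_of_im_pos i1,
        arg_lt_pi_of_im_pos i2]
  rw [cpow_def_of_ne_zero n1, cpow_def_of_ne_zero n2, cpow_def_of_ne_zero n3,
    cpow_def_of_ne_zero n4, ← exp_add, ← exp_add]
  congr 1
  linear_combination s * key

/-- The bases have product -2i. The sum of their arguments is in (-3π/2, π/2) and has negative sine,
hence lies in (-π, 0), so no branch correction occurs. Thus the weight on the segment exactly
compensates the factor in h⁺. -/
lemma cpow_one_sub_diskCoord_mul {z : ℂ} (hz : 0 < z.im) (s : ℂ) :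
    (1 - diskCoord z) ^ s * (-I - z) ^ s = (-2 * I) ^ s := by
  have hz' := add_I_ne_zero hz
  have hd := norm_diskCoord_lt_one hz
  have n1 := one_sub_ne_zero_of_norm_lt hd
  have i2 : (-I - z).im < 0 := by simp; linarith
  have n2 := ne_zero_of_im_neg i2
  have a1 := abs_lt.mp (abs_arg_lt_pi_div_two_of_norm_lt hd)
  have a2 := arg_neg_iff.mpr i2
  have a3 := neg_pi_lt_arg (-I - z)
  have hexp : exp (log (1 - diskCoord z) + log (-I - z)) = -2 * I := by
    rw [exp_add, exp_log n1, exp_log n2, diskCoord]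
    field_simp; ring
  have him : (log (1 - diskCoord z) + log (-I - z)).im =
      arg (1 - diskCoord z) + arg (-I - z) := by simp [log_im]
  have hsin : Real.sin (log (1 - diskCoord z) + log (-I - z)).im < 0 := by
    have h1 : (exp (log (1 - diskCoord z) + log (-I - z))).im < 0 := by rw [hexp]; simp
    rw [exp_im] at h1
    by_contra! h
    exact absurd h1 (not_lt.mpr (mul_nonneg (Real.exp_pos _).le h))
  rw [cpow_eq_exp_mul_of_exp_eq s hexp, cpow_def_of_ne_zero n1, cpow_def_of_ne_zero n2, ← exp_add,
    add_mul]
  · by_contra! h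
    have : 0 ≤ Real.sin ((log (1 - diskCoord z) + log (-I - z)).im + 2 * Real.pi) :=
      Real.sin_nonneg_of_nonneg_of_le_pi (by rw [him]; linarith) (by linarith)
    rw [Real.sin_add_two_pi] at this
    linarith
  · rw [him]; linarith

/-! ### Extensions -/

lemma isOpen_region (c : ℝ) : IsOpen {t : ℂ | c * ‖t + I‖ < ‖t - I‖} :=
  isOpen_lt (by fun_prop) (by fun_prop)

lemma mem_region_iff {c : ℝ} (hc : 0 < c) (hc1 : c < 1) (t : ℂ) :
    c * ‖t + I‖ < ‖t - I‖ ↔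
      2 * c / (1 - c ^ 2) < ‖t - (((1 + c ^ 2) / (1 - c ^ 2) : ℝ) : ℂ) * I‖ := by
  have h1 : 0 < 1 - c ^ 2 := by nlinarith
  rw [← sq_lt_sq₀ (by positivity) (norm_nonneg _), ← sq_lt_sq₀ (by positivity) (norm_nonneg _),
    mul_pow, ← normSq_eq_norm_sq, ← normSq_eq_norm_sq, ← normSq_eq_norm_sq, normSq_apply,
    normSq_apply, normSq_apply, ← sub_pos, ← sub_pos (b := (2 * c / (1 - c ^ 2)) ^ 2)]
  simp only [sub_re, sub_im, add_re, add_im, mul_re, mul_im, I_re, I_im, ofReal_re, ofReal_im]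
  have e : (t.re - ((1 + c ^ 2) / (1 - c ^ 2) * 0 - 0 * 1)) *
      (t.re - ((1 + c ^ 2) / (1 - c ^ 2) * 0 - 0 * 1)) +
      (t.im - ((1 + c ^ 2) / (1 - c ^ 2) * 1 + 0 * 0)) *
      (t.im - ((1 + c ^ 2) / (1 - c ^ 2) * 1 + 0 * 0)) - (2 * c / (1 - c ^ 2)) ^ 2 =
      ((t.re - 0) * (t.re - 0) + (t.im - 1) * (t.im - 1) -
        c ^ 2 * ((t.re + 0) * (t.re + 0) + (t.im + 1) * (t.im + 1))) / (1 - c ^ 2) := by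
    field_simp
    ring
  rw [e, div_pos_iff_of_pos_right h1]

/-- The region is the exterior of a Euclidean disk, hence the image of a product of connected sets
under polar coordinates. -/
lemma isPreconnected_region {c : ℝ} (hc : 0 < c) (hc1 : c < 1) :
    IsPreconnected {t : ℂ | c * ‖t + I‖ < ‖t - I‖} := by
  set κ : ℂ := (((1 + c ^ 2) / (1 - c ^ 2) : ℝ) : ℂ) * I with hκ
  have h1 : 0 < 1 - c ^ 2 := by nlinarith
  have himg : {t : ℂ | c * ‖t + I‖ < ‖t - I‖} = (fun q : ℝ × ℝ => κ + (q.1 : ℂ) * exp (q.2 * I)) ''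
      (Ioi (2 * c / (1 - c ^ 2)) ×ˢ univ) := by
    ext t
    rw [mem_ofPred_eq, mem_region_iff hc hc1]
    constructor
    · intro h
      refine ⟨(‖t - κ‖, arg (t - κ)), ⟨h, mem_univ _⟩, ?_⟩
      simp only [norm_mul_exp_arg_mul_I, add_sub_cancel]
    · rintro ⟨⟨ρ, θ⟩, ⟨h, -⟩, rfl⟩
      have hρ : 2 * c / (1 - c ^ 2) < ρ := h
      have : 0 < 2 * c / (1 - c ^ 2) := by positivity
      change _ < ‖κ + (ρ : ℂ) * exp (θ * I) - κ‖
      rwa [add_sub_cancel_left, norm_mul, norm_exp_ofReal_mul_I, mul_one, norm_real,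
        Real.norm_of_nonneg (by linarith)]
  rw [himg]
  refine (isPreconnected_Ioi.prod isPreconnected_univ).image _ (Continuous.continuousOn ?_)
  fun_prop

/-- Identity theorem on the smaller, connected region: both functions equal f⁻ near -i. It lets the
arbitrarily chosen `extension` be replaced by an explicit one. -/
lemma IsExtension.eq_of_norm_lt {s : ℝ} {f : ℂ → ℂ} {c c' : ℝ} {g g' : ℂ → ℂ}
    (h : IsExtension s f c g) (h' : IsExtension s f c' g') {t : ℂ}
    (ht : c * ‖t + I‖ < ‖t - I‖) (ht' : c' * ‖t + I‖ < ‖t - I‖) : g t = g' t := by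
  have hd : 0 < max c c' := lt_max_of_lt_left h.pos
  have hd1 : max c c' < 1 := max_lt h.lt_one h'.lt_one
  have hsub : ∀ a : ℝ, a ≤ max c c' → {t : ℂ | max c c' * ‖t + I‖ < ‖t - I‖} ⊆
      {t : ℂ | a * ‖t + I‖ < ‖t - I‖} := fun a ha t ht =>
    (mul_le_mul_of_nonneg_right ha (norm_nonneg _)).trans_lt ht
  have hmem : -I ∈ {t : ℂ | max c c' * ‖t + I‖ < ‖t - I‖} := by
    have : -I - I ≠ 0 := by
      intro h
      have := congrArg im h
      norm_num at this
    simpa using this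
  refine AnalyticOnNhd.eqOn_of_preconnected_of_eventuallyEq
    ((h.holo.mono (hsub _ (le_max_left _ _))).analyticOnNhd (isOpen_region _))
    ((h'.holo.mono (hsub _ (le_max_right _ _))).analyticOnNhd (isOpen_region _))
    (isPreconnected_region hd hd1) hmem ?_ (x := t) ?_
  · filter_upwards [(isOpen_lt continuous_im continuous_const).mem_nhds
      (show (-I).im < 0 by simp)] with w hw
    rw [h.eq_minusPart w hw, h'.eq_minusPart w hw]
  · rcases max_choice c c' with e | e
    · rw [mem_ofPred_eq, e]; exact ht
    · rw [mem_ofPred_eq, e]; exact ht'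

lemma minusPart_eichler {r : ℝ} {f : UpperHalfPlane → ℂ} {t : ℂ} (ht : t.im < 0) :
    minusPart (2 - r) (eichler r f (rho - 1) rho) t =
      binomTransform (segWeight (fun z => f (UpperHalfPlane.ofComplex z)) ((2 - r : ℝ) : ℂ))
        (fun u => diskCoord (seg u)) ((2 - r : ℝ) : ℂ) ((t + I) / (t - I)) := by
  rw [minusPart, eichler, binomTransform, ← intervalIntegral.integral_const_mul]
  refine intervalIntegral.integral_congr fun u _ => ?_
  have h := cpow_sub_mul_cpow_sub (seg_im_pos u) ht ((2 - r : ℝ) : ℂ)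
  rw [eichlerIntegrand, segWeight, ← seg, show (r : ℂ) - 2 = -((2 - r : ℝ) : ℂ) by push_cast; ring]
  linear_combination f (UpperHalfPlane.ofComplex (seg u)) * h

/-- The transform is holomorphic for |q| < 3, that is, for disk coordinate of modulus above 1/3, and
the radius 1/2 leaves room. At t = ∞ the value q = 1 is well inside; in u = -1/t one has q = (1 -
iu)/(1 + iu). -/
lemma isExtension_eichler {r : ℝ} {f : UpperHalfPlane → ℂ}
    (hf : DifferentiableOn ℂ (fun z => f (UpperHalfPlane.ofComplex z)) {z : ℂ | 0 < z.im}) :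
    IsExtension (2 - r) (eichler r f (rho - 1) rho) (1 / 2) (fun t => binomTransform
      (segWeight (fun z => f (UpperHalfPlane.ofComplex z)) ((2 - r : ℝ) : ℂ))
      (fun u => diskCoord (seg u)) ((2 - r : ℝ) : ℂ) ((t + I) / (t - I))) := by
  have hd := differentiableOn_binomTransform (continuousOn_segWeight hf ((2 - r : ℝ) : ℂ))
    continuousOn_diskCoord_seg (fun u hu => norm_diskCoord_seg_le hu) ((2 - r : ℝ) : ℂ)
  refine ⟨by norm_num, by norm_num, ?_, ?_, fun t ht => (minusPart_eichler ht).symm⟩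
  · have hne : ∀ t : ℂ, 1 / 2 * ‖t + I‖ < ‖t - I‖ → t - I ≠ 0 := fun t ht =>
      norm_pos_iff.mp ((by positivity : (0 : ℝ) ≤ 1 / 2 * ‖t + I‖).trans_lt ht)
    refine hd.comp (DifferentiableOn.div (by fun_prop) (by fun_prop) hne) fun t ht => ?_
    have h := norm_pos_iff.mpr (hne t ht)
    rw [mem_ofPred_eq] at ht
    rw [mem_ball_zero_iff, norm_div, div_lt_iff₀ h]
    linarith
  · refine ⟨fun u => binomTransform
      (segWeight (fun z => f (UpperHalfPlane.ofComplex z)) ((2 - r : ℝ) : ℂ))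
      (fun u => diskCoord (seg u)) ((2 - r : ℝ) : ℂ) ((1 - I * u) / (1 + I * u)), ?_, ?_⟩
    · refine AnalyticAt.fun_comp (g := binomTransform _ _ _) ?_ ?_
      · refine hd.analyticAt (Metric.isOpen_ball.mem_nhds ?_)
        simp
      · refine AnalyticAt.div (by fun_prop) (by fun_prop) (by simp)
    · have h0 : ∀ᶠ t : ℂ in cocompact ℂ, t ∈ ({0} : Set ℂ)ᶜ :=
        isCompact_singleton.compl_mem_cocompact
      filter_upwards [h0] with t ht
      have ht : t ≠ 0 := ht
      congr 1
      rw [show 1 - I * (-1 / t) = (t + I) / t by field_simp; ring,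
        show 1 + I * (-1 / t) = (t - I) / t by field_simp; ring, div_div_div_cancel_right₀ ht]

/-! ### The operator `σ_s` on extensions -/

lemma cayley_mem_region_iff {c : ℝ} {v : ℂ} (hv : ‖v‖ < 1) :
    c * ‖cayley v + I‖ < ‖cayley v - I‖ ↔ c < ‖v‖ := by
  have h : 0 < ‖2 * I / (1 - v)‖ :=
    norm_pos_iff.mpr (div_ne_zero (by simp) (one_sub_ne_zero_of_norm_lt hv))
  rw [cayley_add_I hv, cayley_sub_I hv, mul_div_right_comm (2 * I), norm_mul _ v, mul_comm c,
    mul_lt_mul_iff_right₀ h]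

lemma IsExtension.differentiableOn_comp_cayley {s : ℝ} {f : ℂ → ℂ} {c : ℝ} {g : ℂ → ℂ}
    (hg : IsExtension s f c g) :
    DifferentiableOn ℂ (fun v => g (cayley v)) {v : ℂ | c < ‖v‖ ∧ ‖v‖ < 1} :=
  hg.holo.comp (differentiableOn_cayley.mono fun v hv => by simpa using hv.2) fun _ hv =>
    (cayley_mem_region_iff hv.2).mpr hv.1

/-- In the coordinate v = 1/q the series Σ a_k q^k is a Laurent series in v, and the integral picks
out one coefficient. -/
lemma circleIntegral_extension {s : ℝ} {f : ℂ → ℂ} {c : ℝ} {g A : ℂ → ℂ} {a : ℕ → ℂ}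
    (hg : IsExtension s f c g) (hE : IsExtension s f (1 / 2) fun t => A ((t + I) / (t - I)))
    (hA : ∀ q : ℂ, ‖q‖ < 3 → HasSum (fun k => a k * q ^ k) (A q)) {c₁ : ℝ} (hc₁ : c < c₁)
    (hc₁' : c₁ < 1) (k : ℕ) :
    (∮ v in C(0, c₁), g (cayley v) * v ^ ((k : ℤ) - 1)) = 2 * Real.pi * I * a k := by
  have hc := hg.pos
  -- The given g is known to equal the explicit series only for |v| > 1/2, and c₁ may be smaller.
  -- The circle is first enlarged inside the annulus where g is holomorphic.
  set c₂ := max c₁ (3 / 4) with hc₂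
  have h1 : c₁ ≤ c₂ := le_max_left _ _
  have h2 : 3 / 4 ≤ c₂ := le_max_right _ _
  have h3 : c₂ < 1 := max_lt hc₁' (by norm_num)
  have hopen : IsOpen {v : ℂ | c < ‖v‖ ∧ ‖v‖ < 1} :=
    (isOpen_lt continuous_const continuous_norm).inter (isOpen_lt continuous_norm continuous_const)
  have hd : DifferentiableOn ℂ (fun v => g (cayley v) * v ^ ((k : ℤ) - 1))
      {v : ℂ | c < ‖v‖ ∧ ‖v‖ < 1} := by
    refine hg.differentiableOn_comp_cayley.mul fun v hv => ?_
    have hv0 : v ≠ 0 := norm_pos_iff.mp (hc.trans hv.1)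
    exact (differentiableAt_zpow.mpr (Or.inl hv0)).differentiableWithinAt
  rw [← circleIntegral_eq_of_differentiable_on_annulus_off_countable (hc.trans hc₁) h1
    countable_empty (hd.continuousOn.mono ?_) ?_]
  · have h4 := circleIntegral_laurent (c := c₂) (by linarith) (a := a) (e := fun j => -(j : ℤ))
      (S := fun v => g (cayley v)) (fun i j h => by simpa using h) ?_ ?_ k
    · simpa using h4
    · have := (hA ((c₂ : ℂ)⁻¹) ?_).summable.norm
      · refine this.congr fun j => ?_
        rw [norm_mul, norm_pow, norm_inv, norm_real, Real.norm_of_nonneg (by linarith), zpow_neg,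
          zpow_natCast, inv_pow]
      · rw [norm_inv, norm_real, Real.norm_of_nonneg (by linarith)]
        calc c₂⁻¹ ≤ (3 / 4)⁻¹ := inv_anti₀ (by norm_num) h2
          _ < 3 := by norm_num
    · intro v hv
      have hv' := mem_sphere_zero_iff_norm.mp hv
      have hv1 : ‖v‖ < 1 := by rw [hv']; exact h3
      have hv0 : v ≠ 0 := norm_pos_iff.mp (by rw [hv']; linarith)
      have hq : (cayley v + I) / (cayley v - I) = v⁻¹ := by
        have := one_sub_ne_zero_of_norm_lt hv1
        rw [cayley_add_I hv1, cayley_sub_I hv1]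
        have hI := I_ne_zero
        field_simp
      have h5 := hg.eq_of_norm_lt hE ((cayley_mem_region_iff hv1).mpr (by rw [hv']; linarith))
        ((cayley_mem_region_iff hv1).mpr (by rw [hv']; linarith))
      rw [hq] at h5
      rw [h5]
      refine (hA v⁻¹ ?_).congr_fun fun j => ?_
      · rw [norm_inv, hv']
        calc c₂⁻¹ ≤ (3 / 4)⁻¹ := inv_anti₀ (by norm_num) h2
          _ < 3 := by norm_num
      · rw [zpow_neg, zpow_natCast, inv_pow]
  · intro v hv
    have a1 : ‖v‖ ≤ c₂ := by simpa using hv.1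
    have a2 : c₁ ≤ ‖v‖ := by simpa using hv.2
    exact ⟨by linarith, by linarith⟩
  · intro v hv
    have a1 : ‖v‖ < c₂ := by simpa using hv.1.1
    have a2 : c₁ < ‖v‖ := by simpa using hv.1.2
    exact hd.differentiableAt (hopen.mem_nhds ⟨by linarith, by linarith⟩)

lemma continuousOn_hypergeometric {s : ℂ} (hs : ∀ k : ℕ, (k : ℂ) ≠ -s) {x : ℝ} (hx : 0 ≤ x)
    (hx1 : x < 1) :
    ContinuousOn (fun y : ℂ => ordinaryHypergeometric (1 : ℂ) 1 s y) (Metric.closedBall 0 x) := by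
  have : ContinuousOn (fun y : ℂ => ∑' k : ℕ, (binomCoeff s k)⁻¹ * y ^ k)
      (Metric.closedBall 0 x) := by
    refine continuousOn_tsum (fun k => by fun_prop) (summable_hypergeometric hs hx hx1)
      fun k y hy => ?_
    rw [norm_mul, norm_pow]
    exact mul_le_mul_of_nonneg_left
      (pow_le_pow_left₀ (norm_nonneg _) (mem_closedBall_zero_iff.mp hy) k) (norm_nonneg _)
  refine this.congr fun y hy => ?_
  exact (hasSum_hypergeometric hs ((mem_closedBall_zero_iff.mp hy).trans_lt hx1)).tsum_eq.symm

lemma binomCoeff_ne_zero {s : ℝ} {k : ℕ} (h : ∀ j < k, s ≠ -(j : ℝ)) :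
    binomCoeff (s : ℂ) k ≠ 0 := by
  refine div_ne_zero (fun h0 => ?_) (by exact_mod_cast k.factorial_ne_zero)
  obtain ⟨j, hj, hj'⟩ := (ascPochhammer_eval_eq_zero_iff k (s : ℂ)).mp h0
  refine h j hj ?_
  have : ((j : ℝ) : ℂ) = ((-s : ℝ) : ℂ) := by push_cast; exact hj'
  have := ofReal_injective this
  linarith

lemma extension_spec {s : ℝ} {f : ℂ → ℂ} (hf : IsAnalyticVector s f) :
    IsExtension s f (extension s f).1 (extension s f).2 := by
  rw [extension, dif_pos hf]
  exact hf.choose_spec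

/-- Expand the hypergeometric kernel termwise. The contour integral of the k-th term extracts the
coefficient (s)_k/k! · M_k of the extension, and the kernel coefficient k!/(s)_k reduces it to M_k.
-/
lemma hasSum_sigmaOp {s : ℝ} (hs : ¬ IsNonposInt s) {f A : ℂ → ℂ} {M : ℕ → ℂ}
    (hE : IsExtension s f (1 / 2) fun t => A ((t + I) / (t - I)))
    (hA : ∀ q : ℂ, ‖q‖ < 3 → HasSum (fun k => binomCoeff s k * M k * q ^ k) (A q)) {z : ℂ}
    (hz : 0 < z.im) (hzc : innerRadius s f < ‖diskCoord z‖) :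
    HasSum (fun k => M k * ((diskCoord z)⁻¹) ^ (k + 1)) (sigmaOp s f z) := by
  have hg := extension_spec ⟨(1 / 2, _), hE⟩
  have hrad : innerRadius s f = (extension s f).1 := if_neg hs
  rw [sigmaOp, if_neg hs, hrad]
  rw [hrad] at hzc
  set c := (extension s f).1
  set g := (extension s f).2
  set w := diskCoord z with hw
  have hw1 : ‖w‖ < 1 := norm_diskCoord_lt_one hz
  have hc := hg.pos
  set c₁ := (c + ‖w‖) / 2 with hc₁
  have hcc : c < c₁ := by linarith
  have hcw : c₁ < ‖w‖ := by linarith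
  have hc1 : c₁ < 1 := by linarith
  have hc0 : 0 < c₁ := hc.trans hcc
  have hw0 : w ≠ 0 := norm_pos_iff.mp (hc0.trans hcw)
  have hzI := add_I_ne_zero hz
  have hzI' : z - I ≠ 0 := fun h => hw0 (by rw [hw, diskCoord, h, zero_div])
  have hk : ∀ k : ℕ, (k : ℂ) ≠ -(s : ℂ) := fun k h => hs ⟨k, by
    have h1 : ((k : ℝ) : ℂ) = ((-s : ℝ) : ℂ) := by push_cast; exact h
    have := ofReal_injective h1
    linarith⟩
  have hx0 : 0 ≤ c₁ / ‖w‖ := by positivity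
  have hx1 : c₁ / ‖w‖ < 1 := (div_lt_one (norm_pos_iff.mpr hw0)).mpr hcw
  have harg : ∀ τ : ℂ, ((τ - I) * (z + I)) / ((τ + I) * (z - I)) = diskCoord τ / w := fun τ => by
    rw [hw, diskCoord, diskCoord, div_div_div_eq]
  have hwinv : (z + I) / (z - I) = w⁻¹ := by rw [hw, diskCoord, inv_div]
  simp only [harg, hwinv]
  have hdn : ∀ τ : ℂ, ‖diskCoord τ‖ = c₁ → τ - I ≠ 0 := fun τ h h0 => by
    rw [diskCoord, h0, zero_div, norm_zero] at h
    linarith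
  clear_value c₁ w
  have hlt : ∀ v ∈ Metric.sphere (0 : ℂ) c₁, ‖v‖ < 1 := fun v hv => by
    rw [mem_sphere_zero_iff_norm.mp hv]; exact hc1
  have hv0 : ∀ v ∈ Metric.sphere (0 : ℂ) c₁, v ≠ 0 := fun v hv =>
    norm_pos_iff.mp (by rw [mem_sphere_zero_iff_norm.mp hv]; exact hc0)
  have hgc : ContinuousOn (fun v => g (cayley v)) (Metric.sphere 0 c₁) :=
    hg.differentiableOn_comp_cayley.continuousOn.mono fun v hv =>
      ⟨by rw [mem_sphere_zero_iff_norm.mp hv]; exact hcc, hlt v hv⟩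
  obtain ⟨B, hB⟩ := (isCompact_sphere (0 : ℂ) c₁).exists_bound_of_continuousOn hgc
  have hsum := hasSum_circleIntegral hc0.le
    (f := fun k v => ((binomCoeff s k)⁻¹ * (w⁻¹) ^ k * (2 * I)⁻¹) *
      (g (cayley v) * v ^ ((k : ℤ) - 1)))
    (S := fun v => 2 * I / (1 - v) ^ 2 * (g (cayley v) *
      ordinaryHypergeometric (1 : ℂ) 1 (s : ℂ) (diskCoord (cayley v) / w) /
        (cayley v ^ 2 + 1)))
    (u := fun k => 2⁻¹ * B * c₁⁻¹ * (‖(binomCoeff s k)⁻¹‖ * (c₁ / ‖w‖) ^ k)) ?_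
    ((summable_hypergeometric hk hx0 hx1).mul_left _) ?_ ?_
  · rw [diskContour_eq hc0 hc1]
    · refine (hsum.mul_left (1 / (Real.pi : ℂ) * w⁻¹)).congr_fun fun k => ?_
      rw [circleIntegral.integral_const_mul, circleIntegral_extension hg hE hA hcc hc1 k, pow_succ]
      have hb := binomCoeff_ne_zero (s := s) (k := k) fun j _ h => hs ⟨j, h⟩
      have hI := I_ne_zero
      have hpi : (Real.pi : ℂ) ≠ 0 := by exact_mod_cast Real.pi_ne_zero
      field_simp
    · refine ((hg.holo.continuousOn.mono ?_).mul ?_).div (by fun_prop) ?_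
      · intro τ hτ
        have hτ0 := norm_pos_iff.mpr (add_I_ne_zero hτ.1)
        have h1 := hτ.2
        rw [diskCoord, norm_div, div_eq_iff hτ0.ne'] at h1
        rw [mem_ofPred_eq, h1]
        exact mul_lt_mul_of_pos_right hcc hτ0
      · refine (continuousOn_hypergeometric hk hx0 hx1).comp
          ((differentiableOn_diskCoord.continuousOn.mono fun τ hτ => hτ.1).div_const w)
          fun τ hτ => ?_
        rw [mem_closedBall_zero_iff, norm_div, hτ.2]
      · intro τ hτ
        rw [show τ ^ 2 + 1 = (τ + I) * (τ - I) by linear_combination I_sq]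
        exact mul_ne_zero (add_I_ne_zero hτ.1) (hdn τ hτ.2)
  · intro k
    exact continuousOn_const.mul (hgc.mul (continuousOn_id.zpow₀ _ fun v hv => Or.inl (hv0 v hv)))
  · intro k v hv
    have hv' := mem_sphere_zero_iff_norm.mp hv
    have h2 : ‖(2 : ℂ)‖ = 2 := by simp
    rw [norm_mul, norm_mul, norm_mul, norm_mul, norm_zpow, hv', norm_inv (2 * I), norm_mul 2 I,
      norm_I, mul_one, h2, norm_pow, norm_inv w, zpow_sub_one₀ hc0.ne', zpow_natCast, div_pow,
      inv_pow]
    have := mul_le_mul_of_nonneg_left (hB v hv)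
      (by positivity : 0 ≤ ‖(binomCoeff s k)⁻¹‖ * (‖w‖ ^ k)⁻¹ * 2⁻¹ * c₁ ^ k * c₁⁻¹)
    refine le_trans (le_of_eq ?_) (this.trans (le_of_eq ?_)) <;> ring
  · intro v hv
    have hx : ‖v / w‖ < 1 := by rw [norm_div, mem_sphere_zero_iff_norm.mp hv]; exact hx1
    have h1 := one_sub_ne_zero_of_norm_lt (hlt v hv)
    have h2 := hv0 v hv
    -- Under τ = `cayley v`, the form dτ/(τ² + 1) becomes dv/(2iv).
    have h3 : cayley v ^ 2 + 1 = -4 * v / (1 - v) ^ 2 := by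
      rw [show cayley v ^ 2 + 1 = (cayley v + I) * (cayley v - I) by linear_combination I_sq,
        cayley_add_I (hlt v hv), cayley_sub_I (hlt v hv), div_mul_div_comm]
      congr 1
      · linear_combination 4 * v * I_sq
      · ring
    rw [diskCoord_cayley (hlt v hv), h3]
    have := (hasSum_hypergeometric hk hx).mul_left ((2 * I)⁻¹ * g (cayley v) * v⁻¹)
    have h4 : (2 * I)⁻¹ = -I / 2 := by rw [mul_inv, inv_I]; ring
    have h5 : 2 * I / (1 - v) ^ 2 * (g (cayley v) * ordinaryHypergeometric (1 : ℂ) 1 (s : ℂ) (v / w) /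
        (-4 * v / (1 - v) ^ 2)) =
        (2 * I)⁻¹ * g (cayley v) * v⁻¹ * ordinaryHypergeometric (1 : ℂ) 1 (s : ℂ) (v / w) := by
      rw [h4]
      field_simp
      ring
    rw [h5]
    refine this.congr_fun fun k => ?_
    rw [zpow_sub_one₀ h2, zpow_natCast, div_pow, inv_pow]
    ring

lemma binomCoeff_neg_natCast_eq_zero {n k : ℕ} (h : n < k) :
    binomCoeff ((-(n : ℝ) : ℝ) : ℂ) k = 0 := by
  rw [binomCoeff, (ascPochhammer_eval_eq_zero_iff k _).mpr ⟨n, h, by push_cast; ring⟩, zero_div]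

/-- For s = -n the factor (s)_k vanishes when k > n, so the binomial expansion terminates. -/
lemma isPolExpansion_of_isExtension {n : ℕ} {f A : ℂ → ℂ} {M : ℕ → ℂ}
    (hE : IsExtension (-(n : ℝ)) f (1 / 2) fun t => A ((t + I) / (t - I)))
    (hA : ∀ q : ℂ, ‖q‖ < 3 →
      HasSum (fun k => binomCoeff ((-(n : ℝ) : ℝ) : ℂ) k * M k * q ^ k) (A q)) :
    IsPolExpansion (-(n : ℝ)) f fun k => binomCoeff ((-(n : ℝ) : ℝ) : ℂ) k * M k := by
  intro t ht
  rw [← hE.eq_minusPart t ht, neg_neg, Nat.floor_natCast]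
  have hq : ‖(t + I) / (t - I)‖ < 3 := by
    rw [norm_div, div_lt_iff₀ (norm_pos_iff.mpr (sub_I_ne_zero ht))]
    linarith [norm_add_I_lt ht, norm_nonneg (t - I)]
  refine (hA _ hq).unique (hasSum_sum_of_ne_finset_zero fun k hk => ?_)
  rw [binomCoeff_neg_natCast_eq_zero (by simpa using hk), zero_mul, zero_mul]

/-- A polynomial is determined by infinitely many values; thus the arbitrarily chosen `polCoeff`
agrees with explicit coefficients. -/
lemma IsPolExpansion.coeff_eq {s : ℝ} {f : ℂ → ℂ} {d d' : ℕ → ℂ} (h : IsPolExpansion s f d)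
    (h' : IsPolExpansion s f d') {k : ℕ} (hk : k < ⌊-s⌋₊ + 1) : d k = d' k := by
  set P : (ℕ → ℂ) → Polynomial ℂ := fun d =>
    ∑ k ∈ Finset.range (⌊-s⌋₊ + 1), Polynomial.C (d k) * Polynomial.X ^ k with hP
  have hcoeff : ∀ d : ℕ → ℂ, (P d).coeff k = d k := fun d => by
    rw [hP, Polynomial.finsetSum_coeff]
    simp only [Polynomial.coeff_C_mul, Polynomial.coeff_X_pow, mul_ite, mul_one, mul_zero]
    rw [Finset.sum_ite_eq, if_pos (Finset.mem_range.mpr hk)]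
  have heval : ∀ (d : ℕ → ℂ) q, (P d).eval q = ∑ k ∈ Finset.range (⌊-s⌋₊ + 1), d k * q ^ k :=
    fun d q => by simp [hP, Polynomial.eval_finsetSum]
  have : P d = P d' := by
    -- The points t = -(n + 1)i of the lower half-plane give the distinct values q = n/(n + 2).
    refine Polynomial.eq_of_infinite_eval_eq _ _ (infinite_of_injective_forall_mem
      (f := fun n : ℕ => (n : ℂ) / (n + 2)) ?_ fun n => ?_)
    · intro m n hmn
      have h1 : ∀ n : ℕ, (n : ℂ) + 2 ≠ 0 := fun n => by exact_mod_cast (by omega : n + 2 ≠ 0)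
      have h2 := (div_eq_div_iff (h1 m) (h1 n)).mp hmn
      have h3 : (m : ℂ) = n := by linear_combination h2 / 2
      exact_mod_cast h3
    · have h1 : (n : ℂ) + 2 ≠ 0 := by exact_mod_cast (by omega : n + 2 ≠ 0)
      have hi : (-((n : ℂ) + 1) * I).im < 0 := by simp; linarith [(n.cast_nonneg : (0 : ℝ) ≤ n)]
      have hq : (-((n : ℂ) + 1) * I + I) / (-((n : ℂ) + 1) * I - I) = n / (n + 2) := by
        have h2 := sub_I_ne_zero hi
        rw [div_eq_div_iff h2 h1]
        ring
      have h3 := (h _ hi).symm.trans (h' _ hi)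
      rw [hq, ← heval, ← heval] at h3
      exact h3
  rw [← hcoeff d, this, hcoeff]

/-- For k ≤ n the factor (-n)_k is nonzero and cancels as in the generic case. The moments with k >
n are already absent from f⁻, which accounts for the truncation. -/
lemma hasSum_sigmaOp_of_isNonposInt {n : ℕ} {f A : ℂ → ℂ} {M : ℕ → ℂ}
    (hE : IsExtension (-(n : ℝ)) f (1 / 2) fun t => A ((t + I) / (t - I)))
    (hA : ∀ q : ℂ, ‖q‖ < 3 →
      HasSum (fun k => binomCoeff ((-(n : ℝ) : ℝ) : ℂ) k * M k * q ^ k) (A q)) (z : ℂ) :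
    HasSum (fun k => (if k ≤ n then M k else 0) * ((diskCoord z)⁻¹) ^ (k + 1))
      (sigmaOp (-(n : ℝ)) f z) := by
  have hp := isPolExpansion_of_isExtension hE hA
  have hpol : IsPolVector (-(n : ℝ)) f := ⟨_, hp⟩
  have hd : IsPolExpansion (-(n : ℝ)) f (polCoeff (-(n : ℝ)) f) := by
    rw [polCoeff, dif_pos hpol]
    exact hpol.choose_spec
  rw [sigmaOp, if_pos ⟨n, rfl⟩]
  have hfl : ⌊-(-(n : ℝ))⌋₊ = n := by rw [neg_neg, Nat.floor_natCast]
  have hsum : ∑ k ∈ Finset.range (⌊-(-(n : ℝ))⌋₊ + 1), polCoeff (-(n : ℝ)) f k *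
      ((k.factorial : ℂ) / (ascPochhammer ℂ k).eval ((-(n : ℝ) : ℝ) : ℂ)) *
        ((z + I) / (z - I)) ^ (k + 1) =
      ∑ k ∈ Finset.range (n + 1), (if k ≤ n then M k else 0) * ((diskCoord z)⁻¹) ^ (k + 1) := by
    refine Finset.sum_congr (by rw [hfl]) fun k hk => ?_
    have hkn : k ≤ n := Nat.lt_succ_iff.mp (Finset.mem_range.mp hk)
    have hb := binomCoeff_ne_zero (s := -(n : ℝ)) (k := k) fun j hj h => by
      have h1 : (n : ℝ) = j := neg_injective h
      have : n = j := by exact_mod_cast h1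
      omega
    rw [hd.coeff_eq hp (by rw [hfl]; exact Finset.mem_range.mp hk), if_pos hkn, diskCoord, inv_div]
    congr 1
    have hinv : (k.factorial : ℂ) / (ascPochhammer ℂ k).eval ((-(n : ℝ) : ℝ) : ℂ) =
        (binomCoeff ((-(n : ℝ) : ℝ) : ℂ) k)⁻¹ := by rw [binomCoeff, inv_div]
    rw [hinv]
    field_simp
  rw [hsum]
  refine hasSum_sum_of_ne_finset_zero fun k hk => ?_
  have : ¬ k ≤ n := by simpa [Nat.lt_succ_iff] using hk
  rw [if_neg this, zero_mul]

/-! ### The duality as an integral along a path -/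

lemma differentiableOn_plusPart_comp_cayley (s : ℝ) {h : ℂ → ℂ}
    (hh : DifferentiableOn ℂ h {z : ℂ | 0 < z.im}) :
    DifferentiableOn ℂ (fun w => plusPart s h (cayley w)) (Metric.ball 0 1) := by
  have h1 : DifferentiableOn ℂ (plusPart s h) {z : ℂ | 0 < z.im} := by
    refine DifferentiableOn.mul (DifferentiableOn.cpow_const (by fun_prop) fun z hz => ?_) hh
    refine Or.inr (ne_of_lt ?_)
    have hz : 0 < z.im := hz
    simp only [sub_im, neg_im, I_im]
    linarith
  exact h1.comp differentiableOn_cayley fun w hw => cayley_im_pos (by simpa using hw)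

/-- If `σ_s f⁻ = Σ N_k w ^ (-k - 1)` and `h⁺ = Σ b_k w ^ k`, then `[h, f]_s = Σ N_k b_k`. -/
lemma hasSum_duality {s : ℝ} {h f : ℂ → ℂ} {N b : ℕ → ℂ} {D : ℝ} (hr0 : 0 ≤ innerRadius s f)
    (hr1 : innerRadius s f < 1) (hN : ∀ k, ‖N k‖ ≤ D * (1 / 3) ^ k)
    (hb : ∀ w : ℂ, ‖w‖ < 1 → HasSum (fun k => b k * w ^ k) (plusPart s h (cayley w)))
    (hh : DifferentiableOn ℂ (fun w => plusPart s h (cayley w)) (Metric.ball 0 1))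
    (hS : ∀ z : ℂ, 0 < z.im → innerRadius s f < ‖diskCoord z‖ →
      HasSum (fun k => N k * ((diskCoord z)⁻¹) ^ (k + 1)) (sigmaOp s f z)) :
    HasSum (fun k => N k * b k) (duality s h f) := by
  rw [duality]
  -- The contour radius is at least 1/2, even if the inner radius is 0, and so exceeds the decay
  -- rate 1/3 of N_k.
  set c := (1 + innerRadius s f) / 2 with hc
  have hc1 : c < 1 := by linarith
  have hc2 : 1 / 2 ≤ c := by linarith
  have hcr : innerRadius s f < c := by linarith
  clear_value c
  have hc0 : 0 < c := by linarith
  have hlt : ∀ w ∈ Metric.sphere (0 : ℂ) c, ‖w‖ < 1 := fun w hw => by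
    rw [mem_sphere_zero_iff_norm.mp hw]; exact hc1
  have hdisk : ContinuousOn diskCoord {z : ℂ | 0 < z.im ∧ ‖diskCoord z‖ = c} :=
    differentiableOn_diskCoord.continuousOn.mono fun z hz => hz.1
  have hsig : ContinuousOn (sigmaOp s f) {z : ℂ | 0 < z.im ∧ ‖diskCoord z‖ = c} := by
    have h1 : ContinuousOn (fun z => ∑' k, N k * ((diskCoord z)⁻¹) ^ (k + 1))
        {z : ℂ | 0 < z.im ∧ ‖diskCoord z‖ = c} := by
      refine continuousOn_tsum (u := fun k => D * c⁻¹ * (1 / 3 / c) ^ k) (fun k => ?_) ?_ ?_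
      · exact continuousOn_const.mul ((hdisk.inv₀ fun z hz =>
          norm_pos_iff.mp (by rw [hz.2]; exact hc0)).pow _)
      · refine (summable_geometric_of_lt_one (by positivity) ?_).mul_left _
        rw [div_lt_one hc0]; linarith
      · intro k z hz
        rw [norm_mul, norm_pow, norm_inv, hz.2]
        refine (mul_le_mul_of_nonneg_right (hN k) (by positivity)).trans (le_of_eq ?_)
        rw [div_pow _ c, pow_succ, inv_pow]; field_simp
    exact h1.congr fun z hz => (hS z hz.1 (by rw [hz.2]; exact hcr)).tsum_eq.symm
  have hplus : ContinuousOn (plusPart s h) {z : ℂ | 0 < z.im ∧ ‖diskCoord z‖ = c} := by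
    have h1 := hh.continuousOn.comp hdisk fun z hz => by simpa using norm_diskCoord_lt_one hz.1
    refine h1.congr fun z hz => ?_
    rw [Function.comp, cayley_diskCoord hz.1]
  have hF : ContinuousOn (fun z => plusPart s h z * sigmaOp s f z / (z + I) ^ 2)
      {z : ℂ | 0 < z.im ∧ ‖diskCoord z‖ = c} :=
    (hplus.mul hsig).div (by fun_prop) fun z hz => pow_ne_zero 2 (add_I_ne_zero hz.1)
  rw [diskContour_eq hc0 hc1 hF]
  have key := hasSum_circleIntegral_mul (d := 1 / 3) (S := fun w => sigmaOp s f (cayley w))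
    (by norm_num) (by linarith) hc1 hN hb fun w hw => by
      have h1 := hS (cayley w) (cayley_im_pos (hlt w hw))
      rw [diskCoord_cayley (hlt w hw)] at h1
      exact h1 (by rw [mem_sphere_zero_iff_norm.mp hw]; exact hcr)
  have hpi : (Real.pi : ℂ) ≠ 0 := by exact_mod_cast Real.pi_ne_zero
  -- In the disk coordinate dz/(z + i)² is dw/(2i), because z + i = 2i/(1 - w).
  have e : (∮ w in C(0, c), 2 * I / (1 - w) ^ 2 *
      (plusPart s h (cayley w) * sigmaOp s f (cayley w) / (cayley w + I) ^ 2)) =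
      (2 * I)⁻¹ * ∮ w in C(0, c), plusPart s h (cayley w) * sigmaOp s f (cayley w) := by
    rw [← circleIntegral.integral_const_mul]
    refine circleIntegral.integral_congr hc0.le fun w hw => ?_
    have h1 := one_sub_ne_zero_of_norm_lt (hlt w hw)
    have hI := I_ne_zero
    simp only [cayley_add_I (hlt w hw)]
    field_simp
  rw [e, ← mul_assoc, show 1 / (Real.pi : ℂ) * (2 * I)⁻¹ = (2 * Real.pi * I : ℂ)⁻¹ by
    rw [mul_inv, mul_inv, mul_inv]; ring]
  exact key

lemma innerRadius_mem {s : ℝ} {f : ℂ → ℂ} (hf : IsAnalyticVector s f) :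
    0 ≤ innerRadius s f ∧ innerRadius s f < 1 := by
  rw [innerRadius]
  split_ifs
  · norm_num
  · exact ⟨(extension_spec hf).pos.le, (extension_spec hf).lt_one⟩

/-- Both sides are sums of b_k M_k, one by coefficient extraction on the contour, the other by
expanding h⁺ along the path. For s = -n the first sum stops at n, and `hpol` makes the second stop
there as well. -/
lemma duality_eq_integral {s : ℝ} {h f : ℂ → ℂ} {m ζ : ℝ → ℂ} (hm : ContinuousOn m (uIcc 0 1))
    (hζ : ContinuousOn ζ (uIcc 0 1)) (hζ3 : ∀ u ∈ uIcc (0 : ℝ) 1, ‖ζ u‖ ≤ 1 / 3)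
    (hE : IsExtension s f (1 / 2) fun t => binomTransform m ζ s ((t + I) / (t - I)))
    (hh : DifferentiableOn ℂ h {z : ℂ | 0 < z.im})
    (hpol : ∀ n : ℕ, s = -(n : ℝ) → ∃ b : ℕ → ℂ, (∀ k, n < k → b k = 0) ∧
      ∀ w : ℂ, ‖w‖ < 1 → HasSum (fun k => b k * w ^ k) (plusPart s h (cayley w))) :
    duality s h f = ∫ u in (0 : ℝ)..1, m u * plusPart s h (cayley (ζ u)) := by
  obtain ⟨hr0, hr1⟩ := innerRadius_mem ⟨(1 / 2, _), hE⟩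
  obtain ⟨D, hD0, hD⟩ := exists_norm_moment_le hm hζ3
  have hH := differentiableOn_plusPart_comp_cayley s hh
  have hA : ∀ q : ℂ, ‖q‖ < 3 → HasSum (fun k => binomCoeff s k * moment m ζ k * q ^ k)
      (binomTransform m ζ s q) := fun q hq => hasSum_binomTransform hm hζ hζ3 s hq
  by_cases hs : IsNonposInt s
  · obtain ⟨n, rfl⟩ := hs
    obtain ⟨b, hb0, hb⟩ := hpol n rfl
    have h1 := hasSum_duality (N := fun k => if k ≤ n then moment m ζ k else 0) hr0 hr1
      (fun k => by
        split_ifs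
        · exact hD k
        · rw [norm_zero]; positivity) hb hH
      fun z _ _ => hasSum_sigmaOp_of_isNonposInt hE hA z
    have h2 := hasSum_mul_moment hm hζ hζ3 fun x hx => hb x (by linarith)
    refine h1.unique (h2.congr_fun fun k => ?_)
    split_ifs with hk
    · ring
    · rw [hb0 k (by omega), zero_mul, zero_mul]
  · obtain ⟨b, hb⟩ := exists_hasSum_of_differentiableOn hH
    have h1 := hasSum_duality hr0 hr1 hD hb hH fun z hz hzc => hasSum_sigmaOp hs hE hA hz hzc
    have h2 := hasSum_mul_moment hm hζ hζ3 fun x hx => hb x (by linarith)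
    exact h1.unique (h2.congr_fun fun k => mul_comm _ _)

/-! ### The cocycle values -/

/-- For y > 1 both |1 - y|/2 and |1 + y|/2 are at most y, so |F(iy)|y^n is a dominating function. -/
lemma RapidDecay.integrableOn_conj_mul_binomial {F : ℂ → ℂ} (hF : RapidDecay F) {n k : ℕ}
    (hk : k ≤ n) :
    IntegrableOn (fun y : ℝ => conj (F (y * I)) *
      (((1 - y) / 2 : ℂ) ^ k * ((1 + y) / 2 : ℂ) ^ (n - k))) (Ioi 1) := by
  have h := hF.integrableOn_vertical n (t := 0) (x := 0) (y₀ := 1) (by simp) (by simp) one_pos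
  have hc : ContinuousOn (fun y : ℝ => F (y * I)) (Ioi 1) :=
    hF.holo.continuousOn.comp (by fun_prop) fun y hy => by
      simpa using one_pos.trans (mem_Ioi.mp hy)
  refine Integrable.mono h ?_ ?_
  · exact ((continuous_conj.comp_continuousOn hc).mul (by fun_prop)).aestronglyMeasurable
      measurableSet_Ioi
  · refine (ae_restrict_iff' measurableSet_Ioi).mpr (Eventually.of_forall fun y hy => ?_)
    have hy : 1 < y := hy
    rw [norm_mul, norm_mul, norm_conj, norm_mul, norm_pow, norm_pow]
    simp only [ofReal_zero, zero_add, sub_zero, ofReal_natCast, cpow_natCast, norm_pow, norm_mul,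
      norm_I, mul_one, norm_real, Real.norm_of_nonneg (zero_le_one.trans hy.le)]
    refine mul_le_mul_of_nonneg_left ?_ (norm_nonneg _)
    have e1 : ‖(1 - y) / 2‖ ≤ y := by
      rw [Real.norm_eq_abs, abs_le]; constructor <;> linarith
    have e2 : ‖(1 + y) / 2‖ ≤ y := by
      rw [Real.norm_eq_abs, abs_le]; constructor <;> linarith
    have f1 : ((1 - y) / 2 : ℂ) = (((1 - y) / 2 : ℝ) : ℂ) := by push_cast; rfl
    have f2 : ((1 + y) / 2 : ℂ) = (((1 + y) / 2 : ℝ) : ℂ) := by push_cast; rfl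
    rw [f1, f2, norm_real, norm_real]
    calc _ ≤ y ^ k * y ^ (n - k) := mul_le_mul (pow_le_pow_left₀ (norm_nonneg _) e1 k)
          (pow_le_pow_left₀ (norm_nonneg _) e2 _) (by positivity) (by positivity)
      _ = y ^ n := by rw [← pow_add, Nat.add_sub_cancel' hk]

/-- With r - 2 = n, the kernel of h⁺ at τ = iy is ((-iy - z)/(-i - z))^n = ((1 - y)w/2 + (1 +
y)/2)^n, a polynomial of degree at most n in w; the binomial theorem gives the coefficients. -/
lemma RapidDecay.exists_hasSum_plusPart_knoppAtI {F : ℂ → ℂ} (hF : RapidDecay F) (n : ℕ) :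
    ∃ b : ℕ → ℂ, (∀ k, n < k → b k = 0) ∧ ∀ w : ℂ, ‖w‖ < 1 →
      HasSum (fun k => b k * w ^ k) (plusPart (-(n : ℝ)) (knoppAtI F n) (cayley w)) := by
  refine ⟨fun k => (∫ y in Ioi (1 : ℝ), conj (F (y * I)) *
    (((1 - y) / 2 : ℂ) ^ k * ((1 + y) / 2 : ℂ) ^ (n - k))) * (-I * n.choose k), fun k hk => ?_,
    fun w hw => ?_⟩
  · simp [Nat.choose_eq_zero_of_lt hk]
  · have hw1 := one_sub_ne_zero_of_norm_lt hw
    have hne : -I - cayley w ≠ 0 := by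
      rw [show -I - cayley w = -(cayley w + I) by ring, cayley_add_I hw]
      exact neg_ne_zero.mpr (div_ne_zero (by simp) hw1)
    have hval : plusPart (-(n : ℝ)) (knoppAtI F n) (cayley w) =
        ∫ y in Ioi (1 : ℝ), conj (F (y * I)) * ((1 - y) / 2 * w + (1 + y) / 2) ^ n * (-I) := by
      rw [plusPart, knoppAtI, verticalIntegral, ← integral_conj, ← integral_const_mul, I_im]
      refine setIntegral_congr_fun measurableSet_Ioi fun y _ => ?_
      have h1 : (-(y * I) - cayley w) / (-I - cayley w) = (1 - y) / 2 * w + (1 + y) / 2 := by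
        rw [div_eq_iff hne, cayley]
        field_simp
        ring
      rw [← h1, div_pow]
      simp only [I_re, ofReal_zero, zero_add, ofReal_neg, ofReal_natCast, cpow_neg, cpow_natCast,
        map_mul, map_pow, map_sub, conj_I, conj_ofReal, conj_conj, mul_neg]
      field_simp
    have hsum : ∀ y : ℝ, conj (F (y * I)) * ((1 - y) / 2 * w + (1 + y) / 2) ^ n * (-I) =
        ∑ k ∈ Finset.range (n + 1), conj (F (y * I)) *
          (((1 - y) / 2 : ℂ) ^ k * ((1 + y) / 2 : ℂ) ^ (n - k)) * (-I * n.choose k * w ^ k) := by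
      intro y
      rw [add_pow, Finset.mul_sum, Finset.sum_mul]
      refine Finset.sum_congr rfl fun k _ => ?_
      rw [mul_pow]; ring
    rw [hval]
    simp only [hsum]
    rw [integral_finsetSum _ fun k hk => (hF.integrableOn_conj_mul_binomial
      (Nat.lt_succ_iff.mp (Finset.mem_range.mp hk))).mul_const _]
    simp only [integral_mul_const]
    have := hasSum_sum_of_ne_finset_zero (L := SummationFilter.unconditional ℕ)
      (f := fun k => (∫ y in Ioi (1 : ℝ), conj (F (y * I)) *
        (((1 - y) / 2 : ℂ) ^ k * ((1 + y) / 2 : ℂ) ^ (n - k))) * (-I * n.choose k * w ^ k))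
      (s := Finset.range (n + 1)) fun k hk => by
        simp [Nat.choose_eq_zero_of_lt (by simpa using hk : n < k)]
    refine this.congr_fun fun k => ?_
    ring

lemma knoppInfty_I (r : ℝ) (f : UpperHalfPlane → ℂ) :
    knoppInfty r f I = knoppAtI (fun z => f (UpperHalfPlane.ofComplex z)) (r - 2) := by
  funext z
  simp only [knoppInfty, iota, knoppAtI, eichlerInfty, verticalIntegral, eichlerIntegrand,
    ofReal_sub, ofReal_ofNat]

/-- The duality contributes (-2i)^(2 - r) times the segment integral, and Stokes' theorem gives that
integral as -2i(-2i)^(r - 2) times the Petersson product; the two powers cancel. -/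
lemma IsCuspForm.duality_eq {r : ℝ} {v : SL(2, ℤ) → ℂˣ} {f₁ f₂ : UpperHalfPlane → ℂ}
    (hv : IsMultiplierSystem r v) (hf₁ : IsCuspForm r v f₁) (hf₂ : IsCuspForm r v f₂) :
    duality (2 - r) (knoppInfty r f₂ I) (eichler r f₁ (rho - 1) rho) =
      -2 * I * peterssonProduct r f₁ f₂ := by
  have h₁ := hf₁.rapidDecay
  have h₂ := hf₂.rapidDecay
  obtain ⟨hS, hT⟩ := hv.norm_S_and_norm_T
  rw [knoppInfty_I]
  rw [duality_eq_integral (continuousOn_segWeight h₁.holo _) continuousOn_diskCoord_seg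
    (fun u hu => norm_diskCoord_seg_le hu) (isExtension_eichler h₁.holo)
    (h₂.differentiableOn_knoppAtI _) fun n hn => by
      rw [show r - 2 = n by linarith, hn]
      exact h₂.exists_hasSum_plusPart_knoppAtI n]
  have hP := petersson_eq_integral_segment (p := r - 2) h₁ h₂ hS hT
    (fun z hz => by rw [sub_add_cancel]; exact hf₁.apply_neg_inv hz)
    (fun z hz => by rw [sub_add_cancel]; exact hf₂.apply_neg_inv hz)
    (fun z hz => hf₁.apply_add_one hz) (fun z hz => hf₂.apply_add_one hz)
  have hint : (∫ u in (0 : ℝ)..1,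
      segWeight (fun z => f₁ (UpperHalfPlane.ofComplex z)) ((2 - r : ℝ) : ℂ) u *
        plusPart (2 - r) (knoppAtI (fun z => f₂ (UpperHalfPlane.ofComplex z)) (r - 2))
          (cayley (diskCoord (seg u)))) =
      (-2 * I) ^ ((2 - r : ℝ) : ℂ) * ∫ u in (0 : ℝ)..1,
        f₁ (UpperHalfPlane.ofComplex (rho - 1 + (u : ℂ) * (rho - (rho - 1)))) *
          knoppAtI (fun z => f₂ (UpperHalfPlane.ofComplex z)) (r - 2)
            (rho - 1 + (u : ℂ) * (rho - (rho - 1))) * (rho - (rho - 1)) := by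
    rw [← intervalIntegral.integral_const_mul]
    refine intervalIntegral.integral_congr fun u _ => ?_
    simp only [cayley_diskCoord (seg_im_pos u), segWeight, plusPart]
    rw [← cpow_one_sub_diskCoord_mul (seg_im_pos u), seg]
    ring
  rw [hint, ← hP, ← mul_assoc, peterssonProduct]
  simp only [UpperHalfPlane.ofComplex_apply, sub_add_cancel]
  rw [show (2 - r : ℝ) = -(r - 2) by ring, ofReal_neg, cpow_neg]
  have : (-2 * I : ℂ) ^ ((r - 2 : ℝ) : ℂ) ≠ 0 := by
    rw [Ne, cpow_eq_zero_iff]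
    simp
  field_simp

end Haberland

end

/-! ### The theorem -/

theorem theorem5p1 (r : ℝ) (hr : 0 < r) (v : SL(2, ℤ) → ℂˣ)
    (hv : Haberland.IsMultiplierSystem r v) (f₁ f₂ : UpperHalfPlane → ℂ)
    (hf₁ : Haberland.IsCuspForm r v f₁) (hf₂ : Haberland.IsCuspForm r v f₂) :
    -- convergence of the integral along the ray from `i` to the cusp
    (∀ t : ℂ, t.im < 0 → IntegrableOn
      (fun y : ℝ => Haberland.eichlerIntegrand r f₂ t ((y : ℂ) * Complex.I)) (Set.Ioi 1)) ∧
    -- the two cocycle values lie in the modules on which the duality is defined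
    Haberland.InDualityDomain (2 - r) (Haberland.knoppInfty r f₂ Complex.I)
      (Haberland.eichler r f₁ (Haberland.rho - 1) Haberland.rho) ∧
    -- convergence of the Petersson integral
    IntegrableOn (fun τ : UpperHalfPlane => f₁ τ * conj (f₂ τ) * ((τ.im ^ r : ℝ) : ℂ)) 𝒟 ∧
    Haberland.duality (2 - r) (Haberland.knoppInfty r f₂ Complex.I)
        (Haberland.eichler r f₁ (Haberland.rho - 1) Haberland.rho) =
      -2 * Complex.I * Haberland.peterssonProduct r f₁ f₂ := by
  have h₁ := hf₁.rapidDecay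
  have h₂ := hf₂.rapidDecay
  have hE := Haberland.isExtension_eichler (r := r) h₁.holo
  refine ⟨fun t ht => ?_, ⟨?_, ⟨(1 / 2, _), hE⟩, ?_⟩, ?_,
    Haberland.IsCuspForm.duality_eq hv hf₁ hf₂⟩
  · have := h₂.integrableOn_vertical (r - 2) ht.le (x := 0) (by simp) one_pos
    simpa [Haberland.eichlerIntegrand] using this
  · rw [Haberland.knoppInfty_I]
    exact h₂.differentiableOn_knoppAtI _
  · rintro ⟨n, hn⟩
    rw [hn] at hE ⊢
    exact ⟨_, Haberland.isPolExpansion_of_isExtension hE fun q hq =>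
      Haberland.hasSum_binomTransform (Haberland.continuousOn_segWeight h₁.holo _)
        Haberland.continuousOn_diskCoord_seg (fun u hu => Haberland.norm_diskCoord_seg_le hu) _ hq⟩
  · simpa using Haberland.integrableOn_petersson h₁ h₂ (r - 2)
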